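/- Let $\mathbb{K}\in\{\mathbb{R},\mathbb{C}\}$, $n\in\mathbb{N}$ and $a<b$. Let $P_1\in\mathbb{K}^{n\times n}$ be invertible and self-adjoint, let $P_0\in L^\infty([a,b],\mathbb{K}^{n\times n})$, and let $\widetilde W_B\in\mathbb{K}^{n\times 2n}$ have full rank $n$. Let $E_+$ and $E_-$ be the subspaces of $\mathbb{K}^n$ spanned by the eigenvectors of $P_1$ to positive and to negative eigenvalues, respectively, let $\iota_\pm:E_\pm\to\mathbb{K}^n$ be the embeddings, and put $$P_\pm:=\iota_\pm\iota_\pm^*,\qquad P_1^\pm:=\iota_\pm^*(\pm P_1)\iota_\pm,\qquad Q_\pm:=\iota_\pm\,(P_1^\pm)^{1/2}\,\iota_\pm^* ,$$ where $(\cdot)^{1/2}$ is the nonnegative square root. Then the following holds. 1. There are unique matrices $J,L\in\mathbb{K}^{n\times n}$ with $$\widetilde W_B=\begin{pmatrix} JQ_+-LQ_- & JQ_--LQ_+\end{pmatrix},$$ and they are given by $J=\widetilde W_B\begin{bmatrix}Q_+\\-Q_-\end{bmatrix}P_1^{-1}$ and $L=\widetilde W_B\begin{bmatrix}Q_-\\-Q_+\end{bmatrix}P_1^{-1}$.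 2. The following statements are equivalent: (a) There are matrices $K,M\in\mathbb{K}^{n\times n}$ with $K$ invertible and $\widetilde W_B=K\begin{pmatrix}Q_+-MQ_- & Q_--MQ_+\end{pmatrix}$. (b) The matrix $\widetilde W_B\begin{bmatrix}P_+\\P_-\end{bmatrix}$ is invertible. (c) The operator $A_I:=P_1\frac{\partial}{\partial\xi}+P_0$ with domain $$\mathrm{D}(A_I)=\left\{x\in H^1([a,b],\mathbb{K}^n)\ \middle|\ \widetilde W_B\begin{bmatrix}x(b)\\x(a)\end{bmatrix}=0\right\}$$ is the infinitesimal generator of a $C_0$-semigroup on $L^2([a,b],\mathbb{K}^n)$. (d) The matrix $J$ from Part 1 is invertible. Furthermore, for every pair $K,M$ as in (a) one has $K=\widetilde W_B\begin{bmatrix}Q_+\\-Q_-\end{bmatrix}P_1^{-1}$ and $M=K^{-1}\widetilde W_B\begin{bmatrix}Q_-\\-Q_+\end{bmatrix}P_1^{-1}$. -/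

import Mathlib

open MeasureTheory Filter Topology
open scoped NNReal ENNReal Matrix

noncomputable section

namespace HBCS

section Semigroup

variable {𝕜 : Type*} [RCLike 𝕜] {X : Type*} [NormedAddCommGroup X] [NormedSpace 𝕜 X]

/-- `T` is a strongly continuous (`C₀`) semigroup of bounded linear operators on `X`. -/
structure IsC0Semigroup (T : ℝ≥0 → X →L[𝕜] X) : Prop where
  map_zero : T 0 = ContinuousLinearMap.id 𝕜 X
  map_add : ∀ s t : ℝ≥0, T (s + t) = (T s).comp (T t)
  tendsto_zero : ∀ x : X, Tendsto (fun t : ℝ≥0 => T t x) (𝓝[>] 0) (𝓝 x)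

/-- `A` is the infinitesimal generator of `T`: `x ∈ D(A)` with `A x = y` if and only if
`(T(t) x - x) / t → y` as `t ↓ 0`. -/
def IsInfinitesimalGenerator (A : X →ₗ.[𝕜] X) (T : ℝ≥0 → X →L[𝕜] X) : Prop :=
  ∀ x y : X, (x, y) ∈ A.graph ↔
    Tendsto (fun t : ℝ≥0 => (((t : ℝ) : 𝕜)⁻¹) • (T t x - x)) (𝓝[>] 0) (𝓝 y)

/-- `A` is the infinitesimal generator of some `C₀`-semigroup on `X`. -/
def GeneratesC0Semigroup (A : X →ₗ.[𝕜] X) : Prop :=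
  ∃ T : ℝ≥0 → X →L[𝕜] X, IsC0Semigroup T ∧ IsInfinitesimalGenerator A T

end Semigroup

section SquareRoot

variable {𝕜 : Type*} [RCLike 𝕜] {F : Type*} [NormedAddCommGroup F] [InnerProductSpace 𝕜 F]
  [FiniteDimensional 𝕜 F]

open Classical in
/-- The nonnegative square root of a nonnegative self-adjoint operator `T` on a finite-dimensional
inner product space: `∑ i, √λᵢ ⟨eᵢ, ·⟩ eᵢ` for an orthonormal eigenbasis `eᵢ` of `T` with
eigenvalues `λᵢ` (and `0` for an operator that is not self-adjoint). -/
def opSqrt (T : F →ₗ[𝕜] F) : F →ₗ[𝕜] F :=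
  if h : T.IsSymmetric then
    ∑ i, ((√(h.eigenvalues rfl i) : ℝ) : 𝕜) •
      (InnerProductSpace.rankOne 𝕜 (h.eigenvectorBasis rfl i) (h.eigenvectorBasis rfl i) :
        F →ₗ[𝕜] F)
  else 0

theorem opSqrt_apply_basis {T : F →ₗ[𝕜] F} (h : T.IsSymmetric)
    (j : Fin (Module.finrank 𝕜 F)) :
    opSqrt T (h.eigenvectorBasis rfl j) =
      ((√(h.eigenvalues rfl j) : ℝ) : 𝕜) • h.eigenvectorBasis rfl j := by
  classical
  rw [opSqrt, dif_pos h]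
  simp [LinearMap.sum_apply, (h.eigenvectorBasis rfl).inner_eq_ite]

/-- The operator `opSqrt T` is a square root of `T`. -/
theorem opSqrt_mul_self {T : F →ₗ[𝕜] F} (h : T.IsPositive) : opSqrt T ∘ₗ opSqrt T = T := by
  refine (h.isSymmetric.eigenvectorBasis rfl).toBasis.ext fun j => ?_
  have h0 : 0 ≤ h.isSymmetric.eigenvalues rfl j := h.nonneg_eigenvalues rfl j
  simp only [OrthonormalBasis.coe_toBasis, LinearMap.comp_apply, opSqrt_apply_basis, map_smul,
    smul_smul, LinearMap.IsSymmetric.apply_eigenvectorBasis]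
  rw [← RCLike.ofReal_mul, Real.mul_self_sqrt h0]

/-- The operator `opSqrt T` is nonnegative. -/
theorem opSqrt_isPositive (T : F →ₗ[𝕜] F) : (opSqrt T).IsPositive := by
  classical
  rw [opSqrt]
  split_ifs with h
  · refine ⟨?_, ?_⟩
    · intro x y
      simp [LinearMap.sum_apply, sum_inner, inner_sum, inner_smul_left, inner_smul_right]
      refine Finset.sum_congr rfl fun i _ => by ring
    · intro x
      simp only [LinearMap.sum_apply, sum_inner, map_sum, LinearMap.smul_apply, inner_smul_left,
        ContinuousLinearMap.coe_coe, InnerProductSpace.rankOne_apply, RCLike.conj_ofReal]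
      refine Finset.sum_nonneg fun i _ => ?_
      rw [inner_conj_symm, RCLike.re_ofReal_mul, inner_mul_symm_re_eq_norm]
      positivity
  · exact LinearMap.isPositive_zero

/-- `ι* : F → E`, the adjoint of the embedding `ι : E → F` of a subspace. -/
def embAdjoint (E : Submodule 𝕜 F) : F →ₗ[𝕜] E := LinearMap.adjoint E.subtype

end SquareRoot

section Matrices

variable {𝕜 : Type*} [RCLike 𝕜] {n : ℕ}

/-- `E₊`: the subspace spanned by the eigenvectors of `P` to positive eigenvalues.
The subspace `E₋` of `P` is `posSpace (-P)`. -/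
def posSpace (P : Matrix (Fin n) (Fin n) 𝕜) : Submodule 𝕜 (EuclideanSpace 𝕜 (Fin n)) :=
  Submodule.span 𝕜 {v | ∃ lam : ℝ, 0 < lam ∧ P.toEuclideanLin v = (lam : 𝕜) • v}

/-- `P₁⁺ = ι₊* P₁ ι₊ : E₊ → E₊`, with `ι₊ : E₊ → 𝕜ⁿ` the embedding. -/
def posPart (P : Matrix (Fin n) (Fin n) 𝕜) : posSpace P →ₗ[𝕜] posSpace P :=
  embAdjoint (posSpace P) ∘ₗ P.toEuclideanLin ∘ₗ (posSpace P).subtype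

/-- `P₊ = ι₊ ι₊*`, as a matrix. -/
def projPlus (P : Matrix (Fin n) (Fin n) 𝕜) : Matrix (Fin n) (Fin n) 𝕜 :=
  Matrix.toEuclideanLin.symm
    ((posSpace P).subtype ∘ₗ embAdjoint (posSpace P))

/-- `Q₊ = ι₊ (P₁⁺)^(1/2) ι₊*`, as a matrix. -/
def Qplus (P : Matrix (Fin n) (Fin n) 𝕜) : Matrix (Fin n) (Fin n) 𝕜 :=
  Matrix.toEuclideanLin.symm
    ((posSpace P).subtype ∘ₗ opSqrt (𝕜 := 𝕜) (F := posSpace P) (posPart P) ∘ₗ embAdjoint (posSpace P))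

/-- `P₋ = ι₋ ι₋*`, where `E₋` is spanned by the eigenvectors of `P` to negative eigenvalues. -/
def projMinus (P : Matrix (Fin n) (Fin n) 𝕜) : Matrix (Fin n) (Fin n) 𝕜 := projPlus (-P)

/-- `Q₋ = ι₋ (P₁⁻)^(1/2) ι₋*`, where `P₁⁻ = ι₋* (-P₁) ι₋`. -/
def Qminus (P : Matrix (Fin n) (Fin n) 𝕜) : Matrix (Fin n) (Fin n) 𝕜 := Qplus (-P)

end Matrices

section Operator

variable {𝕜 : Type*} [RCLike 𝕜] {n : ℕ}

/-- Lebesgue measure on `[a,b]`. -/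
abbrev intervalMeasure (a b : ℝ) : Measure ℝ := volume.restrict (Set.Icc a b)

/-- The state space `L²([a,b], 𝕜ⁿ)`. -/
abbrev StateSpace (𝕜 : Type*) [RCLike 𝕜] (n : ℕ) (a b : ℝ) : Type _ :=
  Lp (EuclideanSpace 𝕜 (Fin n)) 2 (intervalMeasure a b)

/-- `f` is (the absolutely continuous representative of) an element of `H¹([a,b], 𝕜ⁿ)`, with
derivative `g ∈ L²([a,b], 𝕜ⁿ)`. -/
structure IsH1 (a b : ℝ) (f g : ℝ → EuclideanSpace 𝕜 (Fin n)) : Prop where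
  memLp : MemLp g 2 (intervalMeasure a b)
  eq_integral : ∀ ξ ∈ Set.Icc a b, f ξ = f a + ∫ t in a..ξ, g t

/-- `W [f(b); f(a)]`. -/
def boundaryValue (W : Matrix (Fin n) (Fin n ⊕ Fin n) 𝕜) (a b : ℝ)
    (f : ℝ → EuclideanSpace 𝕜 (Fin n)) : Fin n → 𝕜 :=
  W *ᵥ Sum.elim (f b) (f a)

variable (P₁ : Matrix (Fin n) (Fin n) 𝕜) (P₀ : ℝ → Matrix (Fin n) (Fin n) 𝕜)
  (W : Matrix (Fin n) (Fin n ⊕ Fin n) 𝕜) (a b : ℝ)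

theorem IsH1.intervalIntegrable {a b : ℝ} {f g : ℝ → EuclideanSpace 𝕜 (Fin n)}
    (h : IsH1 a b f g) : IntegrableOn g (Set.Icc a b) :=
  h.memLp.integrable (by norm_num)

theorem IsH1.add {a b : ℝ} {f g f' g' : ℝ → EuclideanSpace 𝕜 (Fin n)}
    (h : IsH1 a b f g) (h' : IsH1 a b f' g') : IsH1 a b (f + f') (g + g') := by
  refine ⟨h.memLp.add h'.memLp, fun ξ hξ => ?_⟩
  have i : ∀ {u : ℝ → EuclideanSpace 𝕜 (Fin n)}, IntegrableOn u (Set.Icc a b) →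
      IntervalIntegrable u volume a ξ := fun hu =>
    (intervalIntegrable_iff_integrableOn_Icc_of_le hξ.1).2
      (hu.mono_set (Set.Icc_subset_Icc_right hξ.2))
  simp only [Pi.add_apply]
  rw [intervalIntegral.integral_add (i h.intervalIntegrable) (i h'.intervalIntegrable),
    h.eq_integral ξ hξ, h'.eq_integral ξ hξ]
  abel

theorem IsH1.smul {a b : ℝ} {f g : ℝ → EuclideanSpace 𝕜 (Fin n)}
    (c : 𝕜) (h : IsH1 a b f g) : IsH1 a b (c • f) (c • g) := by
  refine ⟨h.memLp.const_smul c, fun ξ hξ => ?_⟩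
  simp only [Pi.smul_apply]
  rw [intervalIntegral.integral_smul, h.eq_integral ξ hξ, smul_add]

/-- The graph of the operator `P₁ ∂_ξ + P₀` with boundary condition `W [x(b); x(a)] = 0`: pairs
`(x, y)` of elements of `L²([a,b], 𝕜ⁿ)` such that `x ∈ H¹`, `W [x(b); x(a)] = 0` and
`y = P₁ x' + P₀ x`. -/
def opGraph : Submodule 𝕜 (StateSpace 𝕜 n a b × StateSpace 𝕜 n a b) where
  carrier := {p | ∃ f g : ℝ → EuclideanSpace 𝕜 (Fin n),
    IsH1 a b f g ∧ p.1 =ᵐ[intervalMeasure a b] f ∧ boundaryValue W a b f = 0 ∧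
    p.2 =ᵐ[intervalMeasure a b]
      fun ξ => P₁.toEuclideanLin (g ξ) + (P₀ ξ).toEuclideanLin (f ξ)}
  zero_mem' := by
    refine ⟨0, 0, ⟨MemLp.zero', by simp⟩, Lp.coeFn_zero _ _ _, ?_, ?_⟩
    · have : Sum.elim ((0 : ℝ → EuclideanSpace 𝕜 (Fin n)) b)
          ((0 : ℝ → EuclideanSpace 𝕜 (Fin n)) a) = (0 : Fin n ⊕ Fin n → 𝕜) := by
        ext i; cases i <;> rfl
      rw [boundaryValue, this, Matrix.mulVec_zero]
    · filter_upwards [Lp.coeFn_zero (EuclideanSpace 𝕜 (Fin n)) 2 (intervalMeasure a b)] with ξ h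
      simpa using h
  add_mem' := by
    rintro ⟨x, y⟩ ⟨x', y'⟩ ⟨f, g, h, hx, hW, hy⟩ ⟨f', g', h', hx', hW', hy'⟩
    refine ⟨f + f', g + g', h.add h', (Lp.coeFn_add x x').trans (hx.add hx'), ?_, ?_⟩
    · have : (Sum.elim ((f + f') b) ((f + f') a) : Fin n ⊕ Fin n → 𝕜) =
          Sum.elim (f b) (f a) + Sum.elim (f' b) (f' a) := by
        ext i; cases i <;> rfl
      rw [boundaryValue] at hW hW' ⊢
      rw [this, Matrix.mulVec_add, hW, hW', add_zero]
    · filter_upwards [Lp.coeFn_add y y', hy, hy'] with ξ h1 h2 h3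
      change (y + y' : StateSpace 𝕜 n a b) ξ = _
      rw [h1, Pi.add_apply, h2, h3]
      simp only [Pi.add_apply, map_add]
      abel
  smul_mem' := by
    rintro c ⟨x, y⟩ ⟨f, g, h, hx, hW, hy⟩
    refine ⟨c • f, c • g, h.smul c, (Lp.coeFn_smul c x).trans (hx.const_smul c), ?_, ?_⟩
    · have : (Sum.elim ((c • f) b) ((c • f) a) : Fin n ⊕ Fin n → 𝕜) =
          c • Sum.elim (f b) (f a) := by
        ext i; cases i <;> rfl
      rw [boundaryValue] at hW ⊢
      rw [this, Matrix.mulVec_smul, hW, smul_zero]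
    · filter_upwards [Lp.coeFn_smul c y, hy] with ξ h1 h2
      change (c • y : StateSpace 𝕜 n a b) ξ = _
      rw [h1, Pi.smul_apply, h2]
      simp only [Pi.smul_apply, map_smul, smul_add]

/-- The (unbounded) operator `P₁ ∂_ξ + P₀` on `L²([a,b], 𝕜ⁿ)` with domain
`{x ∈ H¹([a,b], 𝕜ⁿ) | W [x(b); x(a)] = 0}`. -/
def opA : StateSpace 𝕜 n a b →ₗ.[𝕜] StateSpace 𝕜 n a b :=
  (opGraph P₁ P₀ W a b).toLinearPMap

variable {a b}

theorem IsH1.continuousOn {f g : ℝ → EuclideanSpace 𝕜 (Fin n)}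
    (h : IsH1 a b f g) : ContinuousOn f (Set.Icc a b) := by
  rcases lt_or_ge b a with hba | hab
  · simp [Set.Icc_eq_empty_of_lt hba]
  have hi := (intervalIntegrable_iff_integrableOn_Icc_of_le hab).2 h.intervalIntegrable
  have hc := intervalIntegral.continuousOn_primitive_interval' hi Set.left_mem_uIcc
  rw [Set.uIcc_of_le hab] at hc
  exact (continuousOn_const.add hc).congr h.eq_integral

/-- The weak derivative is unique, hence `opGraph` is the graph of an operator. -/
theorem opGraph_functional (hab : a < b) (p : StateSpace 𝕜 n a b × StateSpace 𝕜 n a b)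
    (hp : p ∈ opGraph P₁ P₀ W a b) (h0 : p.1 = 0) : p.2 = 0 := by
  obtain ⟨f, g, h, hx, -, hy⟩ := hp
  have hf : ∀ᵐ ξ ∂(intervalMeasure a b), f ξ = 0 := by
    rw [h0] at hx
    filter_upwards [hx, Lp.coeFn_zero (EuclideanSpace 𝕜 (Fin n)) 2 (intervalMeasure a b)]
      with ξ h1 h2
    rw [← h1, h2, Pi.zero_apply]
  have hf0 : Set.EqOn f 0 (Set.Icc a b) :=
    Measure.eqOn_Icc_of_ae_eq volume hab.ne hf h.continuousOn continuousOn_const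
  have hi := (intervalIntegrable_iff_integrableOn_Icc_of_le hab.le).2 h.intervalIntegrable
  have hg : ∀ᵐ ξ ∂(intervalMeasure a b), g ξ = 0 := by
    have hd := hi.ae_hasDerivAt_integral
    rw [intervalMeasure, ← restrict_Ioo_eq_restrict_Icc, ae_restrict_iff' measurableSet_Ioo]
    filter_upwards [hd] with ξ hξ hm
    have h1 := hξ (by rw [Set.uIcc_of_le hab.le]; exact Set.Ioo_subset_Icc_self hm) a
      Set.left_mem_uIcc
    have h2 : (fun x => ∫ t in a..x, g t) =ᶠ[𝓝 ξ] fun _ => 0 := by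
      filter_upwards [Ioo_mem_nhds hm.1 hm.2] with x hx
      have h3 := h.eq_integral x (Set.Ioo_subset_Icc_self hx)
      rw [hf0 (Set.Ioo_subset_Icc_self hx), hf0 (Set.left_mem_Icc.2 hab.le)] at h3
      simpa using h3.symm
    exact h1.unique ((hasDerivAt_const ξ 0).congr_of_eventuallyEq h2)
  refine Lp.ext ?_
  filter_upwards [hy, hf, hg, Lp.coeFn_zero (EuclideanSpace 𝕜 (Fin n)) 2 (intervalMeasure a b)]
    with ξ h1 h2 h3 h4
  rw [h1, h2, h3, h4]
  simp

theorem opA_graph (hab : a < b) : (opA P₁ P₀ W a b).graph = opGraph P₁ P₀ W a b :=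
  Submodule.toLinearPMap_graph_eq _ fun p hp h0 => opGraph_functional P₁ P₀ W hab p hp h0

/-- For `P₀ ∈ L^∞`, the domain of `opA` is `{x ∈ H¹([a,b], 𝕜ⁿ) | W [x(b); x(a)] = 0}`. -/
theorem mem_opA_domain
    (hP₀ : ∀ i j, MemLp (fun ξ => P₀ ξ i j) ∞ (intervalMeasure a b))
    (x : StateSpace 𝕜 n a b) :
    x ∈ (opA P₁ P₀ W a b).domain ↔ ∃ f g : ℝ → EuclideanSpace 𝕜 (Fin n),
      IsH1 a b f g ∧ x =ᵐ[intervalMeasure a b] f ∧ boundaryValue W a b f = 0 := by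
  constructor
  · rintro ⟨p, ⟨f, g, h, hx, hW, -⟩, rfl⟩
    exact ⟨f, g, h, hx, hW⟩
  · rintro ⟨f, g, h, hx, hW⟩
    have hfm : MemLp f 2 (intervalMeasure a b) := (memLp_congr_ae hx).1 (Lp.memLp x)
    have h1 : MemLp (fun ξ => P₁.toEuclideanLin (g ξ)) 2 (intervalMeasure a b) :=
      (LinearMap.toContinuousLinearMap P₁.toEuclideanLin).comp_memLp' h.memLp
    have h2 : MemLp (fun ξ => (P₀ ξ).toEuclideanLin (f ξ)) 2 (intervalMeasure a b) := by
      refine MemLp.of_eval_piLp fun i => ?_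
      have : (fun ξ => (P₀ ξ).toEuclideanLin (f ξ) i) = fun ξ => ∑ j, P₀ ξ i j * f ξ j := by
        ext ξ; rfl
      rw [this]
      refine memLp_finsetSum _ fun j _ => ?_
      exact (hfm.eval_piLp j).mul (hP₀ i j)
    exact ⟨(x, (h1.add h2).toLp), ⟨f, g, h, hx, hW, (h1.add h2).coeFn_toLp⟩, rfl⟩

end Operator

end HBCS

end

/-! Algebra. On eigenvectors of `P` one reads off that `Qplus P` and `Qminus P` annihilate each
other and that `Qplus² - Qminus² = P`. Multiplying the boundary matrix by two block columns
therefore isolates `J P` and `L P`, which gives existence, uniqueness and the formulas. Likewise `W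
[P₊; P₋] = J (Q₊ + Q₋)` with `Q₊ + Q₋` invertible, so (b) and (d) say the same; if `J` is
invertible, `K = J` and `M = J⁻¹ L` give (a).

(a) implies (c). The flow of `x' = P₁ ∂x` carries the `E₊` part leftwards and the `E₋` part
rightwards, so `Q₊ x(b)` and `Q₋ x(a)` are inflow, `Q₋ x(b)` and `Q₊ x(a)` outflow, and (a) reads
inflow = `M` outflow. An equivalent inner product that weights the inflow ends by a small `ε` makes
the boundary terms of the energy identity nonpositive, however large `M` is; differentiating the
weight costs only a bounded term (`exists_dissipative`). Since `λ - A` reduces to an ODE whose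
boundary condition is a square linear system, injectivity from dissipativity yields surjectivity
(`isQuasiMDissipative_opA`). Lumer–Phillips, derived from Hille–Yosida by Yosida approximation, and
a bounded perturbation by `P₀` finish.

(c) implies (b). A generator satisfies `λ ‖x‖ ≤ C ‖λ x - A x‖` for large `λ`. Correcting the
boundary value by an affine function, which needs full rank, turns this into a bound of `P₁ (f(b) -
f(a))` by `λ` times the boundary value, for every solution of `P₁ f' = λ f`
(`exists_boundary_bound`). If `W [P₊; P₋] u = 0`, exponential solutions with `f(b) → P₊ u` and `f(a)
→ P₋ u` have boundary values decaying faster than `1/λ`; in the limit `P₁ (P₊ u - P₋ u) = 0`, so `u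
= 0`. -/

namespace HBCS

/-! ### Square roots and subspace embeddings. -/

section SquareRoot

variable {𝕜 : Type*} [RCLike 𝕜] {F : Type*} [NormedAddCommGroup F] [InnerProductSpace 𝕜 F]
  [FiniteDimensional 𝕜 F]

/-- Symmetry gives `(λⱼ - μ) ⟪eⱼ, v⟫ = 0`, so `v` has components only along those `eⱼ` with `λⱼ =
μ`. This frees later computations from the eigenbasis chosen in `opSqrt`. -/
theorem opSqrt_apply_of_eigenvector {T : F →ₗ[𝕜] F} (h : T.IsSymmetric) {μ : ℝ} {v : F}
    (hv : T v = (μ : 𝕜) • v) : opSqrt T v = ((√μ : ℝ) : 𝕜) • v := by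
  set e := h.eigenvectorBasis rfl with he
  refine InnerProductSpace.ext_inner_left_basis (𝕜 := 𝕜) e.toBasis fun j => ?_
  rw [e.coe_toBasis]
  have h1 : inner 𝕜 (e j) (opSqrt T v) =
      ((√(h.eigenvalues rfl j) : ℝ) : 𝕜) * inner 𝕜 (e j) v := by
    rw [← (opSqrt_isPositive T).isSymmetric, he, opSqrt_apply_basis h, inner_smul_left,
      RCLike.conj_ofReal]
  have h2 : ((h.eigenvalues rfl j : ℝ) : 𝕜) * inner 𝕜 (e j) v = (μ : 𝕜) * inner 𝕜 (e j) v := by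
    rw [← inner_smul_right (e j) v (μ : 𝕜), ← hv, ← h, he, h.apply_eigenvectorBasis rfl j, inner_smul_left,
      RCLike.conj_ofReal]
  rw [h1, inner_smul_right]
  rcases mul_eq_mul_right_iff.1 h2 with h3 | h3
  · rw [RCLike.ofReal_inj.1 h3]
  · simp [h3]

theorem embAdjoint_apply_coe (E : Submodule 𝕜 F) (v : E) : embAdjoint E (v : F) = v := by
  refine ext_inner_left 𝕜 fun w => ?_
  rw [embAdjoint, LinearMap.adjoint_inner_right]
  rfl

theorem embAdjoint_apply_of_mem_orthogonal (E : Submodule 𝕜 F) {v : F} (hv : v ∈ Eᗮ) :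
    embAdjoint E v = 0 := by
  refine ext_inner_left 𝕜 fun w => ?_
  rw [embAdjoint, LinearMap.adjoint_inner_right, inner_zero_right]
  exact hv w w.2

theorem isSymmetric_subtype_comp_opSqrt_comp_embAdjoint (E : Submodule 𝕜 F) (S : E →ₗ[𝕜] E) :
    (E.subtype ∘ₗ opSqrt (𝕜 := 𝕜) (F := E) S ∘ₗ embAdjoint E).IsSymmetric := by
  intro x y
  have h1 := LinearMap.adjoint_inner_right E.subtype (opSqrt S (embAdjoint E x)) y
  have h2 := LinearMap.adjoint_inner_left E.subtype (opSqrt S (embAdjoint E y)) x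
  exact h1.symm.trans (((opSqrt_isPositive S).isSymmetric _ _).trans h2)

end SquareRoot

/-! ### Calculus of the spectral projections and of the matrices `Q₊`, `Q₋`. -/

section Matrices

set_option linter.unusedSimpArgs false

variable {𝕜 : Type*} [RCLike 𝕜] {n : ℕ}

theorem toEuclideanLin_mul_apply (A B : Matrix (Fin n) (Fin n) 𝕜)
    (v : EuclideanSpace 𝕜 (Fin n)) :
    (A * B).toEuclideanLin v = A.toEuclideanLin (B.toEuclideanLin v) := by
  simp [Matrix.toLpLin_apply, Matrix.mulVec_mulVec]

theorem toEuclideanLin_isSymmetric {P : Matrix (Fin n) (Fin n) 𝕜} (hP : P.IsHermitian) :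
    P.toEuclideanLin.IsSymmetric :=
  Matrix.isSymmetric_toEuclideanLin_iff.2 hP

variable {P : Matrix (Fin n) (Fin n) 𝕜}

theorem toEuclideanLin_eigenvectorBasis (hP : P.IsHermitian) (i : Fin n) :
    P.toEuclideanLin (hP.eigenvectorBasis i) =
      ((hP.eigenvalues i : ℝ) : 𝕜) • hP.eigenvectorBasis i := by
  rw [Matrix.toLpLin_apply, hP.mulVec_eigenvectorBasis, ← RCLike.real_smul_eq_coe_smul]
  rfl

theorem posPart_isSymmetric (hP : P.IsHermitian) :
    LinearMap.IsSymmetric (𝕜 := 𝕜) (E := posSpace P) (posPart P) := by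
  intro x y
  rw [posPart, LinearMap.comp_apply, LinearMap.comp_apply, LinearMap.comp_apply,
    LinearMap.comp_apply, embAdjoint, LinearMap.adjoint_inner_left, LinearMap.adjoint_inner_right]
  exact toEuclideanLin_isSymmetric hP _ _

theorem mem_posSpace {μ : ℝ} {v : EuclideanSpace 𝕜 (Fin n)}
    (hv : P.toEuclideanLin v = (μ : 𝕜) • v) (hμ : 0 < μ) : v ∈ posSpace P :=
  Submodule.subset_span ⟨μ, hμ, hv⟩

/-- Eigenvectors of a self-adjoint matrix to distinct eigenvalues are orthogonal, and `μ` differs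
from every positive eigenvalue. -/
theorem mem_posSpace_orthogonal (hP : P.IsHermitian) {μ : ℝ} {v : EuclideanSpace 𝕜 (Fin n)}
    (hv : P.toEuclideanLin v = (μ : 𝕜) • v) (hμ : μ ≤ 0) : v ∈ (posSpace P)ᗮ := by
  rw [posSpace, Submodule.mem_orthogonal]
  intro w hw
  induction hw using Submodule.span_induction with
  | mem w hw =>
    obtain ⟨lam, hlam, hw⟩ := hw
    have h := toEuclideanLin_isSymmetric hP w v
    rw [hv, hw, inner_smul_left, inner_smul_right, RCLike.conj_ofReal] at h
    rcases mul_eq_mul_right_iff.1 h with h | h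
    · have := RCLike.ofReal_inj.1 h
      linarith
    · exact h
  | zero => simp
  | add x y _ _ hx hy => rw [inner_add_left, hx, hy, add_zero]
  | smul c x _ hx => rw [inner_smul_left, hx, mul_zero]

theorem projPlus_apply_of_pos {μ : ℝ} {v : EuclideanSpace 𝕜 (Fin n)}
    (hv : P.toEuclideanLin v = (μ : 𝕜) • v) (hμ : 0 < μ) :
    (projPlus P).toEuclideanLin v = v := by
  rw [projPlus, LinearEquiv.apply_symm_apply, LinearMap.comp_apply]
  have := embAdjoint_apply_coe (posSpace P) ⟨v, mem_posSpace hv hμ⟩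
  simp only at this
  rw [this]
  rfl

theorem projPlus_apply_of_nonpos (hP : P.IsHermitian) {μ : ℝ} {v : EuclideanSpace 𝕜 (Fin n)}
    (hv : P.toEuclideanLin v = (μ : 𝕜) • v) (hμ : μ ≤ 0) :
    (projPlus P).toEuclideanLin v = 0 := by
  rw [projPlus, LinearEquiv.apply_symm_apply, LinearMap.comp_apply,
    embAdjoint_apply_of_mem_orthogonal _ (mem_posSpace_orthogonal hP hv hμ), map_zero]

theorem Qplus_apply_of_pos (hP : P.IsHermitian) {μ : ℝ} {v : EuclideanSpace 𝕜 (Fin n)}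
    (hv : P.toEuclideanLin v = (μ : 𝕜) • v) (hμ : 0 < μ) :
    (Qplus P).toEuclideanLin v = ((√μ : ℝ) : 𝕜) • v := by
  have h0 := embAdjoint_apply_coe (posSpace P) ⟨v, mem_posSpace hv hμ⟩
  have h1 : posPart P ⟨v, mem_posSpace hv hμ⟩ = (μ : 𝕜) • ⟨v, mem_posSpace hv hμ⟩ := by
    rw [posPart, LinearMap.comp_apply, LinearMap.comp_apply, Submodule.subtype_apply, hv, map_smul,
      h0]
  simp only at h0
  have h2 := opSqrt_apply_of_eigenvector (F := posSpace P) (posPart_isSymmetric hP) h1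
  rw [Qplus, LinearEquiv.apply_symm_apply, LinearMap.comp_apply, LinearMap.comp_apply, h0]
  exact congrArg Subtype.val h2

theorem Qplus_apply_of_nonpos (hP : P.IsHermitian) {μ : ℝ} {v : EuclideanSpace 𝕜 (Fin n)}
    (hv : P.toEuclideanLin v = (μ : 𝕜) • v) (hμ : μ ≤ 0) :
    (Qplus P).toEuclideanLin v = 0 := by
  rw [Qplus, LinearEquiv.apply_symm_apply, LinearMap.comp_apply, LinearMap.comp_apply,
    embAdjoint_apply_of_mem_orthogonal _ (mem_posSpace_orthogonal hP hv hμ), map_zero, map_zero]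

theorem eigenvector_neg {μ : ℝ} {v : EuclideanSpace 𝕜 (Fin n)}
    (hv : P.toEuclideanLin v = (μ : 𝕜) • v) : (-P).toEuclideanLin v = ((-μ : ℝ) : 𝕜) • v := by
  rw [map_neg, LinearMap.neg_apply, hv, RCLike.ofReal_neg, neg_smul]

theorem eigenvalues_ne_zero (hP : P.IsHermitian) (hu : IsUnit P) (i : Fin n) :
    hP.eigenvalues i ≠ 0 := by
  rw [Matrix.isUnit_iff_isUnit_det, hP.det_eq_prod_eigenvalues, isUnit_iff_ne_zero,
    Finset.prod_ne_zero_iff] at hu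
  exact fun h => hu i (Finset.mem_univ i) (by simp [h])

theorem matrix_ext_eigenvectorBasis (hP : P.IsHermitian) {A B : Matrix (Fin n) (Fin n) 𝕜}
    (h : ∀ i, A.toEuclideanLin (hP.eigenvectorBasis i) = B.toEuclideanLin (hP.eigenvectorBasis i)) :
    A = B := by
  apply Matrix.toEuclideanLin.injective
  exact hP.eigenvectorBasis.toBasis.ext (by simpa using h)

/-- To prove an identity between matrices it suffices to test it on the eigenvectors of an
invertible self-adjoint matrix `P`, on which the matrices `P₊`, `P₋`, `Q₊`, `Q₋` are explicit. -/
theorem matrix_ext_of_eigenvectors (hP : P.IsHermitian) (hu : IsUnit P)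
    {A B : Matrix (Fin n) (Fin n) 𝕜}
    (hpos : ∀ (μ : ℝ) (v : EuclideanSpace 𝕜 (Fin n)), 0 < μ →
      P.toEuclideanLin v = (((√μ : ℝ) : 𝕜) * ((√μ : ℝ) : 𝕜)) • v →
      (projPlus P).toEuclideanLin v = v → (projMinus P).toEuclideanLin v = 0 →
      (Qplus P).toEuclideanLin v = ((√μ : ℝ) : 𝕜) • v → (Qminus P).toEuclideanLin v = 0 →
      A.toEuclideanLin v = B.toEuclideanLin v)
    (hneg : ∀ (μ : ℝ) (v : EuclideanSpace 𝕜 (Fin n)), 0 < μ →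
      P.toEuclideanLin v = -((((√μ : ℝ) : 𝕜) * ((√μ : ℝ) : 𝕜)) • v) →
      (projPlus P).toEuclideanLin v = 0 → (projMinus P).toEuclideanLin v = v →
      (Qplus P).toEuclideanLin v = 0 → (Qminus P).toEuclideanLin v = ((√μ : ℝ) : 𝕜) • v →
      A.toEuclideanLin v = B.toEuclideanLin v) : A = B := by
  refine matrix_ext_eigenvectorBasis hP fun i => ?_
  have hv := toEuclideanLin_eigenvectorBasis hP i
  have hv' := eigenvector_neg hv
  rcases (eigenvalues_ne_zero hP hu i).lt_or_gt with h | h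
  · have h' : 0 < -hP.eigenvalues i := by linarith
    refine hneg _ _ h' ?_ (projPlus_apply_of_nonpos hP hv h.le) (projPlus_apply_of_pos hv' h')
      (Qplus_apply_of_nonpos hP hv h.le) (Qplus_apply_of_pos hP.neg hv' h')
    rw [← RCLike.ofReal_mul, Real.mul_self_sqrt h'.le, hv, RCLike.ofReal_neg, neg_smul, neg_neg]
  · refine hpos _ _ h ?_ (projPlus_apply_of_pos hv h)
      (projPlus_apply_of_nonpos hP.neg hv' (by linarith))
      (Qplus_apply_of_pos hP hv h) (Qplus_apply_of_nonpos hP.neg hv' (by linarith))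
    rw [← RCLike.ofReal_mul, Real.mul_self_sqrt h.le, hv]

theorem Qplus_mul_Qminus (hP : P.IsHermitian) (hu : IsUnit P) :
    Qplus P * Qminus P = 0 := by
  refine matrix_ext_of_eigenvectors hP hu ?_ ?_ <;> intro μ v hμ h1 h2 h3 h4 h5 <;>
    simp [h4, h5]

theorem Qminus_mul_Qplus (hP : P.IsHermitian) (hu : IsUnit P) :
    Qminus P * Qplus P = 0 := by
  refine matrix_ext_of_eigenvectors hP hu ?_ ?_ <;> intro μ v hμ h1 h2 h3 h4 h5 <;>
    simp [h4, h5]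

theorem Qplus_sq_sub_Qminus_sq (hP : P.IsHermitian) (hu : IsUnit P) :
    Qplus P * Qplus P - Qminus P * Qminus P = P := by
  refine matrix_ext_of_eigenvectors hP hu ?_ ?_ <;> intro μ v hμ h1 h2 h3 h4 h5 <;>
    simp [h1, h4, h5, mul_smul]

theorem projPlus_add_projMinus (hP : P.IsHermitian) (hu : IsUnit P) :
    projPlus P + projMinus P = 1 := by
  refine matrix_ext_of_eigenvectors hP hu ?_ ?_ <;> intro μ v hμ h1 h2 h3 h4 h5 <;>
    simp [h2, h3]

theorem Qplus_mul_projPlus (hP : P.IsHermitian) (hu : IsUnit P) :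
    Qplus P * projPlus P = Qplus P := by
  refine matrix_ext_of_eigenvectors hP hu ?_ ?_ <;> intro μ v hμ h1 h2 h3 h4 h5 <;>
    simp [h2, h3, h4, h5]

theorem Qplus_mul_projMinus (hP : P.IsHermitian) (hu : IsUnit P) :
    Qplus P * projMinus P = 0 := by
  refine matrix_ext_of_eigenvectors hP hu ?_ ?_ <;> intro μ v hμ h1 h2 h3 h4 h5 <;>
    simp [h2, h3, h4, h5]

theorem Qminus_mul_projPlus (hP : P.IsHermitian) (hu : IsUnit P) :
    Qminus P * projPlus P = 0 := by
  refine matrix_ext_of_eigenvectors hP hu ?_ ?_ <;> intro μ v hμ h1 h2 h3 h4 h5 <;>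
    simp [h2, h3, h4, h5]

theorem Qminus_mul_projMinus (hP : P.IsHermitian) (hu : IsUnit P) :
    Qminus P * projMinus P = Qminus P := by
  refine matrix_ext_of_eigenvectors hP hu ?_ ?_ <;> intro μ v hμ h1 h2 h3 h4 h5 <;>
    simp [h2, h3, h4, h5]

theorem projPlus_mul_projPlus (hP : P.IsHermitian) (hu : IsUnit P) :
    projPlus P * projPlus P = projPlus P := by
  refine matrix_ext_of_eigenvectors hP hu ?_ ?_ <;> intro μ v hμ h1 h2 h3 h4 h5 <;>
    simp [h2, h3, h4, h5]

theorem projPlus_mul_projMinus (hP : P.IsHermitian) (hu : IsUnit P) :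
    projPlus P * projMinus P = 0 := by
  refine matrix_ext_of_eigenvectors hP hu ?_ ?_ <;> intro μ v hμ h1 h2 h3 h4 h5 <;>
    simp [h2, h3, h4, h5]

theorem projMinus_mul_projPlus (hP : P.IsHermitian) (hu : IsUnit P) :
    projMinus P * projPlus P = 0 := by
  refine matrix_ext_of_eigenvectors hP hu ?_ ?_ <;> intro μ v hμ h1 h2 h3 h4 h5 <;>
    simp [h2, h3, h4, h5]

theorem projMinus_mul_projMinus (hP : P.IsHermitian) (hu : IsUnit P) :
    projMinus P * projMinus P = projMinus P := by
  refine matrix_ext_of_eigenvectors hP hu ?_ ?_ <;> intro μ v hμ h1 h2 h3 h4 h5 <;>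
    simp [h2, h3, h4, h5]

theorem Qplus_mul_comm (hP : P.IsHermitian) (hu : IsUnit P) :
    Qplus P * P = P * Qplus P := by
  refine matrix_ext_of_eigenvectors hP hu ?_ ?_ <;> intro μ v hμ h1 h2 h3 h4 h5 <;>
    simp [h1, h2, h3, h4, h5, mul_smul]

theorem Qminus_mul_comm (hP : P.IsHermitian) (hu : IsUnit P) :
    Qminus P * P = P * Qminus P := by
  refine matrix_ext_of_eigenvectors hP hu ?_ ?_ <;> intro μ v hμ h1 h2 h3 h4 h5 <;>
    simp [h1, h2, h3, h4, h5, mul_smul]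

theorem projPlus_mul_comm (hP : P.IsHermitian) (hu : IsUnit P) :
    projPlus P * P = P * projPlus P := by
  refine matrix_ext_of_eigenvectors hP hu ?_ ?_ <;> intro μ v hμ h1 h2 h3 h4 h5 <;>
    simp [h1, h2, h3, h4, h5, mul_smul]

theorem projMinus_mul_comm (hP : P.IsHermitian) (hu : IsUnit P) :
    projMinus P * P = P * projMinus P := by
  refine matrix_ext_of_eigenvectors hP hu ?_ ?_ <;> intro μ v hμ h1 h2 h3 h4 h5 <;>
    simp [h1, h2, h3, h4, h5, mul_smul]

theorem Qplus_isSymmetric (P : Matrix (Fin n) (Fin n) 𝕜) :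
    (Qplus P).toEuclideanLin.IsSymmetric := by
  rw [Qplus, LinearEquiv.apply_symm_apply]
  exact isSymmetric_subtype_comp_opSqrt_comp_embAdjoint (posSpace P) (posPart P)

/-- Because the mixed products vanish, `(Q₊ + Q₋)(Q₊ - Q₋) = P`, and a factor of an invertible
square matrix is invertible. -/
theorem isUnit_Qplus_add_Qminus (hP : P.IsHermitian) (hu : IsUnit P) :
    IsUnit (Qplus P + Qminus P) := by
  have h : (Qplus P + Qminus P) * (Qplus P - Qminus P) = P := by
    rw [add_mul, mul_sub, mul_sub, Qplus_mul_Qminus hP hu, Qminus_mul_Qplus hP hu, sub_zero,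
      zero_sub, ← sub_eq_add_neg, Qplus_sq_sub_Qminus_sq hP hu]
  rw [← h] at hu
  rw [Matrix.isUnit_iff_isUnit_det] at hu ⊢
  rw [Matrix.det_mul] at hu
  exact isUnit_of_mul_isUnit_left hu

theorem commute_inv {A : Matrix (Fin n) (Fin n) 𝕜} (hu : IsUnit P) (h : A * P = P * A) :
    A * P⁻¹ = P⁻¹ * A := by
  have hd := (Matrix.isUnit_iff_isUnit_det P).1 hu
  calc A * P⁻¹ = P⁻¹ * (P * A) * P⁻¹ := by rw [Matrix.nonsing_inv_mul_cancel_left _ _ hd]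
    _ = P⁻¹ * A := by rw [← h, Matrix.mul_assoc, Matrix.mul_nonsing_inv_cancel_right _ _ hd]

/-! ### The decomposition of the boundary matrix. -/

section Boundary

variable {W : Matrix (Fin n) (Fin n ⊕ Fin n) 𝕜}

/-- Multiplying by `[Q₊; -Q₋]` kills the `L` terms and leaves `J (Q₊² - Q₋²) = J P`; `[Q₋; -Q₊]`
leaves `L P` in the same way. This settles both uniqueness and the formulas. -/
theorem eq_of_fromCols_eq (hP : P.IsHermitian) (hu : IsUnit P) {J L : Matrix (Fin n) (Fin n) 𝕜}
    (h : W = Matrix.fromCols (J * Qplus P - L * Qminus P) (J * Qminus P - L * Qplus P)) :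
    J = W * Matrix.fromRows (Qplus P) (-Qminus P) * P⁻¹ ∧
      L = W * Matrix.fromRows (Qminus P) (-Qplus P) * P⁻¹ := by
  have hd := (Matrix.isUnit_iff_isUnit_det P).1 hu
  have h1 : W * Matrix.fromRows (Qplus P) (-Qminus P) = J * P := by
    have e : J * P = J * (Qplus P * Qplus P - Qminus P * Qminus P) := by
      rw [Qplus_sq_sub_Qminus_sq hP hu]
    rw [h, e, Matrix.fromCols_mul_fromRows]
    simp only [sub_mul, mul_sub, mul_neg, Matrix.mul_assoc, Qplus_mul_Qminus hP hu,
      Qminus_mul_Qplus hP hu, mul_zero]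
    abel
  have h2 : W * Matrix.fromRows (Qminus P) (-Qplus P) = L * P := by
    have e : L * P = L * (Qplus P * Qplus P - Qminus P * Qminus P) := by
      rw [Qplus_sq_sub_Qminus_sq hP hu]
    rw [h, e, Matrix.fromCols_mul_fromRows]
    simp only [sub_mul, mul_sub, mul_neg, Matrix.mul_assoc, Qplus_mul_Qminus hP hu,
      Qminus_mul_Qplus hP hu, mul_zero]
    abel
  rw [h1, h2, Matrix.mul_nonsing_inv_cancel_right _ _ hd,
    Matrix.mul_nonsing_inv_cancel_right _ _ hd]
  exact ⟨rfl, rfl⟩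

/-- The verification behind existence, with `p`, `m`, `c` standing for `Q₊`, `Q₋`, `P⁻¹` and `x`,
`y` for the two blocks of the boundary matrix. -/
theorem splitting_identity {R : Type*} [Ring R] {x y p m c : R} (hp : p * c = c * p)
    (hm : m * c = c * m) (hpm : p * m = 0) (hmp : m * p = 0) (h : c * (p * p) - c * (m * m) = 1) :
    (x * p * c - y * m * c) * p - (x * m * c - y * p * c) * m = x ∧
      (x * p * c - y * m * c) * m - (x * m * c - y * p * c) * p = y := by
  have e1 : p * c * p = c * (p * p) := by rw [hp, mul_assoc]
  have e2 : m * c * m = c * (m * m) := by rw [hm, mul_assoc]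
  have e3 : p * c * m = 0 := by rw [hp, mul_assoc, hpm, mul_zero]
  have e4 : m * c * p = 0 := by rw [hm, mul_assoc, hmp, mul_zero]
  constructor
  · calc _ = x * (p * c * p) - y * (m * c * p) - (x * (m * c * m) - y * (p * c * m)) := by
          noncomm_ring
      _ = x * (c * (p * p) - c * (m * m)) := by rw [e1, e2, e3, e4]; noncomm_ring
      _ = x := by rw [h, mul_one]
  · calc _ = x * (p * c * m) - y * (m * c * m) - (x * (m * c * p) - y * (p * c * p)) := by
          noncomm_ring
      _ = y * (c * (p * p) - c * (m * m)) := by rw [e1, e2, e3, e4]; noncomm_ring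
      _ = y := by rw [h, mul_one]

theorem exists_fromCols_eq (hP : P.IsHermitian) (hu : IsUnit P)
    (W : Matrix (Fin n) (Fin n ⊕ Fin n) 𝕜) : ∃ J L : Matrix (Fin n) (Fin n) 𝕜,
    W = Matrix.fromCols (J * Qplus P - L * Qminus P) (J * Qminus P - L * Qplus P) := by
  have hd := (Matrix.isUnit_iff_isUnit_det P).1 hu
  have hp := commute_inv hu (Qplus_mul_comm hP hu)
  have hm := commute_inv hu (Qminus_mul_comm hP hu)
  have hsq : P⁻¹ * (Qplus P * Qplus P) - P⁻¹ * (Qminus P * Qminus P) = 1 := by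
    rw [← mul_sub, Qplus_sq_sub_Qminus_sq hP hu, Matrix.nonsing_inv_mul _ hd]
  -- The only possible candidates, by `eq_of_fromCols_eq`.
  refine ⟨W.toCols₁ * Qplus P * P⁻¹ - W.toCols₂ * Qminus P * P⁻¹,
    W.toCols₁ * Qminus P * P⁻¹ - W.toCols₂ * Qplus P * P⁻¹, ?_⟩
  obtain ⟨e1, e2⟩ := splitting_identity (x := W.toCols₁) (y := W.toCols₂) hp hm
    (Qplus_mul_Qminus hP hu) (Qminus_mul_Qplus hP hu) hsq
  rw [e1, e2, Matrix.fromCols_toCols]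

theorem mul_projections_eq (hP : P.IsHermitian) (hu : IsUnit P) {J L : Matrix (Fin n) (Fin n) 𝕜}
    (h : W = Matrix.fromCols (J * Qplus P - L * Qminus P) (J * Qminus P - L * Qplus P)) :
    W * Matrix.fromRows (projPlus P) (projMinus P) = J * (Qplus P + Qminus P) := by
  rw [h, Matrix.fromCols_mul_fromRows]
  simp only [sub_mul, mul_add, Matrix.mul_assoc, Qplus_mul_projPlus hP hu,
    Qplus_mul_projMinus hP hu, Qminus_mul_projPlus hP hu, Qminus_mul_projMinus hP hu, mul_zero,
    sub_zero]

end Boundary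

end Matrices
end HBCS

namespace HBCS

/-! ### Strongly continuous semigroups and the resolvent estimate. -/

section Semigroup

variable {𝕜 : Type*} [RCLike 𝕜] {X : Type*} [NormedAddCommGroup X] [NormedSpace 𝕜 X]

theorem IsC0Semigroup.tendsto_nhds_zero {T : ℝ≥0 → X →L[𝕜] X} (hT : IsC0Semigroup T) (x : X) :
    Tendsto (fun t : ℝ≥0 => T t x) (𝓝 0) (𝓝 x) := by
  have h0 : (𝓝 (0 : ℝ≥0)) = 𝓝[>] 0 ⊔ pure 0 := by
    rw [← nhdsWithin_singleton, ← nhdsWithin_union, Set.union_comm, Set.singleton_union,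
      Set.Ioi_insert, ← bot_eq_zero, Set.Ici_bot, nhdsWithin_univ]
  rw [h0, tendsto_sup]
  refine ⟨hT.tendsto_zero x, ?_⟩
  rw [tendsto_pure_left]
  intro s hs
  simpa [hT.map_zero] using mem_of_mem_nhds hs

theorem IsC0Semigroup.exists_norm_le [CompleteSpace X] {T : ℝ≥0 → X →L[𝕜] X}
    (hT : IsC0Semigroup T) :
    ∃ δ : ℝ≥0, 0 < δ ∧ ∃ C : ℝ, 1 ≤ C ∧ ∀ t ≤ δ, ‖T t‖ ≤ C := by
  -- Otherwise some `tₖ → 0` have `‖T tₖ‖ > k + 1`, although every orbit `T tₖ x` converges; this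
  -- contradicts uniform boundedness.
  by_contra! hcon
  have hk : ∀ k : ℕ, ∃ t : ℝ≥0, t ≤ 1 / ((k : ℝ≥0) + 1) ∧ (k : ℝ) + 1 < ‖T t‖ := fun k =>
    hcon (1 / ((k : ℝ≥0) + 1)) (by positivity) (k + 1) (by linarith [k.cast_nonneg (α := ℝ)])
  choose t ht hTt using hk
  have ht0 : Tendsto t atTop (𝓝 0) := by
    refine tendsto_of_tendsto_of_tendsto_of_le_of_le tendsto_const_nhds ?_ (fun _ => zero_le) ht
    exact tendsto_one_div_add_atTop_nhds_zero_nat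
  obtain ⟨C, hC⟩ := banach_steinhaus (g := fun k => T (t k)) fun x => by
    obtain ⟨C, hC⟩ := ((hT.tendsto_nhds_zero x).comp ht0).norm.bddAbove_range
    exact ⟨C, fun k => hC ⟨k, rfl⟩⟩
  obtain ⟨k, hk⟩ := exists_nat_gt C
  linarith [hTt k, hC k]

theorem hasDerivAt_exp_neg_mul (lam t : ℝ) :
    HasDerivAt (fun t : ℝ => Real.exp (-(lam * t))) (Real.exp (-(lam * t)) * (-lam)) t := by
  have : HasDerivAt (fun t : ℝ => -(lam * t)) (-lam) t := by
    simpa using ((hasDerivAt_id t).const_mul lam).fun_neg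
  exact this.exp

/-- For `s ≤ t`, `T t x - T s x = T s (T (t - s) x - x)`; the bound on `T s` makes this small
uniformly in `s`, which also covers continuity from the left. -/
theorem IsC0Semigroup.continuousOn_orbit {T : ℝ≥0 → X →L[𝕜] X}
    (hT : IsC0Semigroup T) {δ : ℝ≥0} {C : ℝ} (hC : ∀ t ≤ δ, ‖T t‖ ≤ C) (x : X) :
    ContinuousOn (fun t : ℝ≥0 => T t x) (Set.Iic δ) := by
  have key : ∀ s t : ℝ≥0, s ≤ δ → s ≤ t → ‖T t x - T s x‖ ≤ C * ‖T (nndist s t) x - x‖ := by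
    intro s t hs hst
    have h1 : nndist s t = t - s := by
      rw [NNReal.nndist_eq, tsub_eq_zero_of_le hst, max_eq_right zero_le]
    have h2 : T t x - T s x = T s (T (nndist s t) x - x) := by
      rw [map_sub, h1, ← ContinuousLinearMap.comp_apply, ← hT.map_add, add_tsub_cancel_of_le hst]
    rw [h2]
    exact (T s).le_of_opNorm_le (hC s hs) _
  intro s hs
  rw [ContinuousWithinAt, tendsto_iff_norm_sub_tendsto_zero]
  have h1 : Tendsto (fun t => nndist t s) (𝓝[Set.Iic δ] s) (𝓝 0) := by
    have : Tendsto (fun t => nndist t s) (𝓝 s) (𝓝 (nndist s s)) :=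
      (continuous_id.nndist continuous_const).tendsto s
    rw [nndist_self] at this
    exact this.mono_left nhdsWithin_le_nhds
  have h2 : Tendsto (fun t => C * ‖T (nndist t s) x - x‖) (𝓝[Set.Iic δ] s) (𝓝 0) := by
    have h := (tendsto_iff_norm_sub_tendsto_zero.1 ((hT.tendsto_nhds_zero x).comp h1)).const_mul C
    rwa [mul_zero] at h
  refine squeeze_zero' (Eventually.of_forall fun t => norm_nonneg _) ?_ h2
  filter_upwards [self_mem_nhdsWithin] with t ht
  rcases le_total s t with h | h
  · rw [nndist_comm]
    exact key s t hs h
  · rw [norm_sub_rev]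
    exact key t s ht h

variable [NormedSpace ℝ X] [IsScalarTower ℝ 𝕜 X]

/-- Only the right derivative is taken: it follows from the semigroup law, and the mean value
inequality needs no more. -/
theorem IsC0Semigroup.hasDerivWithinAt_orbit {T : ℝ≥0 → X →L[𝕜] X}
    (hT : IsC0Semigroup T) {x y : X}
    (hxy : Tendsto (fun t : ℝ≥0 => (((t : ℝ) : 𝕜)⁻¹) • (T t x - x)) (𝓝[>] 0) (𝓝 y))
    {t : ℝ} (ht : 0 ≤ t) :
    HasDerivWithinAt (fun s : ℝ => T s.toNNReal x) (T t.toNNReal y) (Set.Ici t) t := by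
  rw [← hasDerivWithinAt_Ioi_iff_Ici, hasDerivWithinAt_iff_tendsto_slope' (by simp)]
  have h1 : Tendsto (fun s : ℝ => (s - t).toNNReal) (𝓝[>] t) (𝓝[>] 0) := by
    refine tendsto_nhdsWithin_iff.2 ⟨?_, ?_⟩
    · have : Tendsto (fun s : ℝ => (s - t).toNNReal) (𝓝 t) (𝓝 (t - t).toNNReal) :=
        (continuous_real_toNNReal.comp (continuous_id.sub continuous_const)).tendsto t
      rw [sub_self, Real.toNNReal_zero] at this
      exact this.mono_left nhdsWithin_le_nhds
    · filter_upwards [self_mem_nhdsWithin] with s hs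
      simpa using hs
  refine (((T t.toNNReal).continuous.tendsto y).comp (hxy.comp h1)).congr' ?_
  filter_upwards [self_mem_nhdsWithin] with s hs
  have hs' : 0 ≤ s - t := by linarith [Set.mem_Ioi.1 hs]
  have h2 : s.toNNReal = t.toNNReal + (s - t).toNNReal := by
    rw [← Real.toNNReal_add ht hs', add_sub_cancel]
  rw [slope_def_module, h2, hT.map_add, Function.comp_apply, Function.comp_apply,
    Real.coe_toNNReal _ hs', map_smul, map_sub, ← RCLike.ofReal_inv, ← RCLike.real_smul_eq_coe_smul,
    ContinuousLinearMap.comp_apply]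

/-- The resolvent estimate: an infinitesimal generator `A` satisfies
`λ ‖x‖ ≤ C ‖λ x - A x‖` for all large real `λ`. -/
theorem IsC0Semigroup.exists_resolvent_bound [CompleteSpace X] {T : ℝ≥0 → X →L[𝕜] X}
    (hT : IsC0Semigroup T) :
    ∃ C lam₀ : ℝ, 0 < C ∧ 0 < lam₀ ∧ ∀ lam ≥ lam₀, ∀ x y : X,
      Tendsto (fun t : ℝ≥0 => (((t : ℝ) : 𝕜)⁻¹) • (T t x - x)) (𝓝[>] 0) (𝓝 y) →
      lam * ‖x‖ ≤ C * ‖(lam : 𝕜) • x - y‖ := by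
  obtain ⟨δ, hδ, C, hC1, hC⟩ := hT.exists_norm_le
  have hlim : Tendsto (fun lam : ℝ => C * Real.exp (-(lam * δ))) atTop (𝓝 0) := by
    have := ((Real.tendsto_exp_neg_atTop_nhds_zero.comp
      (tendsto_id.atTop_mul_const (NNReal.coe_pos.2 hδ))).const_mul C)
    simpa using this
  -- With `λ` this large, `exp (-λ δ) ‖T δ x‖ ≤ ‖x‖ / 2`, so the orbit is needed only on `[0, δ]`
  -- and no global growth bound enters.
  obtain ⟨lam₀, hlam₀⟩ := eventually_atTop.1 (hlim.eventually (gt_mem_nhds (by norm_num : (0:ℝ) < 1 / 2)))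
  refine ⟨2 * C, max lam₀ 1, by linarith, by positivity, fun lam hlam x y hxy => ?_⟩
  have hpos : 0 < lam := by linarith [le_max_right lam₀ 1]
  have hsmall := hlam₀ lam ((le_max_left _ _).trans hlam)
  rw [← RCLike.real_smul_eq_coe_smul]
  set D := ‖lam • x - y‖ with hD
  have hcont : ContinuousOn (fun t : ℝ => Real.exp (-(lam * t)) • T t.toNNReal x - x)
      (Set.Icc 0 (δ : ℝ)) := by
    refine ContinuousOn.sub (ContinuousOn.smul (by fun_prop) ?_) continuousOn_const
    refine (hT.continuousOn_orbit hC x).comp continuous_real_toNNReal.continuousOn fun t ht => ?_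
    exact Real.toNNReal_le_iff_le_coe.2 ht.2
  have hderiv : ∀ t ∈ Set.Ico 0 (δ : ℝ), HasDerivWithinAt
      (fun t : ℝ => Real.exp (-(lam * t)) • T t.toNNReal x - x)
      (Real.exp (-(lam * t)) • T t.toNNReal (y - lam • x)) (Set.Ici t) t := by
    intro t ht
    convert ((hasDerivAt_exp_neg_mul lam t).hasDerivWithinAt.fun_smul (hT.hasDerivWithinAt_orbit hxy ht.1)).sub_const x using 1
    rw [map_sub, RCLike.real_smul_eq_coe_smul (K := 𝕜) lam x, map_smul,
      ← RCLike.real_smul_eq_coe_smul (K := 𝕜), smul_sub, mul_neg, neg_smul, mul_smul, ← sub_eq_add_neg]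
  have hB : ∀ t : ℝ, HasDerivAt (fun t : ℝ => C * D / lam * (1 - Real.exp (-(lam * t))))
      (C * D * Real.exp (-(lam * t))) t := by
    intro t
    refine (((hasDerivAt_exp_neg_mul lam t).const_sub 1).const_mul (C * D / lam)).congr_deriv ?_
    field_simp
  -- The damped orbit has derivative `exp (-λ t) T(t) (y - λ x)`, dominated by `C D exp (-λ t)`,
  -- whose primitive stays below `C D / λ`.
  have hfin := image_norm_le_of_norm_deriv_right_le_deriv_boundary hcont hderiv
    (by simp [hT.map_zero]) hB (fun t ht => by
      rw [norm_smul, Real.norm_of_nonneg (Real.exp_pos _).le, mul_comm]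
      gcongr
      rw [hD, norm_sub_rev]
      exact (T t.toNNReal).le_of_opNorm_le (hC _ (Real.toNNReal_le_iff_le_coe.2 ht.2.le)) _)
    (Set.right_mem_Icc.2 δ.2)
  simp only [Real.toNNReal_coe] at hfin
  have h1 : ‖Real.exp (-(lam * δ)) • T δ x‖ ≤ 1 / 2 * ‖x‖ := by
    rw [norm_smul, Real.norm_of_nonneg (Real.exp_pos _).le]
    calc _ ≤ Real.exp (-(lam * δ)) * (C * ‖x‖) := by
          gcongr
          exact (T δ).le_of_opNorm_le (hC δ le_rfl) x
      _ = C * Real.exp (-(lam * δ)) * ‖x‖ := by ring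
      _ ≤ _ := by gcongr
  have h2 : ‖x‖ ≤ 1 / 2 * ‖x‖ + C * D / lam := by
    have h3 : C * D / lam * (1 - Real.exp (-(lam * δ))) ≤ C * D / lam := by
      refine mul_le_of_le_one_right (by positivity) ?_
      linarith [Real.exp_pos (-(lam * δ))]
    have h4 := norm_sub_norm_le x (Real.exp (-(lam * δ)) • T δ x)
    rw [norm_sub_rev] at h4
    linarith
  have h3 : lam * ‖x‖ ≤ lam * (2 * (C * D / lam)) := by
    gcongr
    linarith
  have h4 : lam * (2 * (C * D / lam)) = 2 * C * D := by field_simp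
  linarith

end Semigroup
end HBCS

namespace HBCS

/-! ### Exponentials of bounded operators. -/

section Exponential

variable {𝕜 : Type*} [RCLike 𝕜]

theorem exp_add_of_commute' {𝔸 : Type*} [NormedRing 𝔸] [NormedAlgebra 𝕜 𝔸] [CompleteSpace 𝔸]
    {x y : 𝔸} (h : Commute x y) :
    NormedSpace.exp (x + y) = NormedSpace.exp x * NormedSpace.exp y :=
  NormedSpace.exp_add_of_commute_of_mem_ball (𝕂 := 𝕜) h
    ((NormedSpace.expSeries_radius_eq_top 𝕜 𝔸).symm ▸ edist_lt_top _ _)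
    ((NormedSpace.expSeries_radius_eq_top 𝕜 𝔸).symm ▸ edist_lt_top _ _)

theorem hasSum_real_exp (x : ℝ) : HasSum (fun k : ℕ => (k.factorial : ℝ)⁻¹ * x ^ k) (Real.exp x) := by
  rw [Real.exp_eq_exp_ℝ]
  exact NormedSpace.exp_series_hasSum_exp' (𝕂 := ℝ) x

theorem norm_exp_smul_le {𝔸 : Type*} [NormedRing 𝔸] [NormedAlgebra 𝕜 𝔸] [CompleteSpace 𝔸]
    {R : 𝔸} {M r : ℝ} (hR : ∀ k : ℕ, ‖R ^ k‖ ≤ M * r ^ k) {s : ℝ} (hs : 0 ≤ s) :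
    ‖NormedSpace.exp ((s : 𝕜) • R)‖ ≤ M * Real.exp (s * r) := by
  refine (NormedSpace.exp_series_hasSum_exp' (𝕂 := 𝕜) ((s : 𝕜) • R)).norm_le_of_bounded
    ((hasSum_real_exp (s * r)).mul_left M) fun k => ?_
  rw [smul_pow, norm_smul, norm_smul, norm_inv, RCLike.norm_natCast, norm_pow, RCLike.norm_ofReal,
    abs_of_nonneg hs, mul_pow]
  calc (k.factorial : ℝ)⁻¹ * (s ^ k * ‖R ^ k‖) ≤ (k.factorial : ℝ)⁻¹ * (s ^ k * (M * r ^ k)) := by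
        gcongr
        exact hR k
    _ = _ := by ring

variable {X : Type*} [NormedAddCommGroup X] [NormedSpace 𝕜 X]

/-- The group `t ↦ exp (t G)` of a bounded operator `G`. -/
noncomputable def expOp (G : X →L[𝕜] X) (t : ℝ) : X →L[𝕜] X := NormedSpace.exp ((t : 𝕜) • G)

theorem expOp_zero (G : X →L[𝕜] X) : expOp G 0 = 1 := by
  simp [expOp]

theorem commute_expOp {G H : X →L[𝕜] X} (h : Commute G H) (t : ℝ) : Commute (expOp G t) H :=
  (h.smul_left _).exp_left

/-- Explicit estimates for Yosida approximations are available only on the domain of the generator;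
this lemma carries limits from there to the whole space. -/
theorem tendsto_zero_of_dense {ι : Type*} {l : Filter ι} {Φ : ι → X →L[𝕜] X} {C : ℝ}
    (hC : ∀ᶠ i in l, ‖Φ i‖ ≤ C) {D : Set X} (hD : Dense D)
    (h : ∀ x ∈ D, Tendsto (fun i => Φ i x) l (𝓝 0)) (x : X) :
    Tendsto (fun i => Φ i x) l (𝓝 0) := by
  rw [Metric.tendsto_nhds]
  intro ε hε
  obtain ⟨y, hy, hxy⟩ := hD.exists_dist_lt x (ε := ε / (2 * (|C| + 1))) (by positivity)
  filter_upwards [hC, Metric.tendsto_nhds.1 (h y hy) (ε / 2) (by positivity)] with i h1 h2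
  rw [dist_zero_right] at h2 ⊢
  rw [dist_eq_norm] at hxy
  have h3 : ‖Φ i (x - y)‖ ≤ (|C| + 1) * ‖x - y‖ :=
    (Φ i).le_of_opNorm_le (h1.trans ((le_abs_self C).trans (by linarith))) _
  have h4 : (|C| + 1) * ‖x - y‖ ≤ (|C| + 1) * (ε / (2 * (|C| + 1))) := by gcongr
  have h5 : (|C| + 1) * (ε / (2 * (|C| + 1))) = ε / 2 := by field_simp
  calc ‖Φ i x‖ = ‖Φ i (x - y) + Φ i y‖ := by rw [← map_add, sub_add_cancel]
    _ ≤ ‖Φ i (x - y)‖ + ‖Φ i y‖ := norm_add_le _ _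
    _ < ε := by linarith

variable [CompleteSpace X]

theorem expOp_add (G : X →L[𝕜] X) (s t : ℝ) : expOp G (s + t) = expOp G s * expOp G t := by
  rw [expOp, RCLike.ofReal_add, add_smul]
  exact exp_add_of_commute' (𝕜 := 𝕜) (((Commute.refl G).smul_left _).smul_right _)

theorem expOp_add_of_commute {G H : X →L[𝕜] X} (h : Commute G H) (t : ℝ) :
    expOp (G + H) t = expOp G t * expOp H t := by
  rw [expOp, smul_add]
  exact exp_add_of_commute' (𝕜 := 𝕜) ((h.smul_left _).smul_right _)

theorem hasDerivAt_expOp [NormedSpace ℝ X] [IsScalarTower ℝ 𝕜 X] (G : X →L[𝕜] X) (x : X) (t : ℝ) :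
    HasDerivAt (fun s : ℝ => expOp G s x) (expOp G t (G x)) t := by
  have h1 : HasDerivAt (fun u : 𝕜 => NormedSpace.exp (u • G) x)
      (NormedSpace.exp ((t : 𝕜) • G) (G x)) (t : 𝕜) :=
    (ContinuousLinearMap.apply 𝕜 X x).hasFDerivAt.comp_hasDerivAt (t : 𝕜)
      (hasDerivAt_exp_smul_const G (t : 𝕜))
  have h2 : HasDerivAt (fun s : ℝ => (s : 𝕜)) 1 t := by
    simpa using (RCLike.ofRealCLM (K := 𝕜)).hasDerivAt (x := t)
  have h3 := HasDerivAt.scomp t h1 h2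
  rw [one_smul] at h3
  exact h3

/-- The exponential factors as `exp (-t c)` times `exp (t c² R)`, and the second factor is estimated
termwise in its series. Bounds on all powers of `R` keep the constant `M` out of the exponent. -/
theorem norm_expOp_yosida_le {R : X →L[𝕜] X} {M r c : ℝ} (hR : ∀ k : ℕ, ‖R ^ k‖ ≤ M * r ^ k)
    {t : ℝ} (ht : 0 ≤ t) :
    ‖expOp (((c ^ 2 : ℝ) : 𝕜) • R - (c : 𝕜) • (1 : X →L[𝕜] X)) t‖ ≤
      M * Real.exp (t * (c ^ 2 * r - c)) := by
  have hM : 0 ≤ M := by simpa using (norm_nonneg _).trans (hR 0)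
  have h1 : expOp (((c ^ 2 : ℝ) : 𝕜) • R - (c : 𝕜) • (1 : X →L[𝕜] X)) t =
      NormedSpace.exp (((t * c ^ 2 : ℝ) : 𝕜) • R) *
        algebraMap 𝕜 (X →L[𝕜] X) (NormedSpace.exp ((-(t * c) : ℝ) : 𝕜)) := by
    rw [NormedSpace.algebraMap_exp_comm, ← exp_add_of_commute' (𝕜 := 𝕜), expOp]
    · congr 1
      rw [Algebra.algebraMap_eq_smul_one]
      push_cast
      module
    · exact (Algebra.commutes _ _).symm
  have h2 : NormedSpace.exp ((-(t * c) : ℝ) : 𝕜) = ((Real.exp (-(t * c)) : ℝ) : 𝕜) := by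
    rw [Real.exp_eq_exp_ℝ]
    exact (NormedSpace.algebraMap_exp_comm (𝕂 := ℝ) (𝔸 := 𝕜) (-(t * c))).symm
  rw [h1, h2, Algebra.algebraMap_eq_smul_one, mul_smul_comm, mul_one, norm_smul, RCLike.norm_ofReal,
    abs_of_pos (Real.exp_pos _)]
  calc _ ≤ Real.exp (-(t * c)) * (M * Real.exp (t * c ^ 2 * r)) := by
        gcongr
        exact norm_exp_smul_le hR (by positivity)
    _ = M * (Real.exp (-(t * c)) * Real.exp (t * c ^ 2 * r)) := by ring
    _ = _ := by
        rw [← Real.exp_add]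
        ring_nf

variable [NormedSpace ℝ X] [IsScalarTower ℝ 𝕜 X]

/-- Differentiate `s ↦ exp (t H) exp (s (G - H)) x` on `[0, t]`. By commutativity the operator here
is `exp ((t - s) H) exp (s G)`, so the two growth bounds multiply to `M² exp (w t)`. -/
theorem norm_expOp_sub_expOp_le {G H : X →L[𝕜] X} (hGH : Commute G H) {M w : ℝ}
    (hG : ∀ t, 0 ≤ t → ‖expOp G t‖ ≤ M * Real.exp (w * t))
    (hH : ∀ t, 0 ≤ t → ‖expOp H t‖ ≤ M * Real.exp (w * t)) {t : ℝ} (ht : 0 ≤ t) (x : X) :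
    ‖expOp G t x - expOp H t x‖ ≤ M ^ 2 * Real.exp (w * t) * ‖G x - H x‖ * t := by
  have hM : 0 ≤ M := by simpa using (norm_nonneg _).trans (hG 0 le_rfl)
  have hc : Commute H (G - H) := hGH.symm.sub_right (Commute.refl H)
  have key : ∀ s, expOp H t * expOp (G - H) s = expOp H (t - s) * expOp G s := by
    intro s
    conv_lhs => rw [← sub_add_cancel t s, expOp_add, mul_assoc, ← expOp_add_of_commute hc]
    rw [add_sub_cancel]
  have h := norm_image_sub_le_of_norm_deriv_le_segment'
    (f := fun s => expOp H t (expOp (G - H) s x))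
    (f' := fun s => expOp H t (expOp (G - H) s ((G - H) x)))
    (a := 0) (b := t) (C := M ^ 2 * Real.exp (w * t) * ‖G x - H x‖) (fun s _ =>
      (((expOp H t).restrictScalars ℝ).hasFDerivAt.comp_hasDerivAt s
        (hasDerivAt_expOp (G - H) x s)).hasDerivWithinAt) (fun s hs => by
      have h1 := congrArg (fun F : X →L[𝕜] X => F ((G - H) x)) (key s)
      simp only [mul_apply_eq_comp] at h1
      rw [h1]
      calc _ ≤ M * Real.exp (w * (t - s)) * (M * Real.exp (w * s) * ‖(G - H) x‖) := by
            refine ((expOp H (t - s)).le_of_opNorm_le (hH _ (by linarith [hs.2])) _).trans ?_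
            gcongr
            exact (expOp G s).le_of_opNorm_le (hG _ hs.1) _
        _ = M ^ 2 * (Real.exp (w * (t - s)) * Real.exp (w * s)) * ‖(G - H) x‖ := by ring
        _ = _ := by
            rw [← Real.exp_add, sub_apply]
            ring_nf) t (Set.right_mem_Icc.2 ht)
  have h2 := congrArg (fun F : X →L[𝕜] X => F x) (key t)
  simp only [mul_apply_eq_comp, sub_self, expOp_zero,
    one_apply_eq_self] at h2
  simpa [h2, expOp_zero] using h

end Exponential
end HBCS

namespace HBCS

/-! ### The Hille–Yosida theorem by Yosida approximation. -/

section HilleYosida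

variable {𝕜 : Type*} [RCLike 𝕜] {X : Type*} [NormedAddCommGroup X] [NormedSpace 𝕜 X]

/-- `R` is the resolvent of `A` on `[lam₀, ∞)`, with the bounds of the Hille–Yosida theorem. -/
structure IsHilleYosidaResolvent (A : X →ₗ.[𝕜] X) (R : ℝ → X →L[𝕜] X) (lam₀ ω M : ℝ) : Prop where
  nonneg : 0 ≤ ω
  le : 2 * ω + 1 ≤ lam₀
  mem_graph : ∀ lam ≥ lam₀, ∀ y, (R lam y, (lam : 𝕜) • R lam y - y) ∈ A.graph
  apply_sub : ∀ lam ≥ lam₀, ∀ x z, (x, z) ∈ A.graph → R lam ((lam : 𝕜) • x - z) = x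
  norm_pow_le : ∀ lam ≥ lam₀, ∀ k : ℕ, ‖R lam ^ k‖ ≤ M * ((lam - ω)⁻¹) ^ k
  dense : Dense (A.domain : Set X)

/-- The Yosida approximation `λ² R(λ) - λ`. -/
noncomputable def yosida (R : ℝ → X →L[𝕜] X) (lam : ℝ) : X →L[𝕜] X :=
  ((lam ^ 2 : ℝ) : 𝕜) • R lam - (lam : 𝕜) • (1 : X →L[𝕜] X)

/-- Behaviour as `t ↓ 0` is inherited by the limit semigroup: a joint limit in `(t, λ)` survives
letting `λ → ∞` first. -/
theorem tendsto_of_tendsto_prod {l : Filter ℝ} {F : ℝ × ℝ → X} {G : ℝ → X} {y : X}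
    (h : Tendsto F (l ×ˢ atTop) (𝓝 y))
    (hG : ∀ᶠ t in l, Tendsto (fun lam => F (t, lam)) atTop (𝓝 (G t))) : Tendsto G l (𝓝 y) := by
  rw [Metric.tendsto_nhds]
  intro ε hε
  have h1 := (Metric.tendsto_nhds.1 h (ε / 2) (by positivity)).curry
  filter_upwards [h1, hG] with t ht htG
  have h2 : dist (G t) y ≤ ε / 2 :=
    le_of_tendsto (htG.dist tendsto_const_nhds) (ht.mono fun _ h => h.le)
  linarith

namespace IsHilleYosidaResolvent

variable {A : X →ₗ.[𝕜] X} {R : ℝ → X →L[𝕜] X} {lam₀ ω M : ℝ}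

theorem const_nonneg (h : IsHilleYosidaResolvent A R lam₀ ω M) : 0 ≤ M := by
  simpa using (norm_nonneg _).trans (h.norm_pow_le lam₀ le_rfl 0)

/-- The resolvent identity, written once for each order of the two parameters; dividing by `λ - μ`
gives the claim. -/
theorem commute (h : IsHilleYosidaResolvent A R lam₀ ω M) {lam mu : ℝ} (hl : lam₀ ≤ lam)
    (hm : lam₀ ≤ mu) : Commute (R lam) (R mu) := by
  rcases eq_or_ne lam mu with rfl | hne
  · exact Commute.refl _
  have key : ∀ {lam mu : ℝ}, lam₀ ≤ lam → lam₀ ≤ mu → ∀ y,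
      ((lam : 𝕜) - mu) • R lam (R mu y) = R mu y - R lam y := by
    intro lam mu hl hm y
    have h1 := h.apply_sub lam hl _ _ (h.mem_graph mu hm y)
    rw [← sub_add, ← sub_smul, map_add, map_smul] at h1
    exact eq_sub_of_add_eq h1
  ext y
  have h1 := key hl hm y
  have h2 := key hm hl y
  have h3 : ((lam : 𝕜) - mu) • R lam (R mu y) = ((lam : 𝕜) - mu) • R mu (R lam y) := by
    rw [h1, ← neg_sub (mu : 𝕜) lam, neg_smul, h2, neg_sub]
  have h4 : (lam : 𝕜) - mu ≠ 0 := by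
    rw [← RCLike.ofReal_sub, RCLike.ofReal_ne_zero]
    exact sub_ne_zero.2 hne
  exact smul_right_injective X h4 h3

theorem commute_yosida (h : IsHilleYosidaResolvent A R lam₀ ω M) {lam mu : ℝ} (hl : lam₀ ≤ lam)
    (hm : lam₀ ≤ mu) : Commute (yosida R lam) (yosida R mu) := by
  have h1 := ((h.commute hl hm).smul_left (((lam ^ 2 : ℝ) : 𝕜))).smul_right (((mu ^ 2 : ℝ) : 𝕜))
  exact (h1.sub_left (((Commute.one_left _).smul_left _))).sub_right
    ((Commute.one_right _).smul_right _)

theorem norm_expOp_le [CompleteSpace X] (h : IsHilleYosidaResolvent A R lam₀ ω M) {lam : ℝ}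
    (hl : lam₀ ≤ lam) {t : ℝ} (ht : 0 ≤ t) :
    ‖expOp (yosida R lam) t‖ ≤ M * Real.exp (2 * ω * t) := by
  refine (norm_expOp_yosida_le (h.norm_pow_le lam hl) ht).trans ?_
  have h0 := h.const_nonneg
  have h1 := h.nonneg
  have h2 := h.le
  have h3 : 0 < lam - ω := by linarith
  -- The left side is `λ ω / (λ - ω)`, and `λ ≥ 2 ω` is exactly what is needed.
  have h4 : lam ^ 2 * (lam - ω)⁻¹ - lam ≤ 2 * ω := ?_
  · rw [mul_comm (2 * ω)]
    gcongr
  rw [sub_le_iff_le_add, ← div_eq_mul_inv, div_le_iff₀ h3]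
  nlinarith

theorem norm_expOp_le_of_le_one [CompleteSpace X] (h : IsHilleYosidaResolvent A R lam₀ ω M)
    {lam : ℝ} (hl : lam₀ ≤ lam) {t : ℝ} (ht : 0 ≤ t) (ht1 : t ≤ 1) :
    ‖expOp (yosida R lam) t‖ ≤ M * Real.exp (2 * ω) := by
  have h0 := h.const_nonneg
  have h1 : 2 * ω * t ≤ 2 * ω := by nlinarith [h.nonneg]
  refine (h.norm_expOp_le hl ht).trans ?_
  gcongr

theorem yosida_apply (h : IsHilleYosidaResolvent A R lam₀ ω M) {lam : ℝ} (hl : lam₀ ≤ lam)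
    {x z : X} (hx : (x, z) ∈ A.graph) : yosida R lam x = (lam : 𝕜) • R lam z := by
  have h1 := h.apply_sub lam hl x z hx
  rw [map_sub, map_smul, sub_eq_iff_eq_add] at h1
  rw [yosida, sub_apply, smul_apply, smul_apply, one_apply_eq_self, pow_two, RCLike.ofReal_mul,
    mul_smul, h1, smul_add, add_sub_cancel_left]

theorem norm_apply_le (h : IsHilleYosidaResolvent A R lam₀ ω M) {lam : ℝ} (hl : lam₀ ≤ lam) :
    ‖R lam‖ ≤ 2 * M / lam := by
  have h1 := h.norm_pow_le lam hl 1
  rw [pow_one, pow_one] at h1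
  have h0 := h.const_nonneg
  have h2 := h.le
  have h3 := h.nonneg
  refine h1.trans ?_
  rw [mul_comm 2 M, mul_div_assoc]
  gcongr
  rw [inv_le_comm₀ (by linarith) (by apply div_pos <;> linarith), inv_div]
  linarith

/-- On the domain `λ R(λ) x - x = R(λ) A x`, which is `O(1/λ)`; the operators `λ R(λ)` are bounded
by `2 M`. -/
theorem tendsto_smul_resolvent (h : IsHilleYosidaResolvent A R lam₀ ω M) (z : X) :
    Tendsto (fun lam : ℝ => (lam : 𝕜) • R lam z) atTop (𝓝 z) := by
  have hpos : 0 < lam₀ := by linarith [h.le, h.nonneg]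
  have h0 := h.const_nonneg
  have hmain := tendsto_zero_of_dense (l := atTop)
    (Φ := fun lam : ℝ => (lam : 𝕜) • R lam - (1 : X →L[𝕜] X)) (C := 2 * M + ‖(1 : X →L[𝕜] X)‖)
    ?_ h.dense ?_ z
  · refine tendsto_sub_nhds_zero_iff.1 (hmain.congr fun lam => ?_)
    simp
  · filter_upwards [eventually_ge_atTop lam₀] with lam hl
    refine (norm_sub_le _ _).trans ?_
    gcongr
    rw [norm_smul, RCLike.norm_ofReal, abs_of_pos (by linarith)]
    calc lam * ‖R lam‖ ≤ lam * (2 * M / lam) := by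
          gcongr
          · linarith
          · exact h.norm_apply_le hl
      _ = 2 * M := by
          have : lam ≠ 0 := by linarith
          field_simp
  · intro x hx
    obtain ⟨y, hy⟩ := LinearPMap.mem_domain_iff.1 hx
    have h1 : Tendsto (fun lam : ℝ => 2 * M / lam * ‖y‖) atTop (𝓝 0) := by
      simpa using (tendsto_const_nhds.div_atTop tendsto_id).mul_const ‖y‖
    refine squeeze_zero_norm' ?_ h1
    filter_upwards [eventually_ge_atTop lam₀] with lam hl
    have h2 := h.apply_sub lam hl x y hy
    rw [map_sub, map_smul, sub_eq_iff_eq_add, ← sub_eq_iff_eq_add'] at h2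
    rw [sub_apply, smul_apply, one_apply_eq_self, h2]
    exact (R lam).le_of_opNorm_le (h.norm_apply_le hl) y

theorem tendsto_yosida (h : IsHilleYosidaResolvent A R lam₀ ω M) {x z : X}
    (hx : (x, z) ∈ A.graph) : Tendsto (fun lam : ℝ => yosida R lam x) atTop (𝓝 z) := by
  refine (h.tendsto_smul_resolvent z).congr' ?_
  filter_upwards [eventually_ge_atTop lam₀] with lam hl
  exact (h.yosida_apply hl hx).symm

theorem eventually_norm_expOp_le [CompleteSpace X]
    (h : IsHilleYosidaResolvent A R lam₀ ω M) :
    ∀ᶠ p : ℝ × ℝ in 𝓝[≥] 0 ×ˢ atTop, ‖expOp (yosida R p.2) p.1‖ ≤ M * Real.exp (2 * ω) := by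
  have h1 : ∀ᶠ t : ℝ in 𝓝[≥] 0, 0 ≤ t ∧ t ≤ 1 := (eventually_mem_nhdsWithin).and
    (eventually_nhdsWithin_of_eventually_nhds (ge_mem_nhds one_pos))
  filter_upwards [h1.prod_mk (eventually_ge_atTop lam₀)] with p hp
  exact h.norm_expOp_le_of_le_one hp.2 hp.1.1 hp.1.2

variable [CompleteSpace X] [NormedSpace ℝ X] [IsScalarTower ℝ 𝕜 X]

/-- The Cauchy property of the approximating groups: on the domain their difference is controlled by
that of the generators, and these converge to `A x`. -/
theorem tendsto_expOp_sub_expOp (h : IsHilleYosidaResolvent A R lam₀ ω M) {t : ℝ} (ht : 0 ≤ t)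
    (x : X) : Tendsto (fun p : ℝ × ℝ => expOp (yosida R p.1) t x - expOp (yosida R p.2) t x)
      (atTop ×ˢ atTop) (𝓝 0) := by
  have hge : ∀ᶠ p : ℝ × ℝ in atTop ×ˢ atTop, lam₀ ≤ p.1 ∧ lam₀ ≤ p.2 :=
    (eventually_ge_atTop lam₀).prod_mk (eventually_ge_atTop lam₀)
  refine (tendsto_zero_of_dense (l := atTop ×ˢ atTop)
    (Φ := fun p : ℝ × ℝ => expOp (yosida R p.1) t - expOp (yosida R p.2) t)
    (C := M * Real.exp (2 * ω * t) + M * Real.exp (2 * ω * t)) ?_ h.dense ?_ x)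
  · filter_upwards [hge] with p hp
    exact (norm_sub_le _ _).trans (add_le_add (h.norm_expOp_le hp.1 ht) (h.norm_expOp_le hp.2 ht))
  · intro x hx
    obtain ⟨z, hz⟩ := LinearPMap.mem_domain_iff.1 hx
    have h1 := h.tendsto_yosida hz
    have h2 : Tendsto (fun p : ℝ × ℝ => M ^ 2 * Real.exp (2 * ω * t) *
        ‖yosida R p.1 x - yosida R p.2 x‖ * t) (atTop ×ˢ atTop) (𝓝 0) := by
      have := (((h1.comp tendsto_fst).sub (h1.comp tendsto_snd)).norm.const_mul
        (M ^ 2 * Real.exp (2 * ω * t))).mul_const t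
      simpa using this
    refine squeeze_zero_norm' ?_ h2
    filter_upwards [hge] with p hp
    exact norm_expOp_sub_expOp_le (h.commute_yosida hp.1 hp.2)
      (fun t ht => h.norm_expOp_le hp.1 ht) (fun t ht => h.norm_expOp_le hp.2 ht) ht x

theorem exists_limit (h : IsHilleYosidaResolvent A R lam₀ ω M) :
    ∃ T : ℝ≥0 → X →L[𝕜] X, ∀ (t : ℝ≥0) (x : X),
      Tendsto (fun lam : ℝ => expOp (yosida R lam) t x) atTop (𝓝 (T t x)) := by
  have h1 : ∀ (t : ℝ≥0) (x : X), ∃ y,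
      Tendsto (fun lam : ℝ => expOp (yosida R lam) t x) atTop (𝓝 y) := by
    intro t x
    refine cauchy_map_iff_exists_tendsto.1 (cauchy_map_iff.2 ⟨inferInstance, ?_⟩)
    rw [uniformity_eq_comap_nhds_zero, tendsto_comap_iff]
    have h2 := (h.tendsto_expOp_sub_expOp t.2 x).neg
    rw [neg_zero] at h2
    exact h2.congr fun p => neg_sub _ _
  choose f hf using h1
  refine ⟨fun t => continuousLinearMapOfTendsto (l := atTop) (fun lam : ℝ => expOp (yosida R lam) (t : ℝ))
    (tendsto_pi_nhds.2 (hf t)), fun t x => hf t x⟩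

theorem tendsto_expOp_apply (h : IsHilleYosidaResolvent A R lam₀ ω M) (x : X) :
    Tendsto (fun p : ℝ × ℝ => expOp (yosida R p.2) p.1 x) (𝓝[≥] 0 ×ˢ atTop) (𝓝 x) := by
  have hge : ∀ᶠ p : ℝ × ℝ in 𝓝[≥] 0 ×ˢ atTop, (0 ≤ p.1 ∧ p.1 ≤ 1) ∧ lam₀ ≤ p.2 := by
    have h1 : ∀ᶠ t : ℝ in 𝓝[≥] 0, 0 ≤ t ∧ t ≤ 1 := (eventually_mem_nhdsWithin).and
      (eventually_nhdsWithin_of_eventually_nhds (ge_mem_nhds one_pos))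
    exact h1.prod_mk (eventually_ge_atTop lam₀)
  have hmain := tendsto_zero_of_dense (l := 𝓝[≥] 0 ×ˢ atTop)
    (Φ := fun p : ℝ × ℝ => expOp (yosida R p.2) p.1 - (1 : X →L[𝕜] X))
    (C := M * Real.exp (2 * ω) + ‖(1 : X →L[𝕜] X)‖) ?_ h.dense ?_ x
  · refine tendsto_sub_nhds_zero_iff.1 (hmain.congr fun p => ?_)
    simp
  · filter_upwards [h.eventually_norm_expOp_le] with p hp
    exact (norm_sub_le _ _).trans (add_le_add hp le_rfl)
  · intro x hx
    obtain ⟨z, hz⟩ := LinearPMap.mem_domain_iff.1 hx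
    have h2 : Tendsto (fun p : ℝ × ℝ => M * Real.exp (2 * ω) * ‖yosida R p.2 x‖ * p.1)
        (𝓝[≥] 0 ×ˢ atTop) (𝓝 0) := by
      have hid : Tendsto (fun p : ℝ × ℝ => p.1) (𝓝[≥] 0 ×ˢ atTop) (𝓝 (0 : ℝ)) :=
        tendsto_fst.mono_right nhdsWithin_le_nhds
      have := (((h.tendsto_yosida hz).comp tendsto_snd).norm.const_mul (M * Real.exp (2 * ω))).mul hid
      simpa using this
    refine squeeze_zero_norm' ?_ h2
    filter_upwards [hge] with p hp
    have := norm_image_sub_le_of_norm_deriv_le_segment'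
      (f := fun s => expOp (yosida R p.2) s x)
      (f' := fun s => expOp (yosida R p.2) s (yosida R p.2 x)) (a := 0) (b := p.1)
      (fun s _ => (hasDerivAt_expOp _ x s).hasDerivWithinAt)
      (fun s hs => (expOp (yosida R p.2) s).le_of_opNorm_le
        (h.norm_expOp_le_of_le_one hp.2 hs.1 (hs.2.le.trans hp.1.2)) _) p.1 (Set.right_mem_Icc.2 hp.1.1)
    simpa [expOp_zero] using this

/-- The derivative of `exp (s A_λ) x - s z` is `exp (s A_λ) A_λ x - z`, which is small jointly for
small `s` and large `λ`; the mean value inequality then bounds the quotient. -/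
theorem tendsto_difference_quotient (h : IsHilleYosidaResolvent A R lam₀ ω M) {x z : X}
    (hx : (x, z) ∈ A.graph) :
    Tendsto (fun p : ℝ × ℝ => p.1⁻¹ • (expOp (yosida R p.2) p.1 x - x)) (𝓝[>] 0 ×ˢ atTop) (𝓝 z) := by
  have h1 : Tendsto (fun p : ℝ × ℝ => expOp (yosida R p.2) p.1 (yosida R p.2 x))
      (𝓝[≥] 0 ×ˢ atTop) (𝓝 z) := by
    have h2 : Tendsto (fun p : ℝ × ℝ => expOp (yosida R p.2) p.1 (yosida R p.2 x - z))
        (𝓝[≥] 0 ×ˢ atTop) (𝓝 0) := by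
      have h3 : Tendsto (fun p : ℝ × ℝ => M * Real.exp (2 * ω) * ‖yosida R p.2 x - z‖)
          (𝓝[≥] 0 ×ˢ atTop) (𝓝 0) := by
        have := (tendsto_sub_nhds_zero_iff.2
          ((h.tendsto_yosida hx).comp (tendsto_snd (f := 𝓝[≥] (0 : ℝ))))).norm.const_mul (M * Real.exp (2 * ω))
        simpa using this
      refine squeeze_zero_norm' ?_ h3
      filter_upwards [h.eventually_norm_expOp_le] with p hp
      exact (expOp (yosida R p.2) p.1).le_of_opNorm_le hp _
    simpa using h2.add (h.tendsto_expOp_apply z)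
  rw [Metric.tendsto_nhds]
  intro ε hε
  obtain ⟨pa, hpa, pb, hpb, hp⟩ :=
    eventually_prod_iff.1 (Metric.tendsto_nhds.1 h1 (ε / 2) (by positivity))
  -- The smallness must hold along the whole segment from `0` to `t`, hence an interval rather than
  -- an arbitrary neighbourhood.
  obtain ⟨δ, hδ, hsub⟩ := mem_nhdsGE_iff_exists_Ico_subset.1 hpa
  have hIoo : ∀ᶠ t : ℝ in 𝓝[>] 0, t ∈ Set.Ioo 0 δ := Ioo_mem_nhdsGT hδ
  filter_upwards [hIoo.prod_mk hpb] with p ⟨⟨ht0, htδ⟩, hlam⟩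
  have hd : ∀ s : ℝ, HasDerivAt (fun s : ℝ => expOp (yosida R p.2) s x - s • z)
      (expOp (yosida R p.2) s (yosida R p.2 x) - z) s := fun s => by
    simpa using (hasDerivAt_expOp (yosida R p.2) x s).fun_sub ((hasDerivAt_id s).smul_const z)
  have h2 := norm_image_sub_le_of_norm_deriv_le_segment' (a := 0) (b := p.1) (C := ε / 2)
    (fun s _ => (hd s).hasDerivWithinAt)
    (fun s hs => by
      rw [← dist_eq_norm]
      exact (hp (hsub ⟨hs.1, hs.2.trans htδ⟩) hlam).le) p.1 (Set.right_mem_Icc.2 ht0.le)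
  simp only [expOp_zero, one_apply_eq_self, zero_smul, sub_zero] at h2
  have h3 : p.1⁻¹ • (expOp (yosida R p.2) p.1 x - x) - z =
      p.1⁻¹ • (expOp (yosida R p.2) p.1 x - p.1 • z - x) := by
    rw [sub_right_comm, smul_sub _ _ (p.1 • z), inv_smul_smul₀ ht0.ne']
  rw [dist_eq_norm, h3, norm_smul, norm_inv, Real.norm_of_nonneg ht0.le]
  calc p.1⁻¹ * ‖expOp (yosida R p.2) p.1 x - p.1 • z - x‖ ≤ p.1⁻¹ * (ε / 2 * p.1) := by gcongr
    _ = ε / 2 := by field_simp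
    _ < ε := by linarith

/-- The Hille–Yosida theorem. -/
theorem generatesC0Semigroup (h : IsHilleYosidaResolvent A R lam₀ ω M) :
    GeneratesC0Semigroup A := by
  obtain ⟨T, hT⟩ := h.exists_limit
  have hcoe : Tendsto (fun t : ℝ≥0 => (t : ℝ)) (𝓝[>] 0) (𝓝[>] 0) := by
    refine tendsto_nhdsWithin_iff.2 ⟨?_, ?_⟩
    · exact (NNReal.continuous_coe.tendsto 0).mono_left nhdsWithin_le_nhds
    · filter_upwards [self_mem_nhdsWithin] with t ht
      exact NNReal.coe_pos.2 ht
  have hTr : ∀ (t : ℝ) (_ : 0 ≤ t) (x : X),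
      Tendsto (fun lam : ℝ => expOp (yosida R lam) t x) atTop (𝓝 (T t.toNNReal x)) := by
    intro t ht x
    have := hT t.toNNReal x
    rwa [Real.coe_toNNReal t ht] at this
  have hsg : IsC0Semigroup T := by
    refine ⟨?_, fun s t => ?_, fun x => ?_⟩
    · ext x
      refine tendsto_nhds_unique (hT 0 x) ?_
      simp [expOp_zero]
    · ext x
      refine tendsto_nhds_unique (hT (s + t) x) ?_
      have h0 : Tendsto (fun lam : ℝ => expOp (yosida R lam) s (expOp (yosida R lam) t x - T t x))
          atTop (𝓝 0) := by
        have h1 : Tendsto (fun lam : ℝ =>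
            M * Real.exp (2 * ω * s) * ‖expOp (yosida R lam) t x - T t x‖) atTop (𝓝 0) := by
          simpa using (tendsto_sub_nhds_zero_iff.2 (hT t x)).norm.const_mul
            (M * Real.exp (2 * ω * s))
        refine squeeze_zero_norm' ?_ h1
        filter_upwards [eventually_ge_atTop lam₀] with lam hl
        exact (expOp (yosida R lam) s).le_of_opNorm_le (h.norm_expOp_le hl s.2) _
      have h2 := h0.add (hT s (T t x))
      rw [zero_add] at h2
      refine h2.congr fun lam => ?_
      rw [← map_add, sub_add_cancel, NNReal.coe_add, expOp_add, mul_apply_eq_comp]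
    · have h1 := tendsto_of_tendsto_prod (G := fun t => T t.toNNReal x) (h.tendsto_expOp_apply x)
        (by filter_upwards [self_mem_nhdsWithin] with t ht using hTr t ht x)
      refine (h1.comp (hcoe.mono_right (nhdsWithin_mono _ Set.Ioi_subset_Ici_self))).congr fun t => ?_
      simp
  have hgen : ∀ x z, (x, z) ∈ A.graph →
      Tendsto (fun t : ℝ≥0 => (((t : ℝ) : 𝕜)⁻¹) • (T t x - x)) (𝓝[>] 0) (𝓝 z) := by
    intro x z hx
    have h1 := tendsto_of_tendsto_prod (G := fun t : ℝ => t⁻¹ • (T t.toNNReal x - x))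
      (h.tendsto_difference_quotient hx) (by
        filter_upwards [self_mem_nhdsWithin] with t ht
        exact ((hTr t (le_of_lt ht) x).sub_const x).const_smul _)
    refine (h1.comp hcoe).congr fun t => ?_
    simp only [Function.comp_apply, Real.toNNReal_coe]
    rw [RCLike.real_smul_eq_coe_smul (K := 𝕜), RCLike.ofReal_inv]
  refine ⟨T, hsg, fun x y => ⟨hgen x y, fun hxy => ?_⟩⟩
  -- The generator of `T` is no larger than `A`: the resolvent estimate makes `λ` minus the
  -- generator injective, so `x` coincides with `R(λ) (λ x - y)`, which lies in the domain of `A`.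
  obtain ⟨C, lam₁, -, hlam₁, hres⟩ := hsg.exists_resolvent_bound
  set lam := max lam₀ lam₁
  have hl0 : lam₀ ≤ lam := le_max_left _ _
  have hg := h.mem_graph lam hl0 ((lam : 𝕜) • x - y)
  set x' := R lam ((lam : 𝕜) • x - y)
  have h1 := hgen _ _ hg
  have h2 := hres lam (le_max_right _ _) (x - x') (y - ((lam : 𝕜) • x' - ((lam : 𝕜) • x - y)))
    ((hxy.sub h1).congr fun t => by rw [← smul_sub, map_sub]; congr 1; abel)
  have h3 : (lam : 𝕜) • (x - x') - (y - ((lam : 𝕜) • x' - ((lam : 𝕜) • x - y))) = 0 := by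
    rw [smul_sub]; abel
  rw [h3, norm_zero, mul_zero] at h2
  have h4 : x = x' := by
    have hpos : 0 < lam := hlam₁.trans_le (le_max_right _ _)
    rw [← sub_eq_zero, ← norm_le_zero_iff]
    by_contra hcon
    push Not at hcon
    linarith [mul_pos hpos hcon]
  rw [← h4, sub_sub_cancel] at hg
  exact hg

end IsHilleYosidaResolvent

end HilleYosida
end HBCS

namespace HBCS

/-! ### The Lumer–Phillips theorem and bounded perturbations. -/

section Dissipative

variable {𝕜 : Type*} [RCLike 𝕜] {X : Type*} [NormedAddCommGroup X] [InnerProductSpace 𝕜 X]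

/-- `A` is `ω`-dissipative for the inner product `⟪S x, S y⟫`, and `λ - A` is surjective for all
large real `λ`. -/
structure IsQuasiMDissipative (A : X →ₗ.[𝕜] X) (S : X ≃L[𝕜] X) (ω : ℝ) : Prop where
  re_inner_le : ∀ x z, (x, z) ∈ A.graph → RCLike.re (inner 𝕜 (S x) (S z)) ≤ ω * ‖S x‖ ^ 2
  exists_range : ∃ lam₀ : ℝ, ∀ lam ≥ lam₀, ∀ y, ∃ x, (x, (lam : 𝕜) • x - y) ∈ A.graph

namespace IsQuasiMDissipative

variable {A : X →ₗ.[𝕜] X} {S : X ≃L[𝕜] X} {ω : ℝ}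

theorem norm_le (h : ∀ x z, (x, z) ∈ A.graph → RCLike.re (inner 𝕜 (S x) (S z)) ≤ ω * ‖S x‖ ^ 2)
    {x z : X} (hx : (x, z) ∈ A.graph) (lam : ℝ) :
    (lam - ω) * ‖S x‖ ≤ ‖S ((lam : 𝕜) • x - z)‖ := by
  have h1 := h x z hx
  have h2 : (lam - ω) * ‖S x‖ ^ 2 ≤ RCLike.re (inner 𝕜 (S x) (S ((lam : 𝕜) • x - z))) := by
    rw [map_sub, map_smul, inner_sub_right, inner_smul_right, map_sub, RCLike.re_ofReal_mul,
      ← norm_sq_eq_re_inner]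
    linarith
  have h3 := h2.trans (re_inner_le_norm _ _)
  rcases (norm_nonneg (S x)).eq_or_lt with h0 | h0
  · rw [← h0, mul_zero]
    exact norm_nonneg _
  · have h4 : ‖S x‖ * ((lam - ω) * ‖S x‖) ≤ ‖S x‖ * ‖S ((lam : 𝕜) • x - z)‖ := by
      calc _ = (lam - ω) * ‖S x‖ ^ 2 := by ring
        _ ≤ _ := h3
    exact le_of_mul_le_mul_left h4 h0

theorem exists_resolvent (h : IsQuasiMDissipative A S ω) :
    ∃ lam₀ : ℝ, ω < lam₀ ∧ ∃ R : ℝ → X →L[𝕜] X, ∀ lam ≥ lam₀,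
      (∀ y, (R lam y, (lam : 𝕜) • R lam y - y) ∈ A.graph) ∧
      (∀ x z, (x, z) ∈ A.graph → R lam ((lam : 𝕜) • x - z) = x) ∧
      ∀ y, ‖S (R lam y)‖ ≤ (lam - ω)⁻¹ * ‖S y‖ := by
  obtain ⟨lam₀, hrange⟩ := h.exists_range
  refine ⟨max lam₀ (ω + 1), by linarith [le_max_right lam₀ (ω + 1)], ?_⟩
  have key : ∀ lam : ℝ, max lam₀ (ω + 1) ≤ lam → ∃ R : X →L[𝕜] X,
      (∀ y, (R y, (lam : 𝕜) • R y - y) ∈ A.graph) ∧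
      (∀ x z, (x, z) ∈ A.graph → R ((lam : 𝕜) • x - z) = x) ∧
      ∀ y, ‖S (R y)‖ ≤ (lam - ω)⁻¹ * ‖S y‖ := by
    intro lam hlam
    have hpos : 0 < lam - ω := by linarith [le_max_right lam₀ (ω + 1)]
    have hinj : ∀ x z, (x, z) ∈ A.graph → (lam : 𝕜) • x - z = 0 → x = 0 := by
      intro x z hx h0
      have h1 := norm_le h.re_inner_le hx lam
      rw [h0, map_zero, norm_zero] at h1
      have h2 : ‖S x‖ ≤ 0 := by
        by_contra hcon
        push Not at hcon
        linarith [mul_pos hpos hcon]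
      exact (map_eq_zero_iff S S.injective).1 (norm_le_zero_iff.1 h2)
    choose r hr using hrange lam ((le_max_left _ _).trans hlam)
    have huniq : ∀ x z, (x, z) ∈ A.graph → r ((lam : 𝕜) • x - z) = x := by
      intro x z hx
      rw [← sub_eq_zero]
      refine hinj _ _ (A.graph.sub_mem (hr _) hx) ?_
      simp only [smul_sub]
      abel
    have hbound : ∀ y, ‖S (r y)‖ ≤ (lam - ω)⁻¹ * ‖S y‖ := by
      intro y
      have h1 := norm_le h.re_inner_le (hr y) lam
      rw [sub_sub_cancel] at h1
      rw [inv_mul_eq_div, le_div_iff₀ hpos, mul_comm]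
      exact h1
    let rlin : X →ₗ[𝕜] X :=
      { toFun := r
        map_add' := fun y y' => by
          rw [← huniq _ _ (A.graph.add_mem (hr y) (hr y'))]
          congr 1
          simp only [smul_add]
          abel
        map_smul' := fun c y => by
          rw [RingHom.id_apply, ← huniq _ _ (A.graph.smul_mem c (hr y))]
          congr 1
          simp only [smul_sub]
          rw [smul_comm c]
          abel }
    refine ⟨rlin.mkContinuous (‖(S.symm : X →L[𝕜] X)‖ * ((lam - ω)⁻¹ * ‖(S : X →L[𝕜] X)‖))
      fun y => ?_, hr, huniq, hbound⟩
    calc ‖r y‖ = ‖(S.symm : X →L[𝕜] X) (S (r y))‖ := by simp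
      _ ≤ ‖(S.symm : X →L[𝕜] X)‖ * ((lam - ω)⁻¹ * (‖(S : X →L[𝕜] X)‖ * ‖y‖)) := by
          refine ((S.symm : X →L[𝕜] X).le_opNorm _).trans ?_
          gcongr
          refine (hbound y).trans ?_
          gcongr
          exact (S : X →L[𝕜] X).le_opNorm y
      _ = _ := by ring
  choose! R hR using key
  exact ⟨R, hR⟩

/-- For `w` orthogonal to the domain, choose `y` with `⟪S x, S y⟫ = ⟪x, w⟫` for all `x`. Testing
dissipativity with `R(λ) y` gives `λ ‖S R(λ) y‖² ≤ ω ‖S R(λ) y‖²` with `λ > ω`, so `R(λ) y = 0`,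
hence `y = 0` and `w = 0`. -/
theorem dense_domain [CompleteSpace X] (h : IsQuasiMDissipative A S ω) :
    Dense (A.domain : Set X) := by
  rw [Submodule.dense_iff_topologicalClosure_eq_top, Submodule.topologicalClosure_eq_top_iff,
    Submodule.eq_bot_iff]
  intro w hw
  obtain ⟨lam₀, hlam₀, R, hR⟩ := h.exists_resolvent
  obtain ⟨hg, -, -⟩ := hR lam₀ le_rfl
  set S' := ContinuousLinearMap.adjoint (S.symm : X →L[𝕜] X) with hS'
  set y := S.symm (S' w) with hy
  have h1 : inner 𝕜 (S (R lam₀ y)) (S y) = 0 := by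
    rw [hy, S.apply_symm_apply, hS', ContinuousLinearMap.adjoint_inner_right]
    simpa using hw _ (LinearPMap.mem_domain_iff.2 ⟨_, hg y⟩)
  have h2 := h.re_inner_le _ _ (hg y)
  rw [map_sub, map_smul, inner_sub_right, inner_smul_right, h1, sub_zero, RCLike.re_ofReal_mul,
    ← norm_sq_eq_re_inner] at h2
  have h3 : ‖S (R lam₀ y)‖ ^ 2 = 0 := by nlinarith [sq_nonneg ‖S (R lam₀ y)‖]
  have h4 : R lam₀ y = 0 :=
    (map_eq_zero_iff S S.injective).1 (norm_eq_zero.1 (pow_eq_zero_iff two_ne_zero |>.1 h3))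
  have h5 := hg y
  rw [h4, smul_zero, zero_sub] at h5
  have h6 : y = 0 := neg_eq_zero.1 (A.graph_fst_eq_zero_snd h5 rfl)
  have h7 : S' w = 0 := (map_eq_zero_iff S.symm S.symm.injective).1 h6
  refine ext_inner_left 𝕜 fun v => ?_
  have h8 := ContinuousLinearMap.adjoint_inner_right (S.symm : X →L[𝕜] X) (S v) w
  rw [← hS', h7] at h8
  simpa using h8.symm

/-- The Lumer–Phillips theorem for an equivalent inner product. -/
theorem generatesC0Semigroup [CompleteSpace X] [NormedSpace ℝ X] [IsScalarTower ℝ 𝕜 X]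
    (h : IsQuasiMDissipative A S ω) (hω : 0 ≤ ω) : GeneratesC0Semigroup A := by
  obtain ⟨lam₀, hlam₀, R, hR⟩ := h.exists_resolvent
  have hle : ∀ lam ≥ max lam₀ (2 * ω + 1), lam₀ ≤ lam := fun lam hl => (le_max_left _ _).trans hl
  refine IsHilleYosidaResolvent.generatesC0Semigroup (R := R) (lam₀ := max lam₀ (2 * ω + 1))
    (M := ‖(S.symm : X →L[𝕜] X)‖ * ‖(S : X →L[𝕜] X)‖) (ω := ω)
    ⟨hω, le_max_right _ _, fun lam hl => (hR lam (hle lam hl)).1,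
      fun lam hl => (hR lam (hle lam hl)).2.1, fun lam hl k => ?_, h.dense_domain⟩
  have hpos : 0 ≤ (lam - ω)⁻¹ := inv_nonneg.2 (by linarith [hle lam hl])
  -- Powers are estimated in the norm `‖S ·‖`, where the constant is `1`; converting to the original
  -- norm once makes `M` independent of `k`.
  have h1 : ∀ y, ‖S ((R lam ^ k) y)‖ ≤ ((lam - ω)⁻¹) ^ k * ‖S y‖ := by
    intro y
    induction k with
    | zero => simp
    | succ k ih =>
      rw [pow_succ', mul_apply_eq_comp, pow_succ', mul_assoc]
      refine ((hR lam (hle lam hl)).2.2 _).trans ?_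
      gcongr
  refine ContinuousLinearMap.opNorm_le_bound _ (by positivity) fun y => ?_
  calc ‖(R lam ^ k) y‖ = ‖(S.symm : X →L[𝕜] X) (S ((R lam ^ k) y))‖ := by simp
    _ ≤ ‖(S.symm : X →L[𝕜] X)‖ * (((lam - ω)⁻¹) ^ k * (‖(S : X →L[𝕜] X)‖ * ‖y‖)) := by
        refine ((S.symm : X →L[𝕜] X).le_opNorm _).trans ?_
        gcongr
        refine (h1 y).trans ?_
        gcongr
        exact (S : X →L[𝕜] X).le_opNorm y
    _ = _ := by ring

/-- Bounded perturbations of quasi-m-dissipative operators are quasi-m-dissipative. -/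
theorem add_bounded [CompleteSpace X] (h : IsQuasiMDissipative A S ω) (hω : 0 ≤ ω)
    (B : X →L[𝕜] X) {A' : X →ₗ.[𝕜] X}
    (hA' : ∀ x z, (x, z) ∈ A.graph ↔ (x, z + B x) ∈ A'.graph) :
    ∃ ω' ≥ 0, IsQuasiMDissipative A' S ω' := by
  set N := ‖(S : X →L[𝕜] X) ∘L B ∘L (S.symm : X →L[𝕜] X)‖ with hN
  have hN0 : 0 ≤ N := norm_nonneg _
  refine ⟨ω + N, by linarith, fun x z hx => ?_, ?_⟩
  · have h1 := h.re_inner_le x (z - B x) ((hA' _ _).2 (by rwa [sub_add_cancel]))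
    rw [map_sub, inner_sub_right, map_sub] at h1
    have h2 : RCLike.re (inner 𝕜 (S x) (S (B x))) ≤ N * ‖S x‖ ^ 2 := by
      refine (re_inner_le_norm _ _).trans ?_
      have h3 : ‖S (B x)‖ ≤ N * ‖S x‖ := by
        simpa using ((S : X →L[𝕜] X) ∘L B ∘L (S.symm : X →L[𝕜] X)).le_opNorm (S x)
      nlinarith [norm_nonneg (S x)]
    linarith
  · obtain ⟨lam₀, hlam₀, R, hR⟩ := h.exists_resolvent
    refine ⟨max lam₀ (ω + N + 1), fun lam hlam y => ?_⟩
    obtain ⟨hg, -, hb⟩ := hR lam ((le_max_left _ _).trans hlam)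
    have hpos : 0 < lam - ω := by linarith [le_max_right lam₀ (ω + N + 1)]
    -- From `λ - A - B = (1 - B R(λ)) (λ - A)`; conjugation by `S` makes the perturbation a strict
    -- contraction, so a Neumann series applies.
    set K := (S : X →L[𝕜] X) ∘L B ∘L R lam ∘L (S.symm : X →L[𝕜] X) with hK
    have hKn : ‖K‖ < 1 := by
      have h1 : ‖K‖ ≤ N * (lam - ω)⁻¹ := by
        refine ContinuousLinearMap.opNorm_le_bound _ (by positivity) fun v => ?_
        have h2 := ((S : X →L[𝕜] X) ∘L B ∘L (S.symm : X →L[𝕜] X)).le_opNorm (S (R lam (S.symm v)))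
        have h3 := hb (S.symm v)
        rw [S.apply_symm_apply] at h3
        calc ‖K v‖ ≤ N * ‖S (R lam (S.symm v))‖ := by simpa [hK] using h2
          _ ≤ N * ((lam - ω)⁻¹ * ‖v‖) := by gcongr
          _ = _ := by ring
      refine h1.trans_lt ?_
      rw [← div_eq_mul_inv, div_lt_one hpos]
      linarith [le_max_right lam₀ (ω + N + 1)]
    obtain ⟨u, hu⟩ := isUnit_one_sub_of_norm_lt_one hKn
    set v := (↑u⁻¹ : X →L[𝕜] X) (S y) with hv
    have h1 : v - K v = S y := by
      have : (1 - K) v = S y := by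
        rw [← hu, hv, ← mul_apply_eq_comp, Units.mul_inv, one_apply_eq_self]
      simpa using this
    have h2 : S.symm v - B (R lam (S.symm v)) = y := by
      apply S.injective
      rw [map_sub, S.apply_symm_apply]
      exact h1
    refine ⟨R lam (S.symm v), ?_⟩
    have h3 := (hA' _ _).1 (hg (S.symm v))
    convert h3 using 2
    rw [← h2]
    abel

end IsQuasiMDissipative

end Dissipative
end HBCS

namespace HBCS

/-! ### The product rule for absolutely continuous functions. -/

section ProductRule

variable {E F G : Type*} [NormedAddCommGroup E] [NormedSpace ℝ E]
  [NormedAddCommGroup F] [NormedSpace ℝ F] [NormedAddCommGroup G] [NormedSpace ℝ G]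

theorem integrable_bilin_prod {μ : Measure ℝ} [SFinite μ] (B : E →L[ℝ] F →L[ℝ] G)
    {p : ℝ → E} {q : ℝ → F}
    (hp : Integrable p μ) (hq : Integrable q μ) :
    Integrable (fun z : ℝ × ℝ => B (p z.1) (q z.2)) (μ.prod μ) := by
  have h1 := (hp.norm.mul_prod hq.norm).const_mul ‖B‖
  refine h1.mono' (B.aestronglyMeasurable_comp₂ hp.1.comp_fst hq.1.comp_snd) ?_
  refine Eventually.of_forall fun z => ?_
  rw [← mul_assoc]
  exact B.le_opNorm₂ _ _

variable [CompleteSpace E] [CompleteSpace F] [CompleteSpace G]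

/-- Fubini on the square, split along the diagonal. The diagonal goes to the first half (`Iic`
against `Iio`), so atoms do no harm. -/
theorem bilin_integral_integral_eq {μ : Measure ℝ} [SFinite μ] (B : E →L[ℝ] F →L[ℝ] G)
    {p : ℝ → E} {q : ℝ → F}
    (hp : Integrable p μ) (hq : Integrable q μ) :
    B (∫ s, p s ∂μ) (∫ s, q s ∂μ) =
      ∫ s, B (p s) (∫ r in Set.Iic s, q r ∂μ) ∂μ + ∫ s, B (∫ r in Set.Iio s, p r ∂μ) (q s) ∂μ := by
  have hint := integrable_bilin_prod B hp hq
  have hD : MeasurableSet {z : ℝ × ℝ | z.2 ≤ z.1} := measurableSet_le measurable_snd measurable_fst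
  have h0 : ∫ z, B (p z.1) (q z.2) ∂(μ.prod μ) = B (∫ s, p s ∂μ) (∫ s, q s ∂μ) := by
    rw [integral_prod _ hint]
    have : ∀ s, ∫ r, B (p s) (q r) ∂μ = (B.flip (∫ r, q r ∂μ)) (p s) := fun s =>
      (B (p s)).integral_comp_comm hq
    simp only [this]
    rw [(B.flip (∫ r, q r ∂μ)).integral_comp_comm hp]
    rfl
  rw [← h0, ← integral_add_compl hD hint, ← integral_indicator hD, ← integral_indicator hD.compl,
    integral_prod _ (hint.indicator hD), integral_prod_symm _ (hint.indicator hD.compl)]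
  congr 1
  · congr 1 with s
    rw [← (B (p s)).integral_comp_comm hq.integrableOn, ← integral_indicator measurableSet_Iic]
    rfl
  · congr 1 with s
    have h1 : (B (∫ r in Set.Iio s, p r ∂μ)) (q s) = ∫ r in Set.Iio s, B (p r) (q s) ∂μ :=
      ((B.flip (q s)).integral_comp_comm hp.integrableOn).symm
    rw [h1, ← integral_indicator measurableSet_Iio]
    congr 1 with r
    by_cases hr : r < s
    · rw [Set.indicator_of_mem (by simpa using hr), Set.indicator_of_mem (by simpa using hr)]
    · rw [Set.indicator_of_notMem (by simpa using hr), Set.indicator_of_notMem (by simpa using hr)]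

/-- The product rule for absolutely continuous functions, in integrated form. -/
theorem bilin_eq_add_integral (B : E →L[ℝ] F →L[ℝ] G) {u p : ℝ → E} {v q : ℝ → F} {a c : ℝ}
    (hac : a ≤ c) (hp : IntegrableOn p (Set.Icc a c)) (hq : IntegrableOn q (Set.Icc a c))
    (hu : ∀ s ∈ Set.Icc a c, u s = u a + ∫ r in a..s, p r)
    (hv : ∀ s ∈ Set.Icc a c, v s = v a + ∫ r in a..s, q r) :
    B (u c) (v c) = B (u a) (v a) + ∫ s in a..c, (B (p s) (v s) + B (u s) (q s)) := by
  have hp' : IntegrableOn p (Set.Ioc a c) := hp.mono_set Set.Ioc_subset_Icc_self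
  have hq' : IntegrableOn q (Set.Ioc a c) := hq.mono_set Set.Ioc_subset_Icc_self
  have hU : ContinuousOn (fun s => ∫ r in a..s, p r) (Set.Icc a c) := by
    have := intervalIntegral.continuousOn_primitive_interval'
      ((intervalIntegrable_iff_integrableOn_Icc_of_le hac).2 hp) Set.left_mem_uIcc
    rwa [Set.uIcc_of_le hac] at this
  have hV : ContinuousOn (fun s => ∫ r in a..s, q r) (Set.Icc a c) := by
    have := intervalIntegral.continuousOn_primitive_interval'
      ((intervalIntegrable_iff_integrableOn_Icc_of_le hac).2 hq) Set.left_mem_uIcc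
    rwa [Set.uIcc_of_le hac] at this
  have hbil : ∀ {w : ℝ → E} {x : ℝ → F}, IntegrableOn w (Set.Icc a c) →
      ContinuousOn x (Set.Icc a c) → IntegrableOn (fun s => B (w s) (x s)) (Set.Icc a c) := by
    intro w x hw hx
    obtain ⟨C, hC⟩ := isCompact_Icc.exists_bound_of_continuousOn hx
    exact B.integrable_of_bilin_of_bdd_right C hw (hx.aestronglyMeasurable measurableSet_Icc)
      ((ae_restrict_iff' measurableSet_Icc).2 (Eventually.of_forall hC))
  have hbil' : ∀ {w : ℝ → E} {x : ℝ → F}, ContinuousOn w (Set.Icc a c) →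
      IntegrableOn x (Set.Icc a c) → IntegrableOn (fun s => B (w s) (x s)) (Set.Icc a c) := by
    intro w x hw hx
    obtain ⟨C, hC⟩ := isCompact_Icc.exists_bound_of_continuousOn hw
    exact B.integrable_of_bilin_of_bdd_left C (hw.aestronglyMeasurable measurableSet_Icc)
      ((ae_restrict_iff' measurableSet_Icc).2 (Eventually.of_forall hC)) hx
  have hii : ∀ {w : ℝ → G}, IntegrableOn w (Set.Icc a c) → IntervalIntegrable w volume a c :=
    fun hw => (intervalIntegrable_iff_integrableOn_Icc_of_le hac).2 hw
  have key : B (∫ r in a..c, p r) (∫ r in a..c, q r) =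
      (∫ s in a..c, B (p s) (∫ r in a..s, q r)) + ∫ s in a..c, B (∫ r in a..s, p r) (q s) := by
    simp only [intervalIntegral.integral_of_le hac]
    rw [bilin_integral_integral_eq B hp' hq']
    congr 1
    · refine setIntegral_congr_fun measurableSet_Ioc fun s hs => ?_
      rw [intervalIntegral.integral_of_le hs.1.le, Measure.restrict_restrict measurableSet_Iic,
        Set.Iic_inter_Ioc_of_le hs.2]
    · refine setIntegral_congr_fun measurableSet_Ioc fun s hs => ?_
      have hset : Set.Iio s ∩ Set.Ioc a c = Set.Ioo a s := by
        ext r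
        simp only [Set.mem_inter_iff, Set.mem_Iio, Set.mem_Ioc, Set.mem_Ioo]
        exact ⟨fun h => ⟨h.2.1, h.1⟩, fun h => ⟨h.2, h.1, h.2.le.trans hs.2⟩⟩
      rw [intervalIntegral.integral_of_le hs.1.le, Measure.restrict_restrict measurableSet_Iio,
        hset, integral_Ioc_eq_integral_Ioo]
  have e1 : ∫ s in a..c, (B (p s) (v s) + B (u s) (q s)) =
      ∫ s in a..c, ((B (p s) (v a) + B (u a) (q s)) +
        (B (p s) (∫ r in a..s, q r) + B (∫ r in a..s, p r) (q s))) := by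
    refine intervalIntegral.integral_congr fun s hs => ?_
    rw [Set.uIcc_of_le hac] at hs
    rw [hu s hs, hv s hs, map_add, map_add, add_apply]
    abel
  have i1 := hii (hbil hp (continuousOn_const (c := v a)))
  have i2 := hii (hbil' (continuousOn_const (c := u a)) hq)
  have i3 := hii (hbil hp hV)
  have i4 := hii (hbil' hU hq)
  have hpi := (intervalIntegrable_iff_integrableOn_Icc_of_le hac).2 hp
  have hqi := (intervalIntegrable_iff_integrableOn_Icc_of_le hac).2 hq
  rw [e1, intervalIntegral.integral_add (i1.add i2) (i3.add i4), intervalIntegral.integral_add i1 i2,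
    intervalIntegral.integral_add i3 i4, ← key, hu c (Set.right_mem_Icc.2 hac),
    hv c (Set.right_mem_Icc.2 hac)]
  have e2 : ∫ s in a..c, B (p s) (v a) = B (∫ r in a..c, p r) (v a) :=
    (B.flip (v a)).intervalIntegral_comp_comm hpi
  have e3 : ∫ s in a..c, B (u a) (q s) = B (u a) (∫ r in a..c, q r) :=
    (B (u a)).intervalIntegral_comp_comm hqi
  simp only [e2, e3, map_add, add_apply]
  abel

end ProductRule

/-! ### Sobolev functions and multiplication operators. -/

section Sobolev

variable {𝕜 : Type*} [RCLike 𝕜] {n : ℕ} {a b : ℝ}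

theorem IsH1.integrableOn_Icc {f g : ℝ → EuclideanSpace 𝕜 (Fin n)} (h : IsH1 a b f g) {c : ℝ}
    (hc : c ≤ b) : IntegrableOn g (Set.Icc a c) :=
  h.intervalIntegrable.mono_set (Set.Icc_subset_Icc_right hc)

theorem memLp_of_continuousOn {F : Type*} [NormedAddCommGroup F] {f : ℝ → F}
    (hf : ContinuousOn f (Set.Icc a b)) (p : ℝ≥0∞) : MemLp f p (intervalMeasure a b) := by
  obtain ⟨C, hC⟩ := isCompact_Icc.exists_bound_of_continuousOn hf
  exact MemLp.of_bound (hf.aestronglyMeasurable measurableSet_Icc) C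
    ((ae_restrict_iff' measurableSet_Icc).2 (Eventually.of_forall hC))

theorem IsH1.clm_apply {f g : ℝ → EuclideanSpace 𝕜 (Fin n)} (h : IsH1 a b f g)
    {Φ Φ' : ℝ → EuclideanSpace 𝕜 (Fin n) →L[𝕜] EuclideanSpace 𝕜 (Fin n)}
    (hΦ : ∀ s, HasDerivAt Φ (Φ' s) s) (hΦ' : Continuous Φ') :
    IsH1 a b (fun s => Φ s (f s)) (fun s => Φ' s (f s) + Φ s (g s)) := by
  have hΦc : Continuous Φ := continuous_iff_continuousAt.2 fun s => (hΦ s).continuousAt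
  refine ⟨?_, fun ξ hξ => ?_⟩
  · refine MemLp.add (memLp_of_continuousOn (hΦ'.continuousOn.clm_apply h.continuousOn) 2) ?_
    exact (ContinuousLinearMap.id 𝕜
      (EuclideanSpace 𝕜 (Fin n) →L[𝕜] EuclideanSpace 𝕜 (Fin n))).memLp_of_bilin 2
      (memLp_of_continuousOn hΦc.continuousOn ∞) h.memLp
  · exact bilin_eq_add_integral
      ((ContinuousLinearMap.id 𝕜
        (EuclideanSpace 𝕜 (Fin n) →L[𝕜] EuclideanSpace 𝕜 (Fin n))).bilinearRestrictScalars ℝ) hξ.1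
      (hΦ'.integrableOn_Icc) (h.integrableOn_Icc hξ.2)
      (fun s _ => by
        rw [intervalIntegral.integral_eq_sub_of_hasDerivAt (fun x _ => hΦ x)
          (hΦ'.intervalIntegrable _ _), add_sub_cancel])
      (fun s hs => h.eq_integral s ⟨hs.1, hs.2.trans hξ.2⟩)

/-- The energy identity for a self-adjoint matrix. -/
theorem IsH1.energy_identity (hab : a ≤ b) {f g : ℝ → EuclideanSpace 𝕜 (Fin n)} (h : IsH1 a b f g)
    {P : EuclideanSpace 𝕜 (Fin n) →L[𝕜] EuclideanSpace 𝕜 (Fin n)}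
    (hP : (P : EuclideanSpace 𝕜 (Fin n) →ₗ[𝕜] EuclideanSpace 𝕜 (Fin n)).IsSymmetric) :
    2 * ∫ s in a..b, RCLike.re (inner 𝕜 (f s) (P (g s))) =
      RCLike.re (inner 𝕜 (f b) (P (f b))) - RCLike.re (inner 𝕜 (f a) (P (f a))) := by
  have hgi := (intervalIntegrable_iff_integrableOn_Icc_of_le hab).2 h.intervalIntegrable
  have h1 := bilin_eq_add_integral
    ((ContinuousLinearMap.compL ℝ (EuclideanSpace 𝕜 (Fin n)) 𝕜 ℝ RCLike.reCLM).comp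
      (isBoundedBilinearMap_inner (𝕜 := 𝕜)
        (E := EuclideanSpace 𝕜 (Fin n))).toContinuousLinearMap)
    (u := f) (p := g) (v := fun s => P (f s)) (q := fun s => P (g s)) hab
    h.intervalIntegrable (P.integrable_comp h.intervalIntegrable) h.eq_integral
    (fun s hs => by
      have hi : IntervalIntegrable g volume a s :=
        (intervalIntegrable_iff_integrableOn_Icc_of_le hs.1).2 (h.integrableOn_Icc hs.2)
      rw [h.eq_integral s hs, map_add, ← P.intervalIntegral_comp_comm hi])
  have h2 : ∀ x y, ((ContinuousLinearMap.compL ℝ (EuclideanSpace 𝕜 (Fin n)) 𝕜 ℝ RCLike.reCLM).comp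
      (isBoundedBilinearMap_inner (𝕜 := 𝕜)
        (E := EuclideanSpace 𝕜 (Fin n))).toContinuousLinearMap) x y =
      RCLike.re (inner 𝕜 x y) := fun x y => rfl
  simp only [h2] at h1
  rw [h1, add_sub_cancel_left, ← intervalIntegral.integral_const_mul]
  congr 1 with s
  -- Self-adjointness makes the two terms of the product rule equal in real part.
  have h3 : inner 𝕜 (g s) (P (f s)) = inner 𝕜 (P (g s)) (f s) := (hP (g s) (f s)).symm
  rw [h3, inner_re_symm, two_mul]

/-- Multiplication by an essentially bounded operator-valued function. -/
noncomputable def multOp (F : ℝ → EuclideanSpace 𝕜 (Fin n) →L[𝕜] EuclideanSpace 𝕜 (Fin n))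
    (hF : MemLp F ∞ (intervalMeasure a b)) : StateSpace 𝕜 n a b →L[𝕜] StateSpace 𝕜 n a b :=
  (ContinuousLinearMap.id 𝕜
    (EuclideanSpace 𝕜 (Fin n) →L[𝕜] EuclideanSpace 𝕜 (Fin n))).holderL _ ∞ 2 2 hF.toLp

theorem coeFn_multOp {F : ℝ → EuclideanSpace 𝕜 (Fin n) →L[𝕜] EuclideanSpace 𝕜 (Fin n)}
    (hF : MemLp F ∞ (intervalMeasure a b)) (x : StateSpace 𝕜 n a b) :
    multOp F hF x =ᵐ[intervalMeasure a b] fun ξ => F ξ (x ξ) := by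
  have h1 := (ContinuousLinearMap.id 𝕜
    (EuclideanSpace 𝕜 (Fin n) →L[𝕜] EuclideanSpace 𝕜 (Fin n))).coeFn_holder (r := 2) hF.toLp x
  filter_upwards [h1, hF.coeFn_toLp] with ξ h1 h2
  refine h1.trans ?_
  rw [h2]
  rfl

/-- Multiplication by a pointwise invertible function, as an isomorphism. -/
noncomputable def multEquiv (F F' : ℝ → EuclideanSpace 𝕜 (Fin n) →L[𝕜] EuclideanSpace 𝕜 (Fin n))
    (hF : MemLp F ∞ (intervalMeasure a b)) (hF' : MemLp F' ∞ (intervalMeasure a b))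
    (h : ∀ ξ ∈ Set.Icc a b, F ξ * F' ξ = 1) (h' : ∀ ξ ∈ Set.Icc a b, F' ξ * F ξ = 1) :
    StateSpace 𝕜 n a b ≃L[𝕜] StateSpace 𝕜 n a b :=
  ContinuousLinearEquiv.equivOfInverse (multOp F hF) (multOp F' hF')
    (fun x => by
      refine Lp.ext ?_
      filter_upwards [coeFn_multOp hF' (multOp F hF x), coeFn_multOp hF x,
        ae_restrict_mem measurableSet_Icc] with ξ h1 h2 hξ
      rw [h1, h2, ← mul_apply_eq_comp, h' ξ hξ, one_apply_eq_self])
    (fun x => by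
      refine Lp.ext ?_
      filter_upwards [coeFn_multOp hF (multOp F' hF' x), coeFn_multOp hF' x,
        ae_restrict_mem measurableSet_Icc] with ξ h1 h2 hξ
      rw [h1, h2, ← mul_apply_eq_comp, h ξ hξ, one_apply_eq_self])

/-- The operator on `𝕜ⁿ` given by a matrix. -/
noncomputable def matOp (A : Matrix (Fin n) (Fin n) 𝕜) :
    EuclideanSpace 𝕜 (Fin n) →L[𝕜] EuclideanSpace 𝕜 (Fin n) :=
  Matrix.toEuclideanCLM (n := Fin n) (𝕜 := 𝕜) A

theorem matOp_mul (A B : Matrix (Fin n) (Fin n) 𝕜) : matOp (A * B) = matOp A * matOp B :=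
  map_mul _ A B

theorem matOp_add (A B : Matrix (Fin n) (Fin n) 𝕜) : matOp (A + B) = matOp A + matOp B :=
  map_add _ A B

theorem matOp_smul (c : 𝕜) (A : Matrix (Fin n) (Fin n) 𝕜) : matOp (c • A) = c • matOp A :=
  map_smul _ c A

theorem matOp_one : matOp (1 : Matrix (Fin n) (Fin n) 𝕜) = 1 := map_one _

theorem matOp_zero : matOp (0 : Matrix (Fin n) (Fin n) 𝕜) = 0 := map_zero _

theorem matOp_apply (A : Matrix (Fin n) (Fin n) 𝕜) (v : EuclideanSpace 𝕜 (Fin n)) :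
    matOp A v = A.toEuclideanLin v := rfl

theorem memLp_sum_smul_const {V : Type*} [NormedAddCommGroup V] [NormedSpace 𝕜 V] {μ : Measure ℝ}
    {p : ℝ≥0∞} {c : ℝ → Matrix (Fin n) (Fin n) 𝕜} (hc : ∀ i j, MemLp (fun ξ => c ξ i j) p μ)
    (v : Fin n → Fin n → V) : MemLp (fun ξ => ∑ i, ∑ j, c ξ i j • v i j) p μ :=
  memLp_finsetSum _ fun i _ => memLp_finsetSum _ fun j _ =>
    (ContinuousLinearMap.toSpanSingleton 𝕜 (v i j)).comp_memLp' (hc i j)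

theorem memLp_matOp {P₀ : ℝ → Matrix (Fin n) (Fin n) 𝕜}
    (hP₀ : ∀ i j, MemLp (fun ξ => P₀ ξ i j) ∞ (intervalMeasure a b)) :
    MemLp (fun ξ => matOp (P₀ ξ)) ∞ (intervalMeasure a b) := by
  have h := memLp_sum_smul_const hP₀ (fun i j => matOp (Matrix.single i j (1 : 𝕜)))
  refine (memLp_congr_ae (Eventually.of_forall fun ξ => ?_)).1 h
  conv_rhs => rw [Matrix.matrix_eq_sum_single (P₀ ξ)]
  simp only [matOp, map_sum, ← map_smul, Matrix.smul_single, smul_eq_mul, mul_one]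

/-- Multiplication by `P₀` is bounded on `L²`, so in both directions of the theorem it is only a
perturbation of the case `P₀ = 0`. -/
theorem mem_opGraph_iff_add (P₁ : Matrix (Fin n) (Fin n) 𝕜) {P₀ : ℝ → Matrix (Fin n) (Fin n) 𝕜}
    (hP₀ : ∀ i j, MemLp (fun ξ => P₀ ξ i j) ∞ (intervalMeasure a b))
    (W : Matrix (Fin n) (Fin n ⊕ Fin n) 𝕜) (x z : StateSpace 𝕜 n a b) :
    (x, z) ∈ opGraph P₁ 0 W a b ↔
      (x, z + multOp (fun ξ => matOp (P₀ ξ)) (memLp_matOp hP₀) x) ∈ opGraph P₁ P₀ W a b := by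
  have hB := coeFn_multOp (memLp_matOp hP₀) x
  constructor
  · rintro ⟨f, g, h, hx, hW, hz⟩
    refine ⟨f, g, h, hx, hW, ?_⟩
    filter_upwards [Lp.coeFn_add z (multOp (fun ξ => matOp (P₀ ξ)) (memLp_matOp hP₀) x), hB, hx, hz]
      with ξ h1 h2 h3 h4
    rw [h1, Pi.add_apply, h2, h3, h4, matOp_apply]
    simp
  · rintro ⟨f, g, h, hx, hW, hz⟩
    refine ⟨f, g, h, hx, hW, ?_⟩
    filter_upwards [Lp.coeFn_add z (multOp (fun ξ => matOp (P₀ ξ)) (memLp_matOp hP₀) x), hB, hx, hz]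
      with ξ h1 h2 h3 h4
    rw [h1, Pi.add_apply, h2, h3, matOp_apply, add_left_inj] at h4
    simp [h4]

end Sobolev
end HBCS

namespace HBCS

/-! ### The weighted inner product and the boundary form. -/

section Weight

variable {𝕜 : Type*} [RCLike 𝕜] {n : ℕ}

/-- The affine function with value `c` at `s` and `d` at `t`. -/
noncomputable def affineWeight (s t c d ξ : ℝ) : ℝ := c + (d - c) / (t - s) * (ξ - s)

theorem affineWeight_left (s t c d : ℝ) : affineWeight s t c d s = c := by
  simp [affineWeight]

theorem affineWeight_right {s t : ℝ} (h : s < t) (c d : ℝ) : affineWeight s t c d t = d := by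
  have : t - s ≠ 0 := by linarith
  rw [affineWeight]
  field_simp
  ring

theorem affineWeight_pos {s t c d ξ : ℝ} (h : s < t) (hc : 0 < c) (hd : 0 < d)
    (hξ : ξ ∈ Set.Icc s t) : 0 < affineWeight s t c d ξ := by
  have h1 : 0 < t - s := by linarith
  have h2 : affineWeight s t c d ξ = (c * (t - ξ) + d * (ξ - s)) / (t - s) := by
    rw [affineWeight]
    field_simp
    ring
  rw [h2]
  refine div_pos ?_ h1
  rcases hξ.1.eq_or_lt with rfl | h3
  · nlinarith
  · have := mul_pos hd (sub_pos.2 h3)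
    have := mul_nonneg hc.le (sub_nonneg.2 hξ.2)
    linarith

theorem hasDerivAt_affineWeight (s t c d ξ : ℝ) :
    HasDerivAt (affineWeight s t c d) ((d - c) / (t - s)) ξ := by
  have h := (((hasDerivAt_id ξ).sub_const s).const_mul ((d - c) / (t - s))).const_add c
  rw [mul_one] at h
  exact h

theorem continuous_affineWeight (s t c d : ℝ) : Continuous (affineWeight s t c d) :=
  continuous_iff_continuousAt.2 fun ξ => (hasDerivAt_affineWeight s t c d ξ).continuousAt

variable (P : Matrix (Fin n) (Fin n) 𝕜)

/-- `α P₊ + β P₋`. -/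
noncomputable def signMat (α β : ℝ) : Matrix (Fin n) (Fin n) 𝕜 :=
  (α : 𝕜) • projPlus P + (β : 𝕜) • projMinus P

/-- The operator `α P₊ + β P₋`. -/
noncomputable def signOp (α β : ℝ) : EuclideanSpace 𝕜 (Fin n) →L[𝕜] EuclideanSpace 𝕜 (Fin n) :=
  matOp (signMat P α β)

theorem signOp_eq (α β : ℝ) :
    signOp P α β = (α : 𝕜) • matOp (projPlus P) + (β : 𝕜) • matOp (projMinus P) := by
  rw [signOp, signMat, matOp_add, matOp_smul, matOp_smul]

variable {P}

theorem signOp_mul_signOp (hP : P.IsHermitian) (hu : IsUnit P) (α β α' β' : ℝ) :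
    signOp P α β * signOp P α' β' = signOp P (α * α') (β * β') := by
  rw [signOp, signOp, ← matOp_mul, signOp]
  congr 1
  simp only [signMat, add_mul, mul_add, smul_mul_assoc, mul_smul_comm,
    projPlus_mul_projPlus hP hu, projPlus_mul_projMinus hP hu,
    projMinus_mul_projPlus hP hu, projMinus_mul_projMinus hP hu, smul_zero, smul_smul,
    add_zero, zero_add, RCLike.ofReal_mul]
  rw [mul_comm (α' : 𝕜), mul_comm (β' : 𝕜)]

theorem signOp_one_one (hP : P.IsHermitian) (hu : IsUnit P) : signOp P 1 1 = 1 := by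
  rw [signOp, signMat, RCLike.ofReal_one, one_smul, one_smul, projPlus_add_projMinus hP hu,
    matOp_one]

theorem signOp_mul_matOp_comm (hP : P.IsHermitian) (hu : IsUnit P) (α β : ℝ) :
    signOp P α β * matOp P = matOp P * signOp P α β := by
  rw [signOp, ← matOp_mul, ← matOp_mul]
  congr 1
  simp only [signMat, add_mul, mul_add, smul_mul_assoc, mul_smul_comm,
    projPlus_mul_comm hP hu, projMinus_mul_comm hP hu]

theorem Qplus_mul_signOp (hP : P.IsHermitian) (hu : IsUnit P) (α β : ℝ) :
    matOp (Qplus P) * signOp P α β = (α : 𝕜) • matOp (Qplus P) := by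
  rw [signOp, ← matOp_mul, ← matOp_smul]
  congr 1
  simp only [signMat, mul_add, mul_smul_comm, Qplus_mul_projPlus hP hu, Qplus_mul_projMinus hP hu,
    smul_zero, add_zero]

theorem Qminus_mul_signOp (hP : P.IsHermitian) (hu : IsUnit P) (α β : ℝ) :
    matOp (Qminus P) * signOp P α β = (β : 𝕜) • matOp (Qminus P) := by
  rw [signOp, ← matOp_mul, ← matOp_smul]
  congr 1
  simp only [signMat, mul_add, mul_smul_comm, Qminus_mul_projPlus hP hu,
    Qminus_mul_projMinus hP hu, smul_zero, zero_add]

theorem hasDerivAt_ofReal_smul_add {V : Type*} [NormedAddCommGroup V] [NormedSpace 𝕜 V]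
    [NormedSpace ℝ V] [IsScalarTower ℝ 𝕜 V] {α β : ℝ → ℝ} {α' β' ξ : ℝ} (hα : HasDerivAt α α' ξ)
    (hβ : HasDerivAt β β' ξ) (v w : V) :
    HasDerivAt (fun ξ => (α ξ : 𝕜) • v + (β ξ : 𝕜) • w) ((α' : 𝕜) • v + (β' : 𝕜) • w) ξ := by
  have h := (hα.smul_const v).fun_add (hβ.smul_const w)
  simpa only [RCLike.real_smul_eq_coe_smul (K := 𝕜)] using h

theorem continuousOn_ofReal_smul_add {V : Type*} [NormedAddCommGroup V] [NormedSpace 𝕜 V]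
    {α β : ℝ → ℝ} {s : Set ℝ} (hα : ContinuousOn α s) (hβ : ContinuousOn β s) (v w : V) :
    ContinuousOn (fun ξ => (α ξ : 𝕜) • v + (β ξ : 𝕜) • w) s :=
  ((RCLike.continuous_ofReal.comp_continuousOn hα).smul continuousOn_const).add
    ((RCLike.continuous_ofReal.comp_continuousOn hβ).smul continuousOn_const)

theorem hasDerivAt_signOp {α β : ℝ → ℝ} {α' β' : ℝ} {ξ : ℝ} (hα : HasDerivAt α α' ξ)
    (hβ : HasDerivAt β β' ξ) :
    HasDerivAt (fun ξ => signOp P (α ξ) (β ξ)) (signOp P α' β') ξ := by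
  have h := hasDerivAt_ofReal_smul_add (𝕜 := 𝕜) hα hβ (matOp (projPlus P)) (matOp (projMinus P))
  simp only [← signOp_eq] at h
  exact h

theorem continuousOn_signOp {α β : ℝ → ℝ} {s : Set ℝ} (hα : ContinuousOn α s)
    (hβ : ContinuousOn β s) : ContinuousOn (fun ξ => signOp P (α ξ) (β ξ)) s := by
  have h := continuousOn_ofReal_smul_add (𝕜 := 𝕜) hα hβ (matOp (projPlus P)) (matOp (projMinus P))
  simp only [← signOp_eq] at h
  exact h

/-- From `P = Q₊² - Q₋²` with both `Q₊` and `Q₋` symmetric. This splits the energy flux into its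
`E₊` and `E₋` parts. -/
theorem re_inner_matOp (hP : P.IsHermitian) (hu : IsUnit P) (v : EuclideanSpace 𝕜 (Fin n)) :
    RCLike.re (inner 𝕜 v (matOp P v)) = ‖matOp (Qplus P) v‖ ^ 2 - ‖matOp (Qminus P) v‖ ^ 2 := by
  have h1 : matOp P v = matOp (Qplus P) (matOp (Qplus P) v) -
      matOp (Qminus P) (matOp (Qminus P) v) := by
    conv_lhs => rw [← Qplus_sq_sub_Qminus_sq hP hu]
    simp only [matOp_apply, map_sub, LinearMap.sub_apply, toEuclideanLin_mul_apply]
  have h2 : inner 𝕜 v (matOp (Qplus P) (matOp (Qplus P) v)) =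
      inner 𝕜 (matOp (Qplus P) v) (matOp (Qplus P) v) :=
    (Qplus_isSymmetric P v (matOp (Qplus P) v)).symm
  have h3 : inner 𝕜 v (matOp (Qminus P) (matOp (Qminus P) v)) =
      inner 𝕜 (matOp (Qminus P) v) (matOp (Qminus P) v) :=
    (Qplus_isSymmetric (-P) v (matOp (Qminus P) v)).symm
  rw [h1, inner_sub_right, map_sub, h2, h3, ← norm_sq_eq_re_inner, ← norm_sq_eq_re_inner]

theorem norm_Qplus_add_Qminus_sq (hP : P.IsHermitian) (hu : IsUnit P)
    (v w : EuclideanSpace 𝕜 (Fin n)) :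
    ‖matOp (Qplus P) v + matOp (Qminus P) w‖ ^ 2 =
      ‖matOp (Qplus P) v‖ ^ 2 + ‖matOp (Qminus P) w‖ ^ 2 := by
  have h : inner 𝕜 (matOp (Qplus P) v) (matOp (Qminus P) w) = 0 := by
    have h1 : inner 𝕜 (matOp (Qplus P) v) (matOp (Qminus P) w) =
        inner 𝕜 v (matOp (Qplus P) (matOp (Qminus P) w)) := Qplus_isSymmetric P _ _
    rw [h1, ← mul_apply_eq_comp, ← matOp_mul, Qplus_mul_Qminus hP hu, matOp_zero, zero_apply,
      inner_zero_right]
  have h2 := norm_add_sq (𝕜 := 𝕜) (matOp (Qplus P) v) (matOp (Qminus P) w)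
  rw [h] at h2
  simpa using h2

/-- The boundary form is nonpositive for data weighted by a small `ε` on the inflow. -/
theorem boundary_form_nonpos (hP : P.IsHermitian) (hu : IsUnit P) {M : Matrix (Fin n) (Fin n) 𝕜}
    {ε : ℝ} (hε : 0 ≤ ε) (hεM : ε * ‖matOp M‖ ≤ 1) {vb va : EuclideanSpace 𝕜 (Fin n)}
    (h : matOp (Qplus P) vb + matOp (Qminus P) va =
      matOp M (matOp (Qminus P) vb + matOp (Qplus P) va)) :
    RCLike.re (inner 𝕜 (signOp P ε 1 vb) (matOp P (signOp P ε 1 vb))) -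
      RCLike.re (inner 𝕜 (signOp P 1 ε va) (matOp P (signOp P 1 ε va))) ≤ 0 := by
  rw [re_inner_matOp hP hu, re_inner_matOp hP hu, ← mul_apply_eq_comp, ← mul_apply_eq_comp,
    ← mul_apply_eq_comp, ← mul_apply_eq_comp, Qplus_mul_signOp hP hu, Qplus_mul_signOp hP hu,
    Qminus_mul_signOp hP hu, Qminus_mul_signOp hP hu, RCLike.ofReal_one, one_smul, one_smul,
    smul_apply, smul_apply, norm_smul, norm_smul, mul_pow, mul_pow, RCLike.norm_ofReal,
    abs_of_nonneg hε]
  have h1 := norm_Qplus_add_Qminus_sq hP hu vb va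
  have h2 := norm_Qplus_add_Qminus_sq hP hu va vb
  rw [add_comm] at h2
  -- `y` is the outflow and `M y` the inflow; by orthogonality the boundary form is `ε² ‖M y‖² -
  -- ‖y‖²`.
  set y := matOp (Qminus P) vb + matOp (Qplus P) va with hy
  rw [h] at h1
  have h3 : ε * ‖matOp M y‖ ≤ ‖y‖ := by
    calc ε * ‖matOp M y‖ ≤ ε * (‖matOp M‖ * ‖y‖) := by
          gcongr
          exact (matOp M).le_opNorm y
      _ = ε * ‖matOp M‖ * ‖y‖ := by ring
      _ ≤ 1 * ‖y‖ := by gcongr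
      _ = ‖y‖ := one_mul _
  have h4 : (ε * ‖matOp M y‖) ^ 2 ≤ ‖y‖ ^ 2 := by gcongr
  rw [mul_pow] at h4
  nlinarith

end Weight

section Dissipativity

variable {𝕜 : Type*} [RCLike 𝕜] {n : ℕ} {a b : ℝ} {P : Matrix (Fin n) (Fin n) 𝕜}

/-- Once the invertible `K` is cancelled, the boundary condition says that the inflow is `M` applied
to the outflow. -/
theorem boundaryValue_eq_zero_iff {K M : Matrix (Fin n) (Fin n) 𝕜} (hK : IsUnit K)
    {W : Matrix (Fin n) (Fin n ⊕ Fin n) 𝕜}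
    (hW : W = K * Matrix.fromCols (Qplus P - M * Qminus P) (Qminus P - M * Qplus P))
    (f : ℝ → EuclideanSpace 𝕜 (Fin n)) : boundaryValue W a b f = 0 ↔
      matOp (Qplus P) (f b) + matOp (Qminus P) (f a) =
        matOp M (matOp (Qminus P) (f b) + matOp (Qplus P) (f a)) := by
  rw [boundaryValue, hW, ← Matrix.mulVec_mulVec]
  have h1 : ∀ v : Fin n → 𝕜, K *ᵥ v = 0 ↔ v = 0 := fun v =>
    ⟨fun h => Matrix.mulVec_injective_of_isUnit hK (by rw [h, Matrix.mulVec_zero]),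
      fun h => by rw [h, Matrix.mulVec_zero]⟩
  have h2 : Matrix.fromCols (Qplus P - M * Qminus P) (Qminus P - M * Qplus P) *ᵥ
      Sum.elim (f b) (f a) =
      (matOp (Qplus P) (f b) + matOp (Qminus P) (f a) -
        matOp M (matOp (Qminus P) (f b) + matOp (Qplus P) (f a))).ofLp := by
    rw [Matrix.fromCols_mulVec]
    simp only [Function.comp_def, Sum.elim_inl, Sum.elim_inr, Matrix.sub_mulVec,
      ← Matrix.mulVec_mulVec, map_add, matOp_apply]
    simp only [Matrix.toLpLin_apply, WithLp.ofLp_sub, WithLp.ofLp_add]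
    abel
  rw [h1, h2, WithLp.ofLp_eq_zero, sub_eq_zero]

end Dissipativity
end HBCS

namespace HBCS

/-! ### Sufficiency: the factored boundary condition yields a generator. -/

section Generation

variable {𝕜 : Type*} [RCLike 𝕜] {n : ℕ} {a b : ℝ} {P : Matrix (Fin n) (Fin n) 𝕜}

theorem coe_multEquiv {F F' : ℝ → EuclideanSpace 𝕜 (Fin n) →L[𝕜] EuclideanSpace 𝕜 (Fin n)}
    (hF : MemLp F ∞ (intervalMeasure a b)) (hF' : MemLp F' ∞ (intervalMeasure a b))
    (h : ∀ ξ ∈ Set.Icc a b, F ξ * F' ξ = 1) (h' : ∀ ξ ∈ Set.Icc a b, F' ξ * F ξ = 1)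
    (x : StateSpace 𝕜 n a b) : multEquiv F F' hF hF' h h' x = multOp F hF x := rfl

theorem re_inner_eq_integral (hab : a ≤ b) {x y : StateSpace 𝕜 n a b}
    {f g : ℝ → EuclideanSpace 𝕜 (Fin n)} (hx : x =ᵐ[intervalMeasure a b] f)
    (hy : y =ᵐ[intervalMeasure a b] g) :
    RCLike.re (inner 𝕜 x y) = ∫ s in a..b, RCLike.re (inner 𝕜 (f s) (g s)) := by
  rw [L2.inner_def, ← integral_re (L2.integrable_inner x y), intervalIntegral.integral_of_le hab,
    ← integral_Icc_eq_integral_Ioc]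
  refine integral_congr_ae ?_
  filter_upwards [hx, hy] with s h1 h2
  rw [h1, h2]

/-- `S` multiplies by a positive weight on each of `E₊` and `E₋`, falling to `ε` at the inflow end
(`b` for `E₊`, `a` for `E₋`). It commutes with `P`, so the energy identity for `S x` gives
dissipativity up to the bounded term from the derivative of the weight. -/
theorem exists_dissipative (hab : a < b) (hP : P.IsHermitian) (hu : IsUnit P)
    {K M : Matrix (Fin n) (Fin n) 𝕜} (hK : IsUnit K) {W : Matrix (Fin n) (Fin n ⊕ Fin n) 𝕜}
    (hW : W = K * Matrix.fromCols (Qplus P - M * Qminus P) (Qminus P - M * Qplus P)) :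
    ∃ (S : StateSpace 𝕜 n a b ≃L[𝕜] StateSpace 𝕜 n a b) (ω : ℝ), 0 ≤ ω ∧
      ∀ x z, (x, z) ∈ opGraph P 0 W a b →
        RCLike.re (inner 𝕜 (S x) (S z)) ≤ ω * ‖S x‖ ^ 2 := by
  set ε : ℝ := (1 + ‖matOp M‖)⁻¹ with hε
  have hε0 : 0 < ε := by positivity
  have hεM : ε * ‖matOp M‖ ≤ 1 := by
    rw [hε, inv_mul_le_iff₀ (by positivity)]
    linarith
  set wp := affineWeight a b 1 ε with hwp
  set wm := affineWeight a b ε 1 with hwm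
  have hpos : ∀ ξ ∈ Set.Icc a b, 0 < wp ξ := fun ξ hξ => affineWeight_pos hab one_pos hε0 hξ
  have hpos' : ∀ ξ ∈ Set.Icc a b, 0 < wm ξ := fun ξ hξ => affineWeight_pos hab hε0 one_pos hξ
  have hcp : ContinuousOn wp (Set.Icc a b) := (continuous_affineWeight _ _ _ _).continuousOn
  have hcm : ContinuousOn wm (Set.Icc a b) := (continuous_affineWeight _ _ _ _).continuousOn
  have hF : MemLp (fun ξ => signOp P (wp ξ) (wm ξ)) ∞ (intervalMeasure a b) :=
    memLp_of_continuousOn (continuousOn_signOp hcp hcm) ∞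
  have hF' : MemLp (fun ξ => signOp P (wp ξ)⁻¹ (wm ξ)⁻¹) ∞ (intervalMeasure a b) :=
    memLp_of_continuousOn (continuousOn_signOp (hcp.inv₀ fun ξ hξ => (hpos ξ hξ).ne')
      (hcm.inv₀ fun ξ hξ => (hpos' ξ hξ).ne')) ∞
  set S := multEquiv _ _ hF hF'
    (fun ξ hξ => by
      rw [signOp_mul_signOp hP hu, mul_inv_cancel₀ (hpos ξ hξ).ne',
        mul_inv_cancel₀ (hpos' ξ hξ).ne', signOp_one_one hP hu])
    (fun ξ hξ => by
      rw [signOp_mul_signOp hP hu, inv_mul_cancel₀ (hpos ξ hξ).ne',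
        inv_mul_cancel₀ (hpos' ξ hξ).ne', signOp_one_one hP hu]) with hS
  -- The derivative of the weight, constant because the weights are affine.
  set D := signOp P ((ε - 1) / (b - a)) ((1 - ε) / (b - a)) with hD
  have hB : MemLp (fun _ : ℝ => matOp P * D) ∞ (intervalMeasure a b) :=
    memLp_of_continuousOn continuousOn_const ∞
  set B := multOp (fun _ : ℝ => matOp P * D) hB with hBdef
  set N := ‖B‖ * ‖(S.symm : StateSpace 𝕜 n a b →L[𝕜] StateSpace 𝕜 n a b)‖ with hN
  refine ⟨S, N, by positivity, ?_⟩
  rintro x z ⟨f, g, h, hx, hbv, hz⟩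
  have hv := h.clm_apply (Φ := fun ξ => signOp P (wp ξ) (wm ξ)) (Φ' := fun _ => D)
    (fun ξ => hasDerivAt_signOp (hasDerivAt_affineWeight a b 1 ε ξ)
      (hasDerivAt_affineWeight a b ε 1 ξ)) continuous_const
  have hSx : S x =ᵐ[intervalMeasure a b] fun ξ => signOp P (wp ξ) (wm ξ) (f ξ) := by
    filter_upwards [coeFn_multOp hF x, hx] with ξ h1 h2
    rw [hS, coe_multEquiv, h1, h2]
  have hSz : (S z + B x : StateSpace 𝕜 n a b) =ᵐ[intervalMeasure a b]
      fun ξ => matOp P (D (f ξ) + signOp P (wp ξ) (wm ξ) (g ξ)) := by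
    filter_upwards [coeFn_multOp hF z, coeFn_multOp hB x, hx, hz, Lp.coeFn_add (S z) (B x)]
      with ξ h1 h2 h3 h4 h5
    have h6 : matOp P (signOp P (wp ξ) (wm ξ) (g ξ)) = signOp P (wp ξ) (wm ξ) (matOp P (g ξ)) := by
      rw [← mul_apply_eq_comp, ← signOp_mul_matOp_comm hP hu, mul_apply_eq_comp]
    have h7 : z ξ = matOp P (g ξ) := by
      rw [h4, matOp_apply]
      simp
    rw [h5, Pi.add_apply, hS, coe_multEquiv, h1, hBdef, h2, h3, h7, map_add, h6,
      mul_apply_eq_comp, add_comm]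
  have henergy := hv.energy_identity hab.le (P := matOp P) (toEuclideanLin_isSymmetric hP)
  have hform := boundary_form_nonpos hP hu hε0.le hεM ((boundaryValue_eq_zero_iff hK hW f).1 hbv)
  rw [hwp, hwm, affineWeight_left, affineWeight_left, affineWeight_right hab,
    affineWeight_right hab] at henergy
  have h1 : RCLike.re (inner 𝕜 (S x) (S z + B x)) ≤ 0 := by
    rw [re_inner_eq_integral hab.le hSx hSz]
    linarith
  rw [inner_add_right, map_add] at h1
  have h2 : -RCLike.re (inner 𝕜 (S x) (B x)) ≤ ‖S x‖ * ‖B x‖ :=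
    (neg_le_abs _).trans ((RCLike.abs_re_le_norm _).trans (norm_inner_le_norm _ _))
  have h3 : ‖B x‖ ≤ N * ‖S x‖ := by
    have h4 : ‖x‖ ≤ ‖(S.symm : StateSpace 𝕜 n a b →L[𝕜] StateSpace 𝕜 n a b)‖ * ‖S x‖ := by
      simpa using (S.symm : StateSpace 𝕜 n a b →L[𝕜] StateSpace 𝕜 n a b).le_opNorm (S x)
    calc ‖B x‖ ≤ ‖B‖ * ‖x‖ := B.le_opNorm x
      _ ≤ ‖B‖ * (‖(S.symm : StateSpace 𝕜 n a b →L[𝕜] StateSpace 𝕜 n a b)‖ * ‖S x‖) := by gcongr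
      _ = _ := by ring
  nlinarith [norm_nonneg (S x)]

theorem hasDerivAt_exp_smul_op {V : Type*} [NormedAddCommGroup V] [NormedSpace 𝕜 V]
    [CompleteSpace V] [NormedSpace ℝ (V →L[𝕜] V)] [IsScalarTower ℝ 𝕜 (V →L[𝕜] V)]
    (G : V →L[𝕜] V) (c s : ℝ) :
    HasDerivAt (fun s : ℝ => expOp G (s - c)) (expOp G (s - c) * G) s := by
  have h1 := hasDerivAt_exp_smul_const (𝕂 := 𝕜) G ((s - c : ℝ) : 𝕜)
  have h2 : HasDerivAt (fun s : ℝ => ((s - c : ℝ) : 𝕜)) 1 s := by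
    have h3 : HasDerivAt (fun s : ℝ => (s : 𝕜)) 1 (s - c) := by
      simpa using (RCLike.ofRealCLM (K := 𝕜)).hasDerivAt (x := s - c)
    have h4 := HasDerivAt.scomp s h3 ((hasDerivAt_id s).sub_const c)
    rw [one_smul] at h4
    exact h4
  have h3 := HasDerivAt.scomp s h1 h2
  rw [one_smul] at h3
  exact h3

/-- Variation of constants for `λ f - P ∂f = y`. -/
theorem exists_solution (hab : a < b) (hu : IsUnit P) (lam : ℝ) :
    ∃ U : EuclideanSpace 𝕜 (Fin n) →L[𝕜] EuclideanSpace 𝕜 (Fin n),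
      ∀ y : StateSpace 𝕜 n a b, ∃ ζ : EuclideanSpace 𝕜 (Fin n), (y = 0 → ζ = 0) ∧
        ∀ c : EuclideanSpace 𝕜 (Fin n), ∃ f g : ℝ → EuclideanSpace 𝕜 (Fin n),
          IsH1 a b f g ∧ f a = c ∧ f b = U (c + ζ) ∧
          ∀ s, matOp P (g s) = (lam : 𝕜) • f s - y s := by
  have hd := (Matrix.isUnit_iff_isUnit_det P).1 hu
  have hPP : matOp P * matOp P⁻¹ = 1 := by
    rw [← matOp_mul, Matrix.mul_nonsing_inv _ hd, matOp_one]
  set G : EuclideanSpace 𝕜 (Fin n) →L[𝕜] EuclideanSpace 𝕜 (Fin n) := (lam : 𝕜) • matOp P⁻¹ with hG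
  -- `f(s) = exp ((s - a) G) (c + ∫ₐˢ q)` with `G = λ P⁻¹`; `ζ` is the full integral of `q`.
  refine ⟨expOp G (b - a), fun y => ?_⟩
  set q : ℝ → EuclideanSpace 𝕜 (Fin n) := fun s => -expOp G (a - s) (matOp P⁻¹ (y s)) with hq
  have hΦ := hasDerivAt_exp_smul_op G a
  have hcont : Continuous fun s : ℝ => expOp G (s - a) :=
    continuous_iff_continuousAt.2 fun s => (hΦ s).continuousAt
  have hcont' : Continuous fun s : ℝ => expOp G (a - s) := by
    have h1 : Continuous fun s : ℝ => expOp G s := by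
      have := hcont.comp (continuous_id.add continuous_const : Continuous fun s : ℝ => s + a)
      simpa [Function.comp_def] using this
    exact h1.comp (continuous_const.sub continuous_id)
  have hqm : MemLp q 2 (intervalMeasure a b) := by
    refine MemLp.neg ?_
    exact (ContinuousLinearMap.id 𝕜
      (EuclideanSpace 𝕜 (Fin n) →L[𝕜] EuclideanSpace 𝕜 (Fin n))).memLp_of_bilin 2
      (memLp_of_continuousOn hcont'.continuousOn ∞) ((matOp P⁻¹).comp_memLp' (Lp.memLp y))
  refine ⟨∫ s in a..b, q s, fun hy => ?_, fun c => ?_⟩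
  · rw [intervalIntegral.integral_of_le hab.le, ← integral_Icc_eq_integral_Ioc]
    refine integral_eq_zero_of_ae ?_
    filter_upwards [Lp.coeFn_zero (EuclideanSpace 𝕜 (Fin n)) 2 (intervalMeasure a b)] with s hs
    have h1 : y s = 0 := by
      rw [hy]
      exact hs
    simp [hq, h1]
  · have hz : IsH1 a b (fun s => c + ∫ t in a..s, q t) q := ⟨hqm, fun ξ _ => by simp⟩
    have hf := hz.clm_apply hΦ (hcont.mul continuous_const)
    refine ⟨_, _, hf, by simp [expOp_zero], rfl, fun s => ?_⟩
    have hcomm : expOp G (s - a) * G = G * expOp G (s - a) := commute_expOp (Commute.refl G) _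
    have hinv : expOp G (s - a) * expOp G (a - s) = 1 := by
      rw [← expOp_add, sub_add_sub_cancel, sub_self, expOp_zero]
    have h1 : expOp G (s - a) (q s) = -matOp P⁻¹ (y s) := by
      rw [hq, map_neg, ← mul_apply_eq_comp, hinv, one_apply_eq_self]
    have h2 : ∀ v, matOp P (matOp P⁻¹ v) = v := fun v => by
      rw [← mul_apply_eq_comp, hPP, one_apply_eq_self]
    have h3 : ∀ v, matOp P (G v) = (lam : 𝕜) • v := fun v => by
      rw [hG, smul_apply, map_smul, h2]
    rw [h1, hcomm, map_add, map_neg, h2, mul_apply_eq_comp, h3]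
    exact (sub_eq_add_neg _ _).symm

theorem isQuasiMDissipative_opA (hab : a < b) (hP : P.IsHermitian) (hu : IsUnit P)
    {K M : Matrix (Fin n) (Fin n) 𝕜} (hK : IsUnit K) {W : Matrix (Fin n) (Fin n ⊕ Fin n) 𝕜}
    (hW : W = K * Matrix.fromCols (Qplus P - M * Qminus P) (Qminus P - M * Qplus P)) :
    ∃ (S : StateSpace 𝕜 n a b ≃L[𝕜] StateSpace 𝕜 n a b) (ω : ℝ), 0 ≤ ω ∧
      IsQuasiMDissipative (opA P 0 W a b) S ω := by
  obtain ⟨S, ω, hω, hdiss⟩ := exists_dissipative hab hP hu hK hW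
  rw [← opA_graph P 0 W hab] at hdiss
  refine ⟨S, ω, hω, hdiss, ω + 1, fun lam hlam y => ?_⟩
  rw [opA_graph P 0 W hab] at hdiss ⊢
  obtain ⟨U, hU⟩ := exists_solution (𝕜 := 𝕜) hab hu lam
  have hmem : ∀ (x y : StateSpace 𝕜 n a b) (f g : ℝ → EuclideanSpace 𝕜 (Fin n)), IsH1 a b f g →
      x =ᵐ[intervalMeasure a b] f → boundaryValue W a b f = 0 →
      (∀ s, matOp P (g s) = (lam : 𝕜) • f s - y s) →
      (x, (lam : 𝕜) • x - y) ∈ opGraph P 0 W a b := by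
    intro x y f g h hx hbv hfg
    refine ⟨f, g, h, hx, hbv, ?_⟩
    filter_upwards [hx, Lp.coeFn_sub ((lam : 𝕜) • x) y, Lp.coeFn_smul (lam : 𝕜) x] with s h1 h2 h3
    simp only [Pi.zero_apply, map_zero, LinearMap.zero_apply, add_zero]
    rw [h2, Pi.sub_apply, h3, Pi.smul_apply, h1, ← hfg s, matOp_apply]
  -- `V c` is the boundary value of the homogeneous solution with `f(a) = c`; solving `λ x - A x =
  -- y` means solving for `c` with `V`.
  let V : EuclideanSpace 𝕜 (Fin n) →ₗ[𝕜] EuclideanSpace 𝕜 (Fin n) :=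
    (WithLp.linearEquiv 2 𝕜 (Fin n → 𝕜)).symm.toLinearMap ∘ₗ
      (W.toCols₁.mulVecLin ∘ₗ (WithLp.linearEquiv 2 𝕜 (Fin n → 𝕜)).toLinearMap ∘ₗ
        (U : EuclideanSpace 𝕜 (Fin n) →ₗ[𝕜] EuclideanSpace 𝕜 (Fin n)) +
      W.toCols₂.mulVecLin ∘ₗ (WithLp.linearEquiv 2 𝕜 (Fin n → 𝕜)).toLinearMap)
  have hbvV : ∀ (f : ℝ → EuclideanSpace 𝕜 (Fin n)) (c ζ : EuclideanSpace 𝕜 (Fin n)), f a = c →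
      f b = U (c + ζ) → boundaryValue W a b f = (V c).ofLp + W.toCols₁ *ᵥ (U ζ).ofLp := by
    intro f c ζ ha hb
    rw [boundaryValue, ha, hb, ← Matrix.fromCols_toCols W, Matrix.fromCols_mulVec]
    simp only [Function.comp_def, Sum.elim_inl, Sum.elim_inr]
    rw [map_add, WithLp.ofLp_add, Matrix.mulVec_add]
    exact add_right_comm _ _ _
  -- A kernel element would be an eigenfunction of `A` to an eigenvalue `λ > ω`, excluded by
  -- dissipativity. In finite dimension surjectivity follows.
  have hinj : Function.Injective V := by
    rw [← LinearMap.ker_eq_bot, LinearMap.ker_eq_bot']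
    intro c hc
    obtain ⟨ζ, hζ, hsol⟩ := hU 0
    obtain ⟨f, g, h, ha, hb, hfg⟩ := hsol c
    rw [hζ rfl] at hb
    have hbv : boundaryValue W a b f = 0 := by
      rw [hbvV f c 0 ha hb, hc]
      simp
    have hfm := memLp_of_continuousOn h.continuousOn 2
    have hg := hmem (hfm.toLp) 0 f g h hfm.coeFn_toLp hbv hfg
    rw [← opA_graph P 0 W hab] at hg hdiss
    have h1 := IsQuasiMDissipative.norm_le hdiss hg lam
    rw [sub_sub_cancel, map_zero, norm_zero] at h1
    have h2 : S hfm.toLp = 0 := by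
      rw [← norm_le_zero_iff]
      nlinarith [norm_nonneg (S hfm.toLp)]
    have h3 : hfm.toLp = 0 := (map_eq_zero_iff S S.injective).1 h2
    have h4 : f =ᵐ[intervalMeasure a b] 0 := by
      have := hfm.coeFn_toLp
      rw [h3] at this
      exact this.symm.trans (Lp.coeFn_zero _ _ _)
    have h5 : Set.EqOn f 0 (Set.Icc a b) :=
      Measure.eqOn_Icc_of_ae_eq volume hab.ne h4 h.continuousOn continuousOn_const
    rw [← ha, h5 (Set.left_mem_Icc.2 hab.le)]
    rfl
  obtain ⟨ζ, -, hsol⟩ := hU y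
  obtain ⟨c, hc⟩ := LinearMap.injective_iff_surjective.1 hinj
    (WithLp.toLp 2 (-(W.toCols₁ *ᵥ (U ζ).ofLp)))
  obtain ⟨f, g, h, ha, hb, hfg⟩ := hsol c
  have hfm := memLp_of_continuousOn h.continuousOn 2
  exact ⟨hfm.toLp, hmem _ y f g h hfm.coeFn_toLp (by rw [hbvV f c ζ ha hb, hc]; simp) hfg⟩

theorem generatesC0Semigroup_opA (hab : a < b) (hP : P.IsHermitian) (hu : IsUnit P)
    {P₀ : ℝ → Matrix (Fin n) (Fin n) 𝕜}
    (hP₀ : ∀ i j, MemLp (fun ξ => P₀ ξ i j) ∞ (intervalMeasure a b))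
    {K M : Matrix (Fin n) (Fin n) 𝕜} (hK : IsUnit K) {W : Matrix (Fin n) (Fin n ⊕ Fin n) 𝕜}
    (hW : W = K * Matrix.fromCols (Qplus P - M * Qminus P) (Qminus P - M * Qplus P)) :
    GeneratesC0Semigroup (opA P P₀ W a b) := by
  obtain ⟨S, ω, hω, hdiss⟩ := isQuasiMDissipative_opA hab hP hu hK hW
  obtain ⟨ω', hω', hdiss'⟩ := hdiss.add_bounded hω
    (multOp (fun ξ => matOp (P₀ ξ)) (memLp_matOp hP₀)) (A' := opA P P₀ W a b) (fun x z => by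
      rw [opA_graph P 0 W hab, opA_graph P P₀ W hab]
      exact mem_opGraph_iff_add P hP₀ W x z)
  exact hdiss'.generatesC0Semigroup hω'

end Generation
end HBCS

namespace HBCS

/-! ### Necessity: a generator forces the projection matrix to be invertible. -/

section Necessity

variable {𝕜 : Type*} [RCLike 𝕜] {n : ℕ} {a b : ℝ} {P : Matrix (Fin n) (Fin n) 𝕜}

theorem IsH1.of_hasDerivAt {f g : ℝ → EuclideanSpace 𝕜 (Fin n)} (h : ∀ s, HasDerivAt f (g s) s)
    (hg : Continuous g) : IsH1 a b f g :=
  ⟨memLp_of_continuousOn hg.continuousOn 2, fun ξ _ => by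
    rw [intervalIntegral.integral_eq_sub_of_hasDerivAt (fun x _ => h x)
      (hg.intervalIntegrable _ _), add_sub_cancel]⟩

theorem boundaryValue_eq (W : Matrix (Fin n) (Fin n ⊕ Fin n) 𝕜)
    (f : ℝ → EuclideanSpace 𝕜 (Fin n)) :
    boundaryValue W a b f = (matOp W.toCols₁ (f b) + matOp W.toCols₂ (f a)).ofLp := by
  rw [boundaryValue, ← Matrix.fromCols_toCols W, Matrix.fromCols_mulVec]
  rfl

theorem boundaryValue_add (W : Matrix (Fin n) (Fin n ⊕ Fin n) 𝕜)
    (f f' : ℝ → EuclideanSpace 𝕜 (Fin n)) :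
    boundaryValue W a b (f + f') = boundaryValue W a b f + boundaryValue W a b f' := by
  simp only [boundaryValue_eq, Pi.add_apply, map_add, ← WithLp.ofLp_add]
  congr 1
  abel

/-- Cauchy–Schwarz against the constant function equal to the integral itself. -/
theorem norm_integral_le_norm (x : StateSpace 𝕜 n a b) :
    ‖∫ s, x s ∂(intervalMeasure a b)‖ ≤
      (intervalMeasure a b).real Set.univ ^ (1 / (2 : ℝ)) * ‖x‖ := by
  have h1 := L2.inner_indicatorConstLp_eq_inner_setIntegral 𝕜 MeasurableSet.univ
    (measure_ne_top (intervalMeasure a b) _) (∫ s, x s ∂(intervalMeasure a b)) x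
  rw [setIntegral_univ, inner_self_eq_norm_sq_to_K] at h1
  have h2 := norm_inner_le_norm (𝕜 := 𝕜) (indicatorConstLp 2 MeasurableSet.univ
    (measure_ne_top (intervalMeasure a b) _) (∫ s, x s ∂(intervalMeasure a b))) x
  rw [h1, norm_indicatorConstLp (by norm_num) (by norm_num), norm_pow, RCLike.norm_ofReal,
    abs_norm, ENNReal.toReal_ofNat] at h2
  rcases (norm_nonneg (∫ s, x s ∂(intervalMeasure a b))).eq_or_lt with h0 | h0
  · rw [← h0]
    positivity
  · refine le_of_mul_le_mul_left ?_ h0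
    linarith

/-- Every boundary value is attained by an affine function depending linearly on it. -/
theorem exists_affine_lift (hab : a < b) (P : Matrix (Fin n) (Fin n) 𝕜)
    {W : Matrix (Fin n) (Fin n ⊕ Fin n) 𝕜} (hW : W.rank = n) :
    ∃ Λ Λ' : (Fin n → 𝕜) →L[𝕜] StateSpace 𝕜 n a b, ∀ r,
      ∃ f g : ℝ → EuclideanSpace 𝕜 (Fin n), IsH1 a b f g ∧ boundaryValue W a b f = r ∧
        Λ r =ᵐ[intervalMeasure a b] f ∧ Λ' r =ᵐ[intervalMeasure a b] fun s => matOp P (g s) := by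
  -- Full rank enters here: every vector is a boundary value.
  have hsurj : W.mulVecLin.range = ⊤ :=
    Submodule.eq_top_of_finrank_eq (by rw [← Matrix.rank, hW]; simp)
  obtain ⟨R, hR⟩ := W.mulVecLin.exists_rightInverse_of_surjective hsurj
  let α : (Fin n → 𝕜) →ₗ[𝕜] EuclideanSpace 𝕜 (Fin n) :=
    (WithLp.linearEquiv 2 𝕜 (Fin n → 𝕜)).symm.toLinearMap ∘ₗ LinearMap.funLeft 𝕜 𝕜 Sum.inr ∘ₗ R
  let β : (Fin n → 𝕜) →ₗ[𝕜] EuclideanSpace 𝕜 (Fin n) :=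
    (WithLp.linearEquiv 2 𝕜 (Fin n → 𝕜)).symm.toLinearMap ∘ₗ LinearMap.funLeft 𝕜 𝕜 Sum.inl ∘ₗ R
  let γ : (Fin n → 𝕜) →ₗ[𝕜] EuclideanSpace 𝕜 (Fin n) := (((b - a)⁻¹ : ℝ) : 𝕜) • (β - α)
  let c : EuclideanSpace 𝕜 (Fin n) →L[𝕜] StateSpace 𝕜 n a b :=
    Lp.constL 2 (intervalMeasure a b) 𝕜
  have hF : MemLp (fun s : ℝ => ((s - a : ℝ) : 𝕜) •
      (1 : EuclideanSpace 𝕜 (Fin n) →L[𝕜] EuclideanSpace 𝕜 (Fin n))) ∞ (intervalMeasure a b) := by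
    refine memLp_of_continuousOn (Continuous.continuousOn ?_) ∞
    have h : Continuous fun s : ℝ => ((s - a : ℝ) : 𝕜) :=
      RCLike.continuous_ofReal.comp (continuous_id.sub continuous_const)
    exact h.smul continuous_const
  have hc : ∀ v, c v =ᵐ[intervalMeasure a b] fun _ => v := fun v => Lp.coeFn_const 2 _ v
  refine ⟨LinearMap.toContinuousLinearMap (c.toLinearMap ∘ₗ α +
    (multOp _ hF).toLinearMap ∘ₗ c.toLinearMap ∘ₗ γ),
    LinearMap.toContinuousLinearMap (c.toLinearMap ∘ₗ (matOp P).toLinearMap ∘ₗ γ), fun r =>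
    ⟨fun s => α r + (s - a) • γ r, fun _ => γ r, ?_, ?_, ?_, ?_⟩⟩
  · refine IsH1.of_hasDerivAt (fun s => ?_) continuous_const
    have h := (((hasDerivAt_id s).sub_const a).smul_const (γ r)).const_add (α r)
    rw [one_smul] at h
    exact h
  · have h1 : α r + (b - a) • γ r = β r := by
      have h2 : (b - a) • γ r = β r - α r := by
        change (b - a) • ((((b - a)⁻¹ : ℝ) : 𝕜) • (β r - α r)) = _
        rw [← RCLike.real_smul_eq_coe_smul, smul_smul, mul_inv_cancel₀ (by linarith), one_smul]
      rw [h2, add_sub_cancel]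
    simp only [boundaryValue, sub_self, zero_smul, add_zero, h1]
    have h3 : (Sum.elim (β r) (α r) : Fin n ⊕ Fin n → 𝕜) = R r := by
      ext i
      cases i <;> rfl
    rw [h3]
    exact LinearMap.congr_fun hR r
  · have h0 : (c (α r) + multOp _ hF (c (γ r)) : StateSpace 𝕜 n a b) =ᵐ[intervalMeasure a b]
        fun s => α r + (s - a) • γ r := by
      filter_upwards [Lp.coeFn_add (c (α r)) (multOp _ hF (c (γ r))), hc (α r), hc (γ r),
        coeFn_multOp hF (c (γ r))] with s h1 h2 h3 h4
      rw [h1, Pi.add_apply, h2, h4, h3, smul_apply, one_apply_eq_self,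
        RCLike.real_smul_eq_coe_smul (K := 𝕜)]
    exact h0
  · exact hc (matOp P (γ r))

/-- The resolvent estimate bounds solutions of `P ∂f = λ f` by their boundary values. -/
theorem exists_boundary_bound (hab : a < b) {P₀ : ℝ → Matrix (Fin n) (Fin n) 𝕜}
    (hP₀ : ∀ i j, MemLp (fun ξ => P₀ ξ i j) ∞ (intervalMeasure a b))
    {W : Matrix (Fin n) (Fin n ⊕ Fin n) 𝕜} (hW : W.rank = n)
    (hgen : GeneratesC0Semigroup (opA P P₀ W a b)) :
    ∃ C lam₀ : ℝ, ∀ lam ≥ lam₀, ∀ f g : ℝ → EuclideanSpace 𝕜 (Fin n), IsH1 a b f g →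
      (∀ s, matOp P (g s) = (lam : 𝕜) • f s) →
        ‖matOp P (f b - f a)‖ ≤ C * (lam * ‖boundaryValue W a b f‖) := by
  obtain ⟨T, hT, hA⟩ := hgen
  obtain ⟨C, lam₀, hC, hlam₀, hres⟩ := hT.exists_resolvent_bound
  obtain ⟨Λ, Λ', hΛ⟩ := exists_affine_lift hab P hW
  set B := multOp (fun ξ => matOp (P₀ ξ)) (memLp_matOp hP₀) with hB
  set N := (intervalMeasure a b).real Set.univ ^ (1 / (2 : ℝ)) with hN
  -- `λ ≥ 2 C ‖B‖` absorbs the perturbation into half of the left side, and `λ ≥ 1` absorbs the `Λ'`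
  -- term.
  refine ⟨N * (2 * C * (‖Λ‖ + ‖Λ'‖) + ‖Λ‖), max (max lam₀ 1) (2 * (C * ‖B‖)),
    fun lam hlam f g h hfg => ?_⟩
  have hl0 : lam₀ ≤ lam := (le_max_left _ _).trans ((le_max_left _ _).trans hlam)
  have hl1 : 1 ≤ lam := (le_max_right _ _).trans ((le_max_left _ _).trans hlam)
  have hl2 : 2 * (C * ‖B‖) ≤ lam := (le_max_right _ _).trans hlam
  have hfm := memLp_of_continuousOn h.continuousOn 2
  set x : StateSpace 𝕜 n a b := hfm.toLp with hx
  have hxf : x =ᵐ[intervalMeasure a b] f := hfm.coeFn_toLp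
  set r := boundaryValue W a b f with hr
  obtain ⟨f₀, g₀, h₀, hbv₀, hΛf, hΛg⟩ := hΛ (-r)
  set y := x + Λ (-r) with hy
  have hmem : (y, (lam : 𝕜) • x + Λ' (-r)) ∈ opGraph P 0 W a b := by
    refine ⟨f + f₀, g + g₀, h.add h₀, (Lp.coeFn_add _ _).trans (hxf.add hΛf), ?_, ?_⟩
    · rw [boundaryValue_add, hbv₀, add_neg_cancel]
    · filter_upwards [Lp.coeFn_add ((lam : 𝕜) • x) (Λ' (-r)), Lp.coeFn_smul (lam : 𝕜) x, hxf, hΛg]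
        with s h1 h2 h3 h4
      simp only [Pi.zero_apply, map_zero, LinearMap.zero_apply, add_zero]
      rw [h1, Pi.add_apply, h2, Pi.smul_apply, h3, h4, ← hfg, Pi.add_apply, map_add]
      rfl
  rw [mem_opGraph_iff_add P hP₀, ← opA_graph P P₀ W hab] at hmem
  have h1 := hres lam hl0 _ _ ((hA _ _).1 hmem)
  have h2 : (lam : 𝕜) • y - ((lam : 𝕜) • x + Λ' (-r) + B y) =
      (lam : 𝕜) • Λ (-r) - Λ' (-r) - B y := by
    rw [hy, smul_add]
    abel
  rw [h2] at h1
  have hΛr : ‖Λ (-r)‖ ≤ ‖Λ‖ * ‖r‖ := by simpa using Λ.le_opNorm (-r)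
  have hΛr' : ‖Λ' (-r)‖ ≤ ‖Λ'‖ * ‖r‖ := by simpa using Λ'.le_opNorm (-r)
  have h3 : ‖(lam : 𝕜) • Λ (-r) - Λ' (-r) - B y‖ ≤
      lam * (‖Λ‖ * ‖r‖) + ‖Λ'‖ * ‖r‖ + ‖B‖ * ‖y‖ := by
    refine (norm_sub_le _ _).trans (add_le_add ((norm_sub_le _ _).trans (add_le_add ?_ hΛr'))
      (B.le_opNorm y))
    rw [norm_smul, RCLike.norm_ofReal, abs_of_nonneg (by linarith)]
    gcongr
  have h4 : lam * ‖y‖ ≤ 2 * C * (‖Λ‖ + ‖Λ'‖) * (lam * ‖r‖) := by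
    have h5 := h1.trans (mul_le_mul_of_nonneg_left h3 hC.le)
    have h6 : 2 * (C * ‖B‖) * ‖y‖ ≤ lam * ‖y‖ := by gcongr
    have h7 : 0 ≤ C * (‖Λ'‖ * ‖r‖) * (lam - 1) :=
      mul_nonneg (by positivity) (by linarith)
    nlinarith
  have h5 : lam * ‖x‖ ≤ (2 * C * (‖Λ‖ + ‖Λ'‖) + ‖Λ‖) * (lam * ‖r‖) := by
    have h6 : ‖x‖ ≤ ‖y‖ + ‖Λ‖ * ‖r‖ := by
      have : x = y - Λ (-r) := by rw [hy, add_sub_cancel_right]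
      rw [this]
      exact (norm_sub_le _ _).trans (by gcongr)
    nlinarith
  -- Integrating `P f' = λ f` converts the `L²` bound into one at the endpoints.
  have h6 : matOp P (f b - f a) = (lam : 𝕜) • ∫ s, x s ∂(intervalMeasure a b) := by
    have hi := (intervalIntegrable_iff_integrableOn_Icc_of_le hab.le).2 h.intervalIntegrable
    rw [h.eq_integral b (Set.right_mem_Icc.2 hab.le), add_sub_cancel_left,
      ← (matOp P).intervalIntegral_comp_comm hi]
    simp only [hfg]
    rw [intervalIntegral.integral_smul, intervalIntegral.integral_of_le hab.le,
      ← integral_Icc_eq_integral_Ioc, integral_congr_ae hxf]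
  rw [h6, norm_smul, RCLike.norm_ofReal, abs_of_nonneg (by linarith)]
  calc lam * ‖∫ s, x s ∂(intervalMeasure a b)‖ ≤ lam * (N * ‖x‖) := by
        gcongr
        exact norm_integral_le_norm x
    _ = N * (lam * ‖x‖) := by ring
    _ ≤ N * ((2 * C * (‖Λ‖ + ‖Λ'‖) + ‖Λ‖) * (lam * ‖r‖)) := by gcongr
    _ = _ := by ring

theorem tendsto_mul_exp_neg_mul {c : ℝ} (hc : 0 < c) :
    Tendsto (fun lam : ℝ => lam * Real.exp (-(lam * c))) atTop (𝓝 0) := by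
  have h := tendsto_rpow_mul_exp_neg_mul_atTop_nhds_zero 1 c hc
  refine h.congr fun lam => ?_
  rw [Real.rpow_one, neg_mul, mul_comm c]

/-- Solutions of `P ∂f = λ f` concentrated at the inflow boundary as `λ → ∞`. -/
theorem exists_concentrating_solutions (hab : a < b) (hP : P.IsHermitian) (hu : IsUnit P)
    (u : EuclideanSpace 𝕜 (Fin n)) :
    ∃ F : ℝ → ℝ → EuclideanSpace 𝕜 (Fin n),
      (∀ lam : ℝ, ∃ g, IsH1 a b (F lam) g ∧ ∀ s, matOp P (g s) = (lam : 𝕜) • F lam s) ∧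
      Tendsto (fun lam : ℝ => lam • (F lam b - matOp (projPlus P) u)) atTop (𝓝 0) ∧
      Tendsto (fun lam : ℝ => lam • (F lam a - matOp (projMinus P) u)) atTop (𝓝 0) := by
  set e := hP.eigenvectorBasis with he
  set μ := hP.eigenvalues with hμ
  have heig : ∀ i, P.toEuclideanLin (e i) = (μ i : 𝕜) • e i := toEuclideanLin_eigenvectorBasis hP
  have hμ0 : ∀ i, μ i ≠ 0 := eigenvalues_ne_zero hP hu
  -- The inflow endpoint of the `i`-th mode: `exp (λ (s - p i) / μ i)` equals `1` there and is
  -- exponentially small at the other end.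
  set p : Fin n → ℝ := fun i => if 0 < μ i then b else a with hp
  set w : Fin n → EuclideanSpace 𝕜 (Fin n) := fun i => inner 𝕜 (e i) u • e i with hw
  have hPw : ∀ i, matOp P (w i) = (μ i : 𝕜) • w i := fun i => by
    rw [hw, map_smul, matOp_apply, heig, smul_comm]
  have hsum : ∀ A : EuclideanSpace 𝕜 (Fin n) →L[𝕜] EuclideanSpace 𝕜 (Fin n),
      A u = ∑ i, A (w i) := fun A => by
    rw [← map_sum, hw, e.sum_repr']
  have hplus : ∀ i, matOp (projPlus P) (w i) = (if 0 < μ i then (1 : ℝ) else 0) • w i := by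
    intro i
    split_ifs with h
    · rw [one_smul, hw, map_smul, matOp_apply, projPlus_apply_of_pos (heig i) h]
    · rw [zero_smul, hw, map_smul, matOp_apply,
        projPlus_apply_of_nonpos hP (heig i) (not_lt.1 h), smul_zero]
  have hminus : ∀ i, matOp (projMinus P) (w i) = (if 0 < μ i then (0 : ℝ) else 1) • w i := by
    intro i
    split_ifs with h
    · rw [zero_smul, hw, map_smul, matOp_apply, projMinus,
        projPlus_apply_of_nonpos hP.neg (eigenvector_neg (heig i)) (by linarith), smul_zero]
    · rw [one_smul, hw, map_smul, matOp_apply, projMinus,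
        projPlus_apply_of_pos (eigenvector_neg (heig i))
          (neg_pos.2 (lt_of_le_of_ne (not_lt.1 h) (hμ0 i)))]
  have hlim : ∀ (c : ℝ) (q : Fin n → ℝ),
      (∀ i, Tendsto (fun lam : ℝ => lam * (Real.exp (lam * ((c - p i) / μ i)) - q i)) atTop (𝓝 0)) →
      Tendsto (fun lam : ℝ => lam • (∑ i, Real.exp (lam * ((c - p i) / μ i)) • w i -
        ∑ i, q i • w i)) atTop (𝓝 0) := by
    intro c q h
    have h1 := tendsto_finsetSum Finset.univ fun i _ => (h i).smul_const (w i)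
    simp only [zero_smul, Finset.sum_const_zero] at h1
    refine h1.congr fun lam => ?_
    rw [← Finset.sum_sub_distrib, Finset.smul_sum]
    refine Finset.sum_congr rfl fun i _ => ?_
    rw [← sub_smul, smul_smul]
  refine ⟨fun lam s => ∑ i, Real.exp (lam * ((s - p i) / μ i)) • w i, fun lam =>
    ⟨fun s => ∑ i, (Real.exp (lam * ((s - p i) / μ i)) * (lam * (1 / μ i))) • w i,
      IsH1.of_hasDerivAt (fun s => ?_) ?_, fun s => ?_⟩, ?_, ?_⟩
  · refine HasDerivAt.fun_sum fun i _ => ?_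
    exact (((((hasDerivAt_id s).sub_const (p i)).div_const (μ i)).const_mul lam).exp).smul_const _
  · fun_prop
  · rw [map_sum, Finset.smul_sum]
    refine Finset.sum_congr rfl fun i _ => ?_
    simp only [RCLike.real_smul_eq_coe_smul (K := 𝕜)]
    rw [map_smul, hPw]
    generalize w i = z
    rw [smul_smul, smul_smul, ← RCLike.ofReal_mul, ← RCLike.ofReal_mul]
    congr 2
    field_simp [hμ0 i]
  · rw [hsum]
    simp only [hplus]
    refine hlim b _ fun i => ?_
    by_cases h : 0 < μ i
    · simp [hp, h]
    · have h1 : 0 < (b - a) / -μ i :=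
        div_pos (by linarith) (neg_pos.2 (lt_of_le_of_ne (not_lt.1 h) (hμ0 i)))
      simpa [hp, h, div_neg] using tendsto_mul_exp_neg_mul h1
  · rw [hsum]
    simp only [hminus]
    refine hlim a _ fun i => ?_
    by_cases h : 0 < μ i
    · have h1 := tendsto_mul_exp_neg_mul (div_pos (sub_pos.2 hab) h)
      simp only [hp, h, if_true, sub_zero]
      refine h1.congr fun lam => ?_
      congr 2
      ring
    · simp [hp, h]

/-- A kernel vector `u` would give concentrating solutions that nearly satisfy the boundary
condition while their endpoint difference tends to `P₊ u - P₋ u`, against the boundary bound. -/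
theorem isUnit_of_generatesC0Semigroup (hab : a < b) (hP : P.IsHermitian) (hu : IsUnit P)
    {P₀ : ℝ → Matrix (Fin n) (Fin n) 𝕜}
    (hP₀ : ∀ i j, MemLp (fun ξ => P₀ ξ i j) ∞ (intervalMeasure a b))
    {W : Matrix (Fin n) (Fin n ⊕ Fin n) 𝕜} (hW : W.rank = n)
    (hgen : GeneratesC0Semigroup (opA P P₀ W a b)) :
    IsUnit (W * Matrix.fromRows (projPlus P) (projMinus P)) := by
  rw [Matrix.isUnit_iff_isUnit_det, isUnit_iff_ne_zero]
  intro hdet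
  obtain ⟨v, hv0, hv⟩ := Matrix.exists_mulVec_eq_zero_iff.2 hdet
  set u : EuclideanSpace 𝕜 (Fin n) := WithLp.toLp 2 v with hudef
  obtain ⟨C, lam₀, hbd⟩ := exists_boundary_bound hab hP₀ hW hgen
  obtain ⟨F, hF, hFb, hFa⟩ := exists_concentrating_solutions hab hP hu u
  have hker : matOp W.toCols₁ (matOp (projPlus P) u) + matOp W.toCols₂ (matOp (projMinus P) u) =
      0 := by
    rw [← Matrix.fromCols_toCols W, Matrix.fromCols_mul_fromRows, Matrix.add_mulVec,
      ← Matrix.mulVec_mulVec, ← Matrix.mulVec_mulVec] at hv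
    exact (WithLp.ofLp_eq_zero 2).1 hv
  have hbv : Tendsto (fun lam : ℝ => lam * ‖boundaryValue W a b (F lam)‖) atTop (𝓝 0) := by
    have h1 := (((matOp W.toCols₁).continuous.tendsto 0).comp hFb).add
      (((matOp W.toCols₂).continuous.tendsto 0).comp hFa)
    rw [map_zero, map_zero, add_zero] at h1
    have h2 := ((PiLp.continuous_ofLp 2 fun _ : Fin n => 𝕜).tendsto 0).comp h1 |>.norm
    rw [WithLp.ofLp_zero, norm_zero] at h2
    refine h2.congr' ?_
    filter_upwards [eventually_ge_atTop 0] with lam hlam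
    have h3 : boundaryValue W a b (F lam) =
        (matOp W.toCols₁ (F lam b - matOp (projPlus P) u) +
          matOp W.toCols₂ (F lam a - matOp (projMinus P) u)).ofLp := by
      rw [boundaryValue_eq, map_sub, map_sub, sub_add_sub_comm, hker, sub_zero]
    rw [h3]
    simp only [Function.comp_apply, RCLike.real_smul_eq_coe_smul (K := 𝕜), map_smul]
    rw [← smul_add, WithLp.ofLp_smul, norm_smul, RCLike.norm_ofReal, abs_of_nonneg hlam]
  have hlim : ∀ {G : ℝ → EuclideanSpace 𝕜 (Fin n)} {w : EuclideanSpace 𝕜 (Fin n)},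
      Tendsto (fun lam : ℝ => lam • (G lam - w)) atTop (𝓝 0) → Tendsto G atTop (𝓝 w) := by
    intro G w h
    have h1 := (tendsto_inv_atTop_zero.smul h).add_const w
    rw [smul_zero, zero_add] at h1
    refine h1.congr' ?_
    filter_upwards [eventually_gt_atTop 0] with lam hlam
    rw [smul_smul, inv_mul_cancel₀ hlam.ne', one_smul, sub_add_cancel]
  have hleft : Tendsto (fun lam : ℝ => ‖matOp P (F lam b - F lam a)‖) atTop
      (𝓝 ‖matOp P (matOp (projPlus P) u - matOp (projMinus P) u)‖) :=
    (((matOp P).continuous.tendsto _).comp ((hlim hFb).sub (hlim hFa))).norm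
  have hzero : ‖matOp P (matOp (projPlus P) u - matOp (projMinus P) u)‖ ≤ C * 0 := by
    refine le_of_tendsto_of_tendsto hleft (hbv.const_mul C) ?_
    filter_upwards [eventually_ge_atTop lam₀] with lam hlam
    obtain ⟨g, hg, hfg⟩ := hF lam
    exact hbd lam hlam _ g hg hfg
  rw [mul_zero, norm_le_zero_iff] at hzero
  have hd := (Matrix.isUnit_iff_isUnit_det P).1 hu
  have h1 : signOp P 1 (-1) u = 0 := by
    have h3 : signOp P 1 (-1) u = matOp (projPlus P) u - matOp (projMinus P) u := by
      rw [signOp_eq, add_apply, smul_apply, smul_apply]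
      simp [sub_eq_add_neg]
    have h2 : matOp P⁻¹ (matOp P (signOp P 1 (-1) u)) = 0 := by
      rw [h3, hzero, map_zero]
    rwa [← mul_apply_eq_comp, ← matOp_mul, Matrix.nonsing_inv_mul _ hd, matOp_one,
      one_apply_eq_self] at h2
  -- `P₊ - P₋` is an involution.
  have h2 : u = 0 := by
    have h3 : signOp P 1 (-1) (signOp P 1 (-1) u) = u := by
      rw [← mul_apply_eq_comp, signOp_mul_signOp hP hu]
      norm_num
      rw [signOp_one_one hP hu, one_apply_eq_self]
    rw [← h3, h1, map_zero]
  exact hv0 (by simpa [hudef] using h2)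

end Necessity
end HBCS

/-! ### Assembly of the theorem. -/

open HBCS in
theorem mainTheorem3 {𝕜 : Type*} [RCLike 𝕜] {n : ℕ} {a b : ℝ} (hab : a < b)
    (P₁ : Matrix (Fin n) (Fin n) 𝕜) (hP₁ : P₁.IsHermitian) (hP₁_inv : IsUnit P₁)
    (P₀ : ℝ → Matrix (Fin n) (Fin n) 𝕜)
    (hP₀ : ∀ i j, MemLp (fun ξ => P₀ ξ i j) ∞ (volume.restrict (Set.Icc a b)))
    (W : Matrix (Fin n) (Fin n ⊕ Fin n) 𝕜) (hW : W.rank = n) :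
    ∃ J L : Matrix (Fin n) (Fin n) 𝕜,
      -- existence and uniqueness of the decomposition, and the formulas for `J` and `L`
      W = Matrix.fromCols (J * Qplus P₁ - L * Qminus P₁) (J * Qminus P₁ - L * Qplus P₁) ∧
      (∀ J' L' : Matrix (Fin n) (Fin n) 𝕜,
        W = Matrix.fromCols (J' * Qplus P₁ - L' * Qminus P₁) (J' * Qminus P₁ - L' * Qplus P₁) →
          J' = J ∧ L' = L) ∧
      J = W * Matrix.fromRows (Qplus P₁) (-Qminus P₁) * P₁⁻¹ ∧
      L = W * Matrix.fromRows (Qminus P₁) (-Qplus P₁) * P₁⁻¹ ∧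
      -- the equivalent statements
      List.TFAE [
        ∃ K M : Matrix (Fin n) (Fin n) 𝕜, IsUnit K ∧
          W = K * Matrix.fromCols (Qplus P₁ - M * Qminus P₁) (Qminus P₁ - M * Qplus P₁),
        IsUnit (W * Matrix.fromRows (projPlus P₁) (projMinus P₁)),
        GeneratesC0Semigroup (opA P₁ P₀ W a b),
        IsUnit J] ∧
      -- the formulas for `K` and `M`
      ∀ K M : Matrix (Fin n) (Fin n) 𝕜, IsUnit K →
        W = K * Matrix.fromCols (Qplus P₁ - M * Qminus P₁) (Qminus P₁ - M * Qplus P₁) →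
          K = W * Matrix.fromRows (Qplus P₁) (-Qminus P₁) * P₁⁻¹ ∧
          M = K⁻¹ * (W * Matrix.fromRows (Qminus P₁) (-Qplus P₁) * P₁⁻¹) := by
  -- A factorization as in (a) is a decomposition with `J = K` and `L = K M`, so uniqueness also
  -- gives the formulas for `K` and `M`.
  have hKM : ∀ K M : Matrix (Fin n) (Fin n) 𝕜,
      K * Matrix.fromCols (Qplus P₁ - M * Qminus P₁) (Qminus P₁ - M * Qplus P₁) =
        Matrix.fromCols (K * Qplus P₁ - K * M * Qminus P₁) (K * Qminus P₁ - K * M * Qplus P₁) :=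
    fun K M => by
      rw [Matrix.mul_fromCols, mul_sub, mul_sub, mul_assoc, mul_assoc]
  obtain ⟨J, L, hJL⟩ := exists_fromCols_eq hP₁ hP₁_inv W
  obtain ⟨hJ, hL⟩ := eq_of_fromCols_eq hP₁ hP₁_inv hJL
  refine ⟨J, L, hJL, fun J' L' h => ?_, hJ, hL, ?_, fun K M hK h => ?_⟩
  · obtain ⟨hJ', hL'⟩ := eq_of_fromCols_eq hP₁ hP₁_inv h
    exact ⟨hJ'.trans hJ.symm, hL'.trans hL.symm⟩
  · tfae_have 1 → 3 := fun ⟨K, M, hK, h⟩ => generatesC0Semigroup_opA hab hP₁ hP₁_inv hP₀ hK h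
    tfae_have 3 → 2 := isUnit_of_generatesC0Semigroup hab hP₁ hP₁_inv hP₀ hW
    tfae_have 2 → 4 := fun h => by
      rw [mul_projections_eq hP₁ hP₁_inv hJL] at h
      rwa [(isUnit_Qplus_add_Qminus hP₁ hP₁_inv).mul_right_iff] at h
    tfae_have 4 → 1 := fun h => by
      refine ⟨J, J⁻¹ * L, h, ?_⟩
      rw [hKM, Matrix.mul_nonsing_inv_cancel_left _ _ ((Matrix.isUnit_iff_isUnit_det J).1 h)]
      exact hJL
    tfae_finish
  · rw [hKM] at h
    obtain ⟨h1, h2⟩ := eq_of_fromCols_eq hP₁ hP₁_inv h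
    refine ⟨h1, ?_⟩
    rw [← h2, Matrix.nonsing_inv_mul_cancel_left _ _ ((Matrix.isUnit_iff_isUnit_det K).1 hK)]
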